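/- A \emph{labeled circle tree} on $n$ points is a tree on $n$ vertices, which are labeled $1,\dots,n$ and placed on a circle in counterclockwise order; its edges are drawn as straight chords. Two such trees are the same if they have the same edges. Spread every vertex of degree $k$ into $k$ consecutive points of the circle, one for each of its edges, in such a way that edges with a common vertex do not cross; this gives $N=2(n-1)$ points, numbered $1,\dots,N$ counterclockwise. Let $\alpha$ be the matching of these points that exchanges the two ends of every edge, let $\sigma=(1\,2\,\cdots\,N)$, and let $z(\pi)$ be the number of cycles of a permutation $\pi$, fixed points included. The \emph{genus} of the tree is $$1+\tfrac12\bigl(N-1-z(\alpha)-z(\alpha^{-1}\sigma)\bigr).$$ Let $f(n)$ be the number of labeled circle trees of genus one on $n$ points. A \emph{negligent number} is $0$ or an integer that can be generated from $1$ by finitely many (possibly zero) applications, in any order, of the maps $k\mapsto 2k$ and $k\mapsto 4k+1$. \textbf{Theorem.} Let $n>3$ be an integer. Then $f(n)$ is divisible by $n$, or $n$ is even and $f(n)$ is divisible by $n/2$. Moreover, $f(n)$ is not divisible by $n$ if and only if $n$ has one of the following forms: \begin{itemize} \item $n=32v+10$ with $v$ a negligent number; \item $n=64v+18$ with $v$ a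 negligent number; \item $n=64\cdot 2^k v+16\cdot 2^k+2$ with an integer $k\ge 1$ and $v$ a negligent number. \end{itemize} -/

import Mathlib

namespace CircleTree

variable {n : ℕ}

/-- The position of a half-edge on the circle. The points `0, …, n - 1` of `Fin n` stand
counterclockwise on the circle, and a half-edge `d` (an edge with a chosen start point `d.fst`) has
the position `(d.fst, c)`, where `c` is the number of steps that lead clockwise from `d.fst` to
`d.snd`. -/
def position (G : SimpleGraph (Fin n)) (d : G.Dart) : Fin n ×ₗ Fin n :=
  toLex (d.fst, d.fst - d.snd)

theorem position_injective (G : SimpleGraph (Fin n)) : Function.Injective (position G) := by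
  intro d e h
  have : NeZero n := ⟨by have := d.fst.isLt; omega⟩
  have h' : (d.fst, d.fst - d.snd) = (e.fst, e.fst - e.snd) := toLex.injective h
  obtain ⟨h1, h2⟩ := Prod.mk.inj h'
  rw [h1] at h2
  exact SimpleGraph.Dart.ext _ _ (Prod.ext h1 (sub_right_injective h2))

/-- The order of the half-edges in counterclockwise direction along the circle. Every vertex of
degree `k` is spread to `k` consecutive points of the circle, one for each of its edges, in such a
way that edges with a common vertex do not cross: the ends at a vertex `i` are ordered
counterclockwise by the clockwise distance from `i` to the other end of the edge. -/
noncomputable abbrev circularOrder (G : SimpleGraph (Fin n)) : LinearOrder G.Dart :=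
  LinearOrder.lift' (position G) (position_injective G)

noncomputable instance dartFintype (G : SimpleGraph (Fin n)) : Fintype G.Dart :=
  Fintype.ofInjective (position G) (position_injective G)

/-- The counterclockwise numbering of the half-edges. -/
noncomputable def numbering (G : SimpleGraph (Fin n)) : Fin (Fintype.card G.Dart) ≃ G.Dart :=
  letI := circularOrder G
  (monoEquivOfFin G.Dart rfl).toEquiv

/-- The cyclic permutation `σ = (1 2 … N)` of the `N` half-edges, numbered counterclockwise. -/
noncomputable def rotation (G : SimpleGraph (Fin n)) : Equiv.Perm G.Dart :=
  (numbering G).permCongr (finRotate (Fintype.card G.Dart))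

/-- The matching `α` of a labeled circle graph: it exchanges the two halves of every edge. -/
def matching (G : SimpleGraph (Fin n)) : Equiv.Perm G.Dart :=
  SimpleGraph.Dart.symm_involutive.toPerm

/-- The number `z(π)` of cycles of a permutation, fixed points included. -/
noncomputable def cycleCount {X : Type*} (π : Equiv.Perm X) : ℕ :=
  Nat.card (Quotient (Equiv.Perm.SameCycle.setoid π))

/-- The genus `1 + (N - 1 - z(α) - z(α⁻¹ σ)) / 2` of a labeled circle graph on the points `Fin n`,
with `N` the number of half-edges (`N = 2 (n - 1)` for a tree). -/
noncomputable def genus (G : SimpleGraph (Fin n)) : ℚ :=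
  1 + (1 / 2 : ℚ) * ((Fintype.card G.Dart : ℚ) - 1 - (cycleCount (matching G) : ℚ)
    - (cycleCount ((matching G)⁻¹ * rotation G) : ℚ))

/-- The number `f(n)` of labeled circle trees of genus one on `n` points. -/
noncomputable def f (n : ℕ) : ℕ :=
  Nat.card {G : SimpleGraph (Fin n) // G.IsTree ∧ genus G = 1}

/-- The integers generated from `1` by the maps `k ↦ 2 k` and `k ↦ 4 k + 1`. -/
inductive GeneratedFromOne : ℕ → Prop
  | one : GeneratedFromOne 1
  | double (k : ℕ) : GeneratedFromOne k → GeneratedFromOne (2 * k)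
  | quadruple (k : ℕ) : GeneratedFromOne k → GeneratedFromOne (4 * k + 1)

/-- Negligent numbers: `0` and the integers generated from `1` by `k ↦ 2 k`, `k ↦ 4 k + 1`. -/
def IsNegligent (v : ℕ) : Prop := v = 0 ∨ GeneratedFromOne v

end CircleTree

/-! The rotations of the circle form a group of order `n` that acts on the trees of genus one. The
stabilizer of a tree has order dividing `n`; if it acted freely on the `n - 1` edges, its order
would also divide `n - 1` and be 1. So a tree with a nontrivial symmetry has one that exchanges the
ends of an edge: it is the half-turn, and the edge is a diameter (`exists_halfTurn`). For odd `n`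
all orbits are therefore free. For `n = 2m`, a tree with half-turn symmetry contains exactly one
diameter, because an automorphism that flips an edge exchanges the two components left by deleting
it. Hence `f n = n a + m b`, where `b` counts those trees that contain the diameter from `0` to `m`
(`exists_f_eq`), and everything depends on the parity of `b`.

The genus is made combinatorial as follows. Functions to the field with two elements that are
constant on the cycles of `α⁻¹ σ` correspond, up to a constant, to the kernel of the crossing matrix
of the edges. The genus is thus half the rank of this alternating matrix, and it is one exactly if
the crossing edges form a complete bipartite or tripartite graph (`genus_eq_one_iff`).

Reflection is an involution on the `b` trees, so modulo 2 only the trees invariant under half-turn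
and reflection count. For even `m` there are none: half-turn times reflection flips the diameter and
fixes a point. For `m = 2q + 1`, folding the circle by this Klein four-group identifies them with
noncrossing trees on a line `0, …, q` that carry a nonempty nested set of twisted edges
(`card_reflect_symmetricTrees`). Reflecting the inside of the outermost twisted edge cancels in
pairs all those with several twisted edges; the rest are counted by the sum of `t(x) t(q - x)` over
`1 ≤ x < q`, where `t(h)` is the number of noncrossing trees on `h + 1` points. Pairing `x` with `q
- x` leaves `t(v)²` if `q = 2v`, and an even number otherwise (`odd_card_twistedTrees`).

The mirror image of a noncrossing tree gives, modulo 2, `t(2h) = t(h)`, `t(4k + 1) = t(k)` and `t(4k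
+ 3) = 0`, so `t(v)` is odd exactly if `v` is negligent (`odd_treeCount_iff`). Hence `n` fails to
divide `f n` exactly if `n = 8v + 2` with `v ≥ 1` negligent, and writing `v = 2^j (4w + 1)` gives
the three families for `j = 0`, `j = 1` and `j ≥ 2`. -/

namespace CircleTree

/-! ### Connectedness and noncrossing trees on a line -/

/-- Two natural numbers are joined by a finite set of arcs `(i, j)`. -/
def Joined (E : Finset (ℕ × ℕ)) : ℕ → ℕ → Prop :=
  Relation.EqvGen fun i j => (i, j) ∈ E

theorem Joined.refl {E : Finset (ℕ × ℕ)} (u : ℕ) : Joined E u u := Relation.EqvGen.refl u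

theorem Joined.symm {E : Finset (ℕ × ℕ)} {u v : ℕ} (h : Joined E u v) : Joined E v u :=
  Relation.EqvGen.symm _ _ h

theorem Joined.trans {E : Finset (ℕ × ℕ)} {u v w : ℕ} (h : Joined E u v) (h' : Joined E v w) :
    Joined E u w :=
  Relation.EqvGen.trans _ _ _ h h'

theorem Joined.of_mem {E : Finset (ℕ × ℕ)} {u v : ℕ} (h : (u, v) ∈ E) : Joined E u v :=
  Relation.EqvGen.rel _ _ h

theorem Joined.map {E F : Finset (ℕ × ℕ)} (φ : ℕ → ℕ)
    (hφ : ∀ i j, (i, j) ∈ E → Joined F (φ i) (φ j)) {u v : ℕ} (h : Joined E u v) :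
    Joined F (φ u) (φ v) := by
  induction h with
  | rel x y h => exact hφ _ _ h
  | refl x => exact .refl _
  | symm x y _ ih => exact ih.symm
  | trans x y z _ _ ih1 ih2 => exact ih1.trans ih2

theorem Joined.mono {E F : Finset (ℕ × ℕ)} (hEF : E ⊆ F) {u v : ℕ} (h : Joined E u v) :
    Joined F u v :=
  h.map id fun _ _ h => .of_mem (hEF h)

theorem Joined.cases_insert {E : Finset (ℕ × ℕ)} {e : ℕ × ℕ} {u v : ℕ}
    (h : Joined (insert e E) u v) :
    Joined E u v ∨ (Joined E u e.1 ∧ Joined E e.2 v) ∨ (Joined E u e.2 ∧ Joined E e.1 v) := by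
  induction h with
  | rel x y h =>
    rcases Finset.mem_insert.1 h with rfl | h
    · exact Or.inr (Or.inl ⟨.refl _, .refl _⟩)
    · exact Or.inl (.of_mem h)
  | refl x => exact Or.inl (.refl _)
  | symm x y _ ih =>
    rcases ih with h | ⟨h1, h2⟩ | ⟨h1, h2⟩
    · exact Or.inl h.symm
    · exact Or.inr (Or.inr ⟨h2.symm, h1.symm⟩)
    · exact Or.inr (Or.inl ⟨h2.symm, h1.symm⟩)
  | trans x y z _ _ ih1 ih2 =>
    rcases ih1 with h | ⟨h1, h2⟩ | ⟨h1, h2⟩ <;> rcases ih2 with h' | ⟨h3, h4⟩ | ⟨h3, h4⟩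
    · exact Or.inl (h.trans h')
    · exact Or.inr (Or.inl ⟨h.trans h3, h4⟩)
    · exact Or.inr (Or.inr ⟨h.trans h3, h4⟩)
    · exact Or.inr (Or.inl ⟨h1, h2.trans h'⟩)
    · exact Or.inr (Or.inl ⟨h1, h4⟩)
    · exact Or.inl (h1.trans h4)
    · exact Or.inr (Or.inr ⟨h1, h2.trans h'⟩)
    · exact Or.inl (h1.trans h4)
    · exact Or.inr (Or.inr ⟨h1, h4⟩)

/-- A set of vertices has at least `|W| - |E|` elements that are pairwise not joined. -/
theorem exists_pairwise_not_joined (E : Finset (ℕ × ℕ)) (W : Finset ℕ) :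
    ∃ R ⊆ W, W.card ≤ R.card + E.card ∧ ∀ u ∈ R, ∀ v ∈ R, Joined E u v → u = v := by
  classical
  induction E using Finset.induction_on with
  | empty =>
    refine ⟨W, subset_rfl, by simp, fun u _ v _ h => ?_⟩
    induction h with
    | rel x y h => simp at h
    | refl => rfl
    | symm _ _ _ ih => exact (ih ‹_› ‹_›).symm
    | trans x y z h1 h2 _ _ =>
      -- The induction hypotheses are not available here, since the middle point need not lie in
      -- `W`.
      have key : ∀ x y, Joined ∅ x y → x = y := by
        intro x y h
        induction h with
        | rel x y h => simp at h
        | refl => rfl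
        | symm _ _ _ ih => exact ih.symm
        | trans _ _ _ _ _ ih1 ih2 => exact ih1.trans ih2
      exact (key _ _ h1).trans (key _ _ h2)
  | insert e E he ih =>
    obtain ⟨R, hRW, hcard, hR⟩ := ih
    -- The new arc only merges the class of `e.1` with another one, so it suffices to drop the
    -- representative of that class, and there is at most one.
    refine ⟨R.filter fun r => ¬ Joined E e.1 r, (Finset.filter_subset _ _).trans hRW, ?_, ?_⟩
    · have h1 : (R.filter fun r => Joined E e.1 r).card ≤ 1 := by
        refine Finset.card_le_one.2 fun u hu v hv => ?_
        rw [Finset.mem_filter] at hu hv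
        exact hR u hu.1 v hv.1 (hu.2.symm.trans hv.2)
      have h2 := Finset.card_filter_add_card_filter_not (s := R) (fun r => Joined E e.1 r)
      rw [Finset.card_insert_of_notMem he]
      omega
    · intro u hu v hv h
      rw [Finset.mem_filter] at hu hv
      rcases h.cases_insert with h | ⟨h, -⟩ | ⟨-, h⟩
      · exact hR u hu.1 v hv.1 h
      · exact absurd h.symm hu.2
      · exact absurd h hv.2

/-- Each arc lowers the number of classes by at most one. The arcs may leave the interval, which
later allows counting without further bounds. -/
theorem le_card_of_joined {E : Finset (ℕ × ℕ)} {a b : ℕ}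
    (h : ∀ v, a ≤ v → v ≤ b → Joined E a v) : b ≤ E.card + a := by
  obtain ⟨R, hRW, hcard, hR⟩ := exists_pairwise_not_joined E (Finset.Icc a b)
  have h1 : R.card ≤ 1 := by
    refine Finset.card_le_one.2 fun u hu v hv => hR u hu v hv ?_
    have hu' := Finset.mem_Icc.1 (hRW hu)
    have hv' := Finset.mem_Icc.1 (hRW hv)
    exact (h u hu'.1 hu'.2).symm.trans (h v hv'.1 hv'.2)
  rw [Nat.card_Icc] at hcard
  omega

/-- `E` is the set of edges `(i, j)`, `i < j`, of a noncrossing tree on the points `a, …, b` of a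
line, with its edges drawn as arcs above the line. -/
structure ArcTree (a b : ℕ) (E : Finset (ℕ × ℕ)) : Prop where
  bounds : ∀ i j, (i, j) ∈ E → a ≤ i ∧ i < j ∧ j ≤ b
  noncrossing : ∀ i j k l, (i, j) ∈ E → (k, l) ∈ E → i < k → k < j → j < l → False
  joined : ∀ v, a ≤ v → v ≤ b → Joined E a v
  card_add : E.card + a = b

/-- No arc of `E` passes strictly above `x`. -/
def Uncovered (E : Finset (ℕ × ℕ)) (x : ℕ) : Prop :=
  ∀ i j, (i, j) ∈ E → i < x → x < j → False

/-- The arcs of `E` inside the interval `[a, b]`. -/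
def inside (a b : ℕ) (E : Finset (ℕ × ℕ)) : Finset (ℕ × ℕ) :=
  E.filter fun e => a ≤ e.1 ∧ e.2 ≤ b

theorem mem_inside {a b i j : ℕ} {E : Finset (ℕ × ℕ)} :
    (i, j) ∈ inside a b E ↔ (i, j) ∈ E ∧ a ≤ i ∧ j ≤ b := by
  simp [inside]

/-- A tree has the least number of arcs that connects its points, so no arc can be spared. -/
theorem ArcTree.not_joined_erase {a b i j : ℕ} {E : Finset (ℕ × ℕ)} (hE : ArcTree a b E)
    (h : (i, j) ∈ E) : ¬ Joined (E.erase (i, j)) i j := by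
  intro hj
  have h1 := le_card_of_joined (E := E.erase (i, j)) (a := a) (b := b) fun v h1 h2 => by
    refine (hE.joined v h1 h2).map id fun k l hkl => ?_
    by_cases hc : (k, l) = (i, j)
    · cases hc
      exact hj
    · exact .of_mem (Finset.mem_erase.2 ⟨hc, hkl⟩)
  have := hE.card_add
  have := Finset.card_erase_add_one h
  omega

theorem ArcTree.joined_erase_or {a b i j v : ℕ} {E : Finset (ℕ × ℕ)} (hE : ArcTree a b E)
    (h : (i, j) ∈ E) (hv : a ≤ v) (hv' : v ≤ b) :
    Joined (E.erase (i, j)) i v ∨ Joined (E.erase (i, j)) j v := by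
  have hb := hE.bounds i j h
  have h1 := (hE.joined i (by omega) (by omega)).symm.trans (hE.joined v hv hv')
  rw [← Finset.insert_erase h] at h1
  rcases h1.cases_insert with h | ⟨-, h⟩ | ⟨-, h⟩
  · exact Or.inl h
  · exact Or.inr h
  · exact Or.inl h

/-- If a map of the points respects a tree and exchanges the ends of an edge, then it has
no fixed point. -/
theorem ArcTree.no_fixed_of_flip {a b i j v : ℕ} {E : Finset (ℕ × ℕ)} (hE : ArcTree a b E)
    (h : (i, j) ∈ E) (φ : ℕ → ℕ) (hi : φ i = j) (hj : φ j = i)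
    (hφ : ∀ k l, (k, l) ∈ E.erase (i, j) → Joined (E.erase (i, j)) (φ k) (φ l))
    (hv : a ≤ v) (hv' : v ≤ b) : ¬ Joined (E.erase (i, j)) v (φ v) := by
  intro hc
  -- The map exchanges the two components left by erasing the arc, so `v` and `φ v` cannot share
  -- one.
  rcases hE.joined_erase_or h hv hv' with h1 | h1
  · have h2 := h1.map φ hφ
    rw [hi] at h2
    exact hE.not_joined_erase h (h1.trans (hc.trans h2.symm))
  · have h2 := h1.map φ hφ
    rw [hj] at h2
    exact hE.not_joined_erase h (h2.trans (hc.symm.trans h1.symm))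

theorem ArcTree.le {a b : ℕ} {E : Finset (ℕ × ℕ)} (hE : ArcTree a b E) : a ≤ b := by
  have := hE.card_add
  omega

theorem inside_union_inside {a b x : ℕ} {E : Finset (ℕ × ℕ)}
    (hb : ∀ i j, (i, j) ∈ E → a ≤ i ∧ i < j ∧ j ≤ b) (hx : Uncovered E x) :
    inside a x E ∪ inside x b E = E := by
  ext ⟨i, j⟩
  rw [Finset.mem_union, mem_inside, mem_inside]
  constructor
  · rintro (h | h) <;> exact h.1
  · intro h
    have h0 := hb i j h
    by_cases h1 : j ≤ x
    · exact Or.inl ⟨h, by omega, h1⟩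
    · exact Or.inr ⟨h, by by_contra; exact hx i j h (by omega) (by omega), by omega⟩

theorem inside_union_left {a b x : ℕ} {E F : Finset (ℕ × ℕ)}
    (hE : ∀ i j, (i, j) ∈ E → a ≤ i ∧ i < j ∧ j ≤ x)
    (hF : ∀ i j, (i, j) ∈ F → x ≤ i ∧ i < j ∧ j ≤ b) : inside a x (E ∪ F) = E := by
  ext ⟨i, j⟩
  rw [mem_inside, Finset.mem_union]
  constructor
  · rintro ⟨h | h, h1⟩
    · exact h
    · have := hF i j h
      omega
  · intro h
    exact ⟨Or.inl h, by have := hE i j h; omega⟩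

theorem inside_union_right {a b x : ℕ} {E F : Finset (ℕ × ℕ)}
    (hE : ∀ i j, (i, j) ∈ E → a ≤ i ∧ i < j ∧ j ≤ x)
    (hF : ∀ i j, (i, j) ∈ F → x ≤ i ∧ i < j ∧ j ≤ b) : inside x b (E ∪ F) = F := by
  ext ⟨i, j⟩
  rw [mem_inside, Finset.mem_union]
  constructor
  · rintro ⟨h | h, h1⟩
    · have := hE i j h
      omega
    · exact h
  · intro h
    exact ⟨Or.inr h, by have := hF i j h; omega⟩

theorem disjoint_of_bounds {a b x : ℕ} {E F : Finset (ℕ × ℕ)}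
    (hE : ∀ i j, (i, j) ∈ E → a ≤ i ∧ i < j ∧ j ≤ x)
    (hF : ∀ i j, (i, j) ∈ F → x ≤ i ∧ i < j ∧ j ≤ b) : Disjoint E F := by
  rw [Finset.disjoint_left]
  rintro ⟨i, j⟩ h h'
  have := hE i j h
  have := hF i j h'
  omega

/-- An arc tree falls into two arc trees at a point that is not covered. -/
theorem ArcTree.split {a b x : ℕ} {E : Finset (ℕ × ℕ)} (hE : ArcTree a b E) (hx : Uncovered E x)
    (hax : a ≤ x) (hxb : x ≤ b) : ArcTree a x (inside a x E) ∧ ArcTree x b (inside x b E) := by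
  have hb1 : ∀ i j, (i, j) ∈ inside a x E → a ≤ i ∧ i < j ∧ j ≤ x := fun i j h => by
    rw [mem_inside] at h
    have := hE.bounds i j h.1
    omega
  have hb2 : ∀ i j, (i, j) ∈ inside x b E → x ≤ i ∧ i < j ∧ j ≤ b := fun i j h => by
    rw [mem_inside] at h
    have := hE.bounds i j h.1
    omega
  have hj1 : ∀ v, a ≤ v → v ≤ x → Joined (inside a x E) a v := fun v h1 h2 => by
    -- Clamping at `x` contracts all that lies beyond `x` to the point `x`; it respects the arcs
    -- because none passes above `x`.
    have := (hE.joined v h1 (h2.trans hxb)).map (F := inside a x E) (fun w => min w x) ?_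
    · rwa [min_eq_left hax, min_eq_left h2] at this
    · intro i j h
      have := hE.bounds i j h
      by_cases hc : j ≤ x
      · rw [min_eq_left hc, min_eq_left (by omega)]
        exact .of_mem (mem_inside.2 ⟨h, by omega, hc⟩)
      · have hi : x ≤ i := by
          by_contra
          exact hx i j h (by omega) (by omega)
        rw [min_eq_right hi, min_eq_right (by omega)]
        exact .refl _
  have hj2 : ∀ v, x ≤ v → v ≤ b → Joined (inside x b E) x v := fun v h1 h2 => by
    have := ((hE.joined x hax hxb).symm.trans (hE.joined v (hax.trans h1) h2)).map
      (F := inside x b E) (fun w => max w x) ?_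
    · rwa [max_self, max_eq_left h1] at this
    · intro i j h
      have := hE.bounds i j h
      by_cases hc : x ≤ i
      · rw [max_eq_left hc, max_eq_left (by omega)]
        exact .of_mem (mem_inside.2 ⟨h, by omega, by omega⟩)
      · have hi : j ≤ x := by
          by_contra
          exact hx i j h (by omega) (by omega)
        rw [max_eq_right hi, max_eq_right (by omega)]
        exact .refl _
  -- Both halves are connected and so have at least as many arcs as trees; the total number forces
  -- equality.
  have h1 := le_card_of_joined hj1
  have h2 := le_card_of_joined hj2
  have h3 := hE.card_add
  rw [← inside_union_inside hE.bounds hx,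
    Finset.card_union_of_disjoint (disjoint_of_bounds hb1 hb2)] at h3
  refine ⟨⟨hb1, fun i j k l h h' => ?_, hj1, by omega⟩, ⟨hb2, fun i j k l h h' => ?_, hj2, by omega⟩⟩
  · exact hE.noncrossing i j k l (mem_inside.1 h).1 (mem_inside.1 h').1
  · exact hE.noncrossing i j k l (mem_inside.1 h).1 (mem_inside.1 h').1

theorem ArcTree.union {a b x : ℕ} {E F : Finset (ℕ × ℕ)} (hE : ArcTree a x E)
    (hF : ArcTree x b F) : ArcTree a b (E ∪ F) := by
  have h1 := hE.le
  have h2 := hF.le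
  constructor
  · intro i j h
    rcases Finset.mem_union.1 h with h | h
    · have := hE.bounds i j h
      omega
    · have := hF.bounds i j h
      omega
  · intro i j k l h h' h3 h4 h5
    rcases Finset.mem_union.1 h with h | h <;> rcases Finset.mem_union.1 h' with h' | h'
    · exact hE.noncrossing i j k l h h' h3 h4 h5
    · have := hE.bounds i j h
      have := hF.bounds k l h'
      omega
    · have := hF.bounds i j h
      have := hE.bounds k l h'
      omega
    · exact hF.noncrossing i j k l h h' h3 h4 h5
  · intro v hv hv'
    by_cases hc : v ≤ x
    · exact (hE.joined v hv hc).mono Finset.subset_union_left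
    · exact ((hE.joined x h1 le_rfl).mono Finset.subset_union_left).trans
        ((hF.joined v (by omega) hv').mono Finset.subset_union_right)
  · rw [Finset.card_union_of_disjoint (disjoint_of_bounds hE.bounds hF.bounds)]
    have := hE.card_add
    have := hF.card_add
    omega

theorem ArcTree.uncovered_union {a b x : ℕ} {E F : Finset (ℕ × ℕ)} (hE : ArcTree a x E)
    (hF : ArcTree x b F) : Uncovered (E ∪ F) x := by
  intro i j h h1 h2
  rcases Finset.mem_union.1 h with h | h
  · have := hE.bounds i j h
    omega
  · have := hF.bounds i j h
    omega

/-- The image of a set of arcs under `w ↦ s - w`. -/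
def mirror (s : ℕ) (E : Finset (ℕ × ℕ)) : Finset (ℕ × ℕ) :=
  E.image fun e => (s - e.2, s - e.1)

theorem mem_mirror {a b s i j : ℕ} {E : Finset (ℕ × ℕ)}
    (hE : ∀ i j, (i, j) ∈ E → a ≤ i ∧ i < j ∧ j ≤ b) (hb : b ≤ s) (hi : i ≤ s) (hj : j ≤ s) :
    (i, j) ∈ mirror s E ↔ (s - j, s - i) ∈ E := by
  rw [mirror, Finset.mem_image]
  constructor
  · rintro ⟨⟨k, l⟩, h, h'⟩
    have := hE k l h
    simp only [Prod.mk.injEq] at h'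
    obtain ⟨rfl, rfl⟩ := h'
    rwa [show s - (s - k) = k by omega, show s - (s - l) = l by omega]
  · intro h
    exact ⟨_, h, by ext <;> dsimp only <;> omega⟩

theorem exists_of_mem_mirror {s i j : ℕ} {E : Finset (ℕ × ℕ)} (h : (i, j) ∈ mirror s E) :
    ∃ k l, (k, l) ∈ E ∧ i = s - l ∧ j = s - k := by
  rw [mirror, Finset.mem_image] at h
  obtain ⟨⟨k, l⟩, h, h'⟩ := h
  simp only [Prod.mk.injEq] at h'
  exact ⟨k, l, h, h'.1.symm, h'.2.symm⟩

theorem mirror_mirror {a b s : ℕ} {E : Finset (ℕ × ℕ)}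
    (hE : ∀ i j, (i, j) ∈ E → a ≤ i ∧ i < j ∧ j ≤ b) (hb : b ≤ s) :
    mirror s (mirror s E) = E := by
  rw [mirror, mirror, Finset.image_image]
  ext ⟨i, j⟩
  rw [Finset.mem_image]
  constructor
  · rintro ⟨⟨k, l⟩, h, h'⟩
    have := hE k l h
    simp only [Function.comp, Prod.mk.injEq] at h'
    obtain ⟨rfl, rfl⟩ := h'
    rwa [show s - (s - k) = k by omega, show s - (s - l) = l by omega]
  · intro h
    have := hE i j h
    exact ⟨(i, j), h, by ext <;> simp only [Function.comp] <;> omega⟩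

theorem card_mirror {a b s : ℕ} {E : Finset (ℕ × ℕ)}
    (hE : ∀ i j, (i, j) ∈ E → a ≤ i ∧ i < j ∧ j ≤ b) (hb : b ≤ s) :
    (mirror s E).card = E.card := by
  refine Finset.card_image_of_injOn ?_
  rintro ⟨i, j⟩ h ⟨k, l⟩ h' he
  have := hE i j h
  have := hE k l h'
  simp only [Prod.mk.injEq] at he ⊢
  omega

theorem ArcTree.arcTree_mirror {a b s : ℕ} {E : Finset (ℕ × ℕ)} (hE : ArcTree a b E) (hb : b ≤ s) :
    ArcTree (s - b) (s - a) (mirror s E) := by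
  have hab := hE.le
  constructor
  · intro i j h
    obtain ⟨k, l, hk, rfl, rfl⟩ := exists_of_mem_mirror h
    have := hE.bounds k l hk
    omega
  · intro i j k l h h' h1 h2 h3
    obtain ⟨i', j', hi, rfl, rfl⟩ := exists_of_mem_mirror h
    obtain ⟨k', l', hk, rfl, rfl⟩ := exists_of_mem_mirror h'
    have := hE.bounds _ _ hi
    have := hE.bounds _ _ hk
    exact hE.noncrossing _ _ _ _ hk hi (by omega) (by omega) (by omega)
  · intro v hv hv'
    have h1 := ((hE.joined b hab le_rfl).symm.trans
      (hE.joined (s - v) (by omega) (by omega))).map (F := mirror s E) (fun w => s - w) ?_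
    · rwa [show s - (s - v) = v by omega] at h1
    · intro i j h
      refine (Joined.of_mem ?_).symm
      exact Finset.mem_image.2 ⟨(i, j), h, rfl⟩
  · rw [card_mirror hE.bounds hb]
    have := hE.card_add
    omega

/-! ### Parity of the number of noncrossing trees -/

theorem even_card_of_involution {α : Type*} (s : Finset α) (g : α → α) (hg : ∀ a ∈ s, g a ∈ s)
    (hgg : ∀ a ∈ s, g (g a) = a) (hne : ∀ a ∈ s, g a ≠ a) : Even s.card := by
  have h : ∑ _a ∈ s, (1 : ZMod 2) = 0 :=
    Finset.sum_involution (fun a _ => g a) (fun _ _ => by decide) (fun a ha _ => hne a ha) hg hgg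
  rw [Finset.sum_const, nsmul_eq_mul, mul_one] at h
  exact ((ZMod.natCast_eq_zero_iff_even).1 h)

theorem odd_card_iff_of_involution {α : Type*} [DecidableEq α] (s : Finset α) (g : α → α)
    (hg : ∀ a ∈ s, g a ∈ s) (hgg : ∀ a ∈ s, g (g a) = a) :
    Odd s.card ↔ Odd (s.filter fun a => g a = a).card := by
  have h := even_card_of_involution (s.filter fun a => ¬ g a = a) g
    (fun a ha => by
      rw [Finset.mem_filter] at ha ⊢
      refine ⟨hg a ha.1, fun h => ha.2 ?_⟩
      rw [hgg a ha.1] at h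
      exact h.symm)
    (fun a ha => hgg a (Finset.mem_filter.1 ha).1) (fun a ha => (Finset.mem_filter.1 ha).2)
  rw [← Finset.card_filter_add_card_filter_not (s := s) (fun a => g a = a), Nat.odd_add]
  exact iff_true_right h

theorem Joined.exists_boundary {E : Finset (ℕ × ℕ)} {u v : ℕ} (h : Joined E u v) (p : ℕ → Prop)
    (hu : p u) (hv : ¬ p v) : ∃ i j, (i, j) ∈ E ∧ (p i ↔ ¬ p j) := by
  by_contra! hc
  have key : ∀ u v, Joined E u v → (p u ↔ p v) := by
    intro u v h
    induction h with
    | rel x y h =>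
      have := hc x y h
      tauto
    | refl x => exact Iff.rfl
    | symm x y _ ih => exact ih.symm
    | trans x y z _ _ ih1 ih2 => exact ih1.trans ih2
  exact hv ((key u v h).1 hu)

open Classical in
/-- The noncrossing trees on the points `0, …, n` of a line. -/
noncomputable def trees (n : ℕ) : Finset (Finset (ℕ × ℕ)) :=
  (Finset.Icc 0 n ×ˢ Finset.Icc 0 n).powerset.filter fun E => ArcTree 0 n E

theorem mem_trees {n : ℕ} {E : Finset (ℕ × ℕ)} : E ∈ trees n ↔ ArcTree 0 n E := by
  classical
  rw [trees, Finset.mem_filter, and_iff_right_iff_imp, Finset.mem_powerset]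
  rintro h ⟨i, j⟩ he
  have := h.bounds i j he
  simp only [Finset.mem_product, Finset.mem_Icc]
  omega

/-- The number of noncrossing trees on `n + 1` points of a line. -/
noncomputable def treeCount (n : ℕ) : ℕ := (trees n).card

-- An uncovered point cuts the tree into two independent trees. The right one is mirrored so that it
-- starts at `0`.
open Classical in
theorem card_trees_uncovered {n x : ℕ} (hx : x ≤ n) :
    ((trees n).filter fun E => Uncovered E x).card = treeCount x * treeCount (n - x) := by
  rw [treeCount, treeCount, ← Finset.card_product]
  symm
  refine Finset.card_bij (fun p _ => p.1 ∪ mirror n p.2) ?_ ?_ ?_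
  · rintro ⟨L, R⟩ h
    rw [Finset.mem_product, mem_trees, mem_trees] at h
    have hR := h.2.arcTree_mirror (s := n) (by omega)
    rw [show n - (n - x) = x by omega, Nat.sub_zero] at hR
    rw [Finset.mem_filter, mem_trees]
    exact ⟨h.1.union hR, h.1.uncovered_union hR⟩
  · rintro ⟨L, R⟩ h ⟨L', R'⟩ h' he
    rw [Finset.mem_product, mem_trees, mem_trees] at h h'
    have hR := h.2.arcTree_mirror (s := n) (by omega)
    have hR' := h'.2.arcTree_mirror (s := n) (by omega)
    rw [show n - (n - x) = x by omega, Nat.sub_zero] at hR hR'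
    dsimp only at he h h' hR hR'
    have h1 := inside_union_left h.1.bounds hR.bounds
    rw [he, inside_union_left h'.1.bounds hR'.bounds] at h1
    have h2 := inside_union_right h.1.bounds hR.bounds
    rw [he, inside_union_right h'.1.bounds hR'.bounds] at h2
    refine Prod.ext h1.symm ?_
    have h3 := congrArg (mirror n) h2
    rw [mirror_mirror h.2.bounds (by omega), mirror_mirror h'.2.bounds (by omega)] at h3
    exact h3.symm
  · intro E hE
    rw [Finset.mem_filter, mem_trees] at hE
    obtain ⟨h1, h2⟩ := hE.1.split hE.2 (Nat.zero_le x) hx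
    refine ⟨(inside 0 x E, mirror n (inside x n E)), ?_, ?_⟩
    · rw [Finset.mem_product, mem_trees, mem_trees]
      refine ⟨h1, ?_⟩
      have h3 := h2.arcTree_mirror (s := n) le_rfl
      rwa [Nat.sub_self] at h3
    · dsimp only
      rw [mirror_mirror h2.bounds le_rfl]
      exact inside_union_inside hE.1.bounds hE.2

section Symmetric

variable {n : ℕ} {E : Finset (ℕ × ℕ)}

theorem ArcTree.mem_symm (hE : ArcTree 0 n E) (hm : mirror n E = E) {i j : ℕ} (h : (i, j) ∈ E) :
    (n - j, n - i) ∈ E := by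
  have := hE.bounds i j h
  rw [← mem_mirror hE.bounds le_rfl (by omega) (by omega), hm]
  exact h

/-- An arc across the middle crosses its mirror image unless the two coincide. -/
theorem ArcTree.add_eq_of_symm (hE : ArcTree 0 n E) (hm : mirror n E = E) {i j : ℕ}
    (h : (i, j) ∈ E) (hi : 2 * i < n) (hj : n < 2 * j) : i + j = n := by
  have h1 := hE.bounds i j h
  have h2 := hE.mem_symm hm h
  by_contra hc
  rcases Nat.lt_or_gt_of_ne hc with h3 | h3
  · exact hE.noncrossing _ _ _ _ h h2 (by omega) (by omega) (by omega)
  · exact hE.noncrossing _ _ _ _ h2 h (by omega) (by omega) (by omega)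

theorem ArcTree.not_joined_of_symm (hE : ArcTree 0 n E) (hm : mirror n E = E) {i j v : ℕ}
    (h : (i, j) ∈ E) (hij : i + j = n) (hv : v ≤ n) :
    ¬ Joined (E.erase (i, j)) v (n - v) := by
  refine hE.no_fixed_of_flip h (fun w => n - w) (by omega) (by omega) (fun k l hkl => ?_)
    (Nat.zero_le v) hv
  rw [Finset.mem_erase] at hkl
  have := hE.bounds k l hkl.2
  refine (Joined.of_mem (Finset.mem_erase.2 ⟨fun hc => hkl.1 ?_, hE.mem_symm hm hkl.2⟩)).symm
  simp only [Prod.mk.injEq] at hc ⊢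
  omega

theorem mirror_union (s : ℕ) (E F : Finset (ℕ × ℕ)) :
    mirror s (E ∪ F) = mirror s E ∪ mirror s F :=
  Finset.image_union _ _

end Symmetric

theorem odd_treeCount_iff_card_symm (n : ℕ) :
    Odd (treeCount n) ↔ Odd ((trees n).filter fun E => mirror n E = E).card := by
  refine odd_card_iff_of_involution _ _ (fun E hE => ?_) fun E hE => ?_
  · rw [mem_trees] at hE ⊢
    have := hE.arcTree_mirror (s := n) le_rfl
    rwa [Nat.sub_self, Nat.sub_zero] at this
  · exact mirror_mirror (mem_trees.1 hE).bounds le_rfl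

/-- A mirror-symmetric tree on `0, …, 2h` has no arc above the centre `h`: such an arc would be
symmetric, and the mirror would exchange the two components left by erasing it although it fixes
`h`. So the tree is its left half together with the mirror image of that half. -/
theorem odd_treeCount_two_mul (h : ℕ) : Odd (treeCount (2 * h)) ↔ Odd (treeCount h) := by
  rw [odd_treeCount_iff_card_symm]
  suffices ((trees (2 * h)).filter fun E => mirror (2 * h) E = E).card = treeCount h by rw [this]
  symm
  have hmir : ∀ L, ArcTree 0 h L → ArcTree h (2 * h) (mirror (2 * h) L) := fun L hL => by
    have := hL.arcTree_mirror (s := 2 * h) (by omega)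
    rwa [show 2 * h - h = h by omega, Nat.sub_zero] at this
  refine Finset.card_bij (fun L _ => L ∪ mirror (2 * h) L) ?_ ?_ ?_
  · intro L hL
    rw [mem_trees] at hL
    rw [Finset.mem_filter, mem_trees, mirror_union, mirror_mirror hL.bounds (by omega)]
    exact ⟨hL.union (hmir L hL), Finset.union_comm _ _⟩
  · intro L hL L' hL' he
    rw [mem_trees] at hL hL'
    have h1 := inside_union_left hL.bounds (hmir L hL).bounds
    rw [he, inside_union_left hL'.bounds (hmir L' hL').bounds] at h1
    exact h1.symm
  · intro E hE
    rw [Finset.mem_filter, mem_trees] at hE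
    obtain ⟨hE, hm⟩ := hE
    have hu : Uncovered E h := fun i j hij h1 h2 => by
      have h3 := hE.add_eq_of_symm hm hij (by omega) (by omega)
      refine hE.not_joined_of_symm hm hij h3 (v := h) (by omega) ?_
      rw [show 2 * h - h = h by omega]
      exact .refl _
    have hs := hE.split hu (Nat.zero_le h) (by omega)
    refine ⟨inside 0 h E, mem_trees.2 hs.1, ?_⟩
    have h4 : mirror (2 * h) (inside 0 h E) = inside h (2 * h) E := by
      ext ⟨i, j⟩
      by_cases hb : i ≤ 2 * h ∧ j ≤ 2 * h
      · rw [mem_mirror hs.1.bounds (by omega) hb.1 hb.2, mem_inside, mem_inside]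
        constructor
        · rintro ⟨h5, h6⟩
          have := hE.mem_symm hm h5
          rw [show 2 * h - (2 * h - i) = i by omega, show 2 * h - (2 * h - j) = j by omega] at this
          exact ⟨this, by omega⟩
        · rintro ⟨h5, h6⟩
          exact ⟨hE.mem_symm hm h5, by omega⟩
      · refine iff_of_false (fun hc => hb ?_) fun hc => hb ?_
        · obtain ⟨k, l, -, h5, h6⟩ := exists_of_mem_mirror hc
          omega
        · have := hE.bounds i j (mem_inside.1 hc).1
          omega
    rw [h4]
    exact inside_union_inside hE.bounds hu

/-- The number of noncrossing trees on `n + 1` points with a marked point that is not covered. -/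
noncomputable def markedCount (n : ℕ) : ℕ :=
  ∑ x ∈ Finset.range (n + 1), treeCount x * treeCount (n - x)

/-- The terms of `x` and `n - x` cancel modulo 2, which leaves the square in the middle, if there is
a middle. -/
theorem odd_markedCount (n : ℕ) : Odd (markedCount n) ↔ ∃ h, n = 2 * h ∧ Odd (treeCount h) := by
  classical
  set s := Finset.range (n + 1) with hs
  set f : ℕ → ZMod 2 := fun x => (treeCount x : ZMod 2) * treeCount (n - x) with hf
  have h0 : ∀ a : ZMod 2, a + a = 0 := by decide
  have h1 : ∑ x ∈ s.filter (fun x => ¬ 2 * x = n), f x = 0 := by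
    refine Finset.sum_involution (fun x _ => n - x) (fun x hx => ?_) (fun x hx _ => ?_)
      (fun x hx => ?_) (fun x hx => ?_)
    all_goals
      simp only [hs, Finset.mem_filter, Finset.mem_range] at hx ⊢
    · rw [hf]
      dsimp only
      rw [show n - (n - x) = x by omega, mul_comm (treeCount (n - x) : ZMod 2)]
      exact h0 _
    · omega
    · omega
    · omega
  have h2 : (markedCount n : ZMod 2) = ∑ x ∈ s.filter (fun x => 2 * x = n), f x := by
    rw [markedCount, Nat.cast_sum, ← Finset.sum_filter_add_sum_filter_not s (fun x => 2 * x = n),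
      Finset.sum_congr rfl fun x _ => Nat.cast_mul _ _, Finset.sum_congr rfl fun x _ => Nat.cast_mul _ _, h1, add_zero]
  rw [← ZMod.natCast_eq_one_iff_odd, h2]
  rcases Nat.even_or_odd' n with ⟨h, rfl | rfl⟩
  · have : s.filter (fun x => 2 * x = 2 * h) = {h} := by
      ext x
      simp only [hs, Finset.mem_filter, Finset.mem_range, Finset.mem_singleton]
      omega
    rw [this, Finset.sum_singleton, hf]
    dsimp only
    rw [show 2 * h - h = h by omega, ← Nat.cast_mul, ZMod.natCast_eq_one_iff_odd, Nat.odd_mul,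
      and_self]
    exact ⟨fun h' => ⟨h, rfl, h'⟩, fun ⟨k, hk, hk'⟩ => by rwa [show h = k by omega]⟩
  · have : s.filter (fun x => 2 * x = 2 * h + 1) = ∅ := by
      ext x
      simp only [Finset.mem_filter, Finset.notMem_empty, iff_false]
      omega
    rw [this, Finset.sum_empty]
    refine iff_of_false (by decide) ?_
    rintro ⟨k, hk, -⟩
    omega

/-- On an even number of points, a mirror-symmetric tree has exactly one arc `(x, n - x)` across the
middle. The rest is a tree on `0, …, h` and its mirror image, and the middle arc crosses nothing
exactly if `x` is uncovered in the left tree. -/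
theorem odd_treeCount_two_mul_add_one (h : ℕ) :
    Odd (treeCount (2 * h + 1)) ↔ Odd (markedCount h) := by
  classical
  rw [odd_treeCount_iff_card_symm]
  set n := 2 * h + 1 with hn
  suffices ((trees n).filter fun E => mirror n E = E).card = markedCount h by rw [this]
  rw [markedCount, ← Finset.sum_congr rfl fun x hx =>
    card_trees_uncovered (Nat.lt_succ_iff.1 (Finset.mem_range.1 hx)), ← Finset.card_sigma]
  symm
  have hmem : ∀ {L : Finset (ℕ × ℕ)} (_ : ArcTree 0 h L) (x i j : ℕ),
      (i, j) ∈ insert (x, n - x) (L ∪ mirror n L) ↔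
        (i = x ∧ j = n - x) ∨ (i, j) ∈ L ∨ (i, j) ∈ mirror n L := by
    intro L _ x i j
    rw [Finset.mem_insert, Finset.mem_union, Prod.mk.injEq]
  have hins : ∀ {L : Finset (ℕ × ℕ)} (_ : ArcTree 0 h L) (x : ℕ), x ≤ h →
      inside 0 h (insert (x, n - x) (L ∪ mirror n L)) = L := by
    intro L hL x hx
    ext ⟨i, j⟩
    rw [mem_inside, hmem hL]
    constructor
    · rintro ⟨⟨rfl, rfl⟩ | h1 | h1, h2, h3⟩
      · omega
      · exact h1
      · obtain ⟨k, l, h4, rfl, rfl⟩ := exists_of_mem_mirror h1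
        have := hL.bounds k l h4
        omega
    · intro h1
      exact ⟨Or.inr (Or.inl h1), by omega, (hL.bounds i j h1).2.2⟩
  refine Finset.card_bij (fun p _ => insert (p.1, n - p.1) (p.2 ∪ mirror n p.2)) ?_ ?_ ?_
  · rintro ⟨x, L⟩ hL
    simp only [Finset.mem_sigma, Finset.mem_range, Finset.mem_filter, mem_trees] at hL ⊢
    obtain ⟨hx, hL, hu⟩ := hL
    have hM := hL.arcTree_mirror (s := n) (by omega)
    rw [show n - 0 = n by omega] at hM
    have hxn : (x, n - x) ∈ insert (x, n - x) (L ∪ mirror n L) := Finset.mem_insert_self _ _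
    have hsL : L ⊆ insert (x, n - x) (L ∪ mirror n L) :=
      Finset.subset_union_left.trans (Finset.subset_insert _ _)
    have hsM : mirror n L ⊆ insert (x, n - x) (L ∪ mirror n L) :=
      Finset.subset_union_right.trans (Finset.subset_insert _ _)
    refine ⟨⟨?_, ?_, ?_, ?_⟩, ?_⟩
    · intro i j hij
      rcases (hmem hL x i j).1 hij with ⟨rfl, rfl⟩ | h1 | h1
      · omega
      · have := hL.bounds i j h1
        omega
      · have := hM.bounds i j h1
        omega
    · intro i j k l hij hkl h1 h2 h3
      rcases (hmem hL x i j).1 hij with ⟨h4, h4'⟩ | h4 | h4 <;>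
        rcases (hmem hL x k l).1 hkl with ⟨h5, h5'⟩ | h5 | h5
      · omega
      · have := hL.bounds k l h5
        omega
      · obtain ⟨k', l', h6, rfl, rfl⟩ := exists_of_mem_mirror h5
        have := hL.bounds k' l' h6
        exact hu k' l' h6 (by omega) (by omega)
      · have := hL.bounds i j h4
        exact hu i j h4 (by omega) (by omega)
      · exact hL.noncrossing i j k l h4 h5 h1 h2 h3
      · have := hL.bounds i j h4
        have := hM.bounds k l h5
        omega
      · have := hM.bounds i j h4
        omega
      · have := hM.bounds i j h4
        have := hL.bounds k l h5
        omega
      · exact hM.noncrossing i j k l h4 h5 h1 h2 h3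
    · intro v _ hv
      by_cases hc : v ≤ h
      · exact (hL.joined v (by omega) hc).mono hsL
      · have h1 := (hM.joined (n - x) (by omega) (by omega)).symm.trans
          (hM.joined v (by omega) hv)
        exact ((hL.joined x (by omega) (by omega)).mono hsL).trans
          ((Joined.of_mem hxn).trans (h1.mono hsM))
    · rw [Finset.card_insert_of_notMem, Finset.card_union_of_disjoint, card_mirror hL.bounds
        (by omega)]
      · have := hL.card_add
        omega
      · rw [Finset.disjoint_left]
        rintro ⟨i, j⟩ h1 h2
        have := hL.bounds i j h1
        have := hM.bounds i j h2
        omega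
      · intro hc
        rcases Finset.mem_union.1 hc with hc | hc
        · have := hL.bounds _ _ hc
          omega
        · have := hM.bounds _ _ hc
          omega
    · rw [← Finset.singleton_union, mirror_union, mirror_union, mirror_mirror hL.bounds (by omega),
        Finset.union_comm (mirror n L)]
      congr 1
      simp only [mirror, Finset.image_singleton]
      rw [show n - (n - x) = x by omega]
  · rintro ⟨x, L⟩ h1 ⟨x', L'⟩ h2 he
    simp only [Finset.mem_sigma, Finset.mem_range, Finset.mem_filter, mem_trees] at h1 h2 he
    have h3 := hins h1.2.1 x (by omega)
    rw [he, hins h2.2.1 x' (by omega)] at h3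
    subst h3
    have h4 : (x, n - x) ∈ insert (x', n - x') (L' ∪ mirror n L') := by
      rw [← he]
      exact Finset.mem_insert_self _ _
    rcases (hmem h2.2.1 x' _ _).1 h4 with ⟨rfl, -⟩ | h4 | h4
    · rfl
    · have := h2.2.1.bounds _ _ h4
      omega
    · obtain ⟨k, l, h6, h7, h8⟩ := exists_of_mem_mirror h4
      have := h2.2.1.bounds _ _ h6
      omega
  · intro E hE
    rw [Finset.mem_filter, mem_trees] at hE
    obtain ⟨hE, hm⟩ := hE
    have hstr : ∀ i j, (i, j) ∈ E → i ≤ h → h < j → i + j = n := fun i j hij h1 h2 =>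
      hE.add_eq_of_symm hm hij (by omega) (by omega)
    obtain ⟨x, y, hxy, hx⟩ := (hE.joined n (by omega) le_rfl).exists_boundary (fun w => w ≤ h)
      (by omega) (by omega)
    have hb := hE.bounds x y hxy
    have hsum := hstr x y hxy (by omega) (by omega)
    -- A second arc across the middle would join a point to its mirror image without the use of `(x,
    -- y)`.
    have huniq : ∀ i j, (i, j) ∈ E → i ≤ h → h < j → i = x ∧ j = y := by
      intro i j hij h1 h2
      by_contra hc
      have h3 := hstr i j hij h1 h2
      refine hE.not_joined_of_symm hm hxy hsum (v := i) (by omega) (.of_mem ?_)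
      rw [show n - i = j by omega, Finset.mem_erase, ne_eq, Prod.mk.injEq]
      exact ⟨hc, hij⟩
    have hb0 : ∀ i j, (i, j) ∈ inside 0 h E → 0 ≤ i ∧ i < j ∧ j ≤ h := fun i j hij => by
      rw [mem_inside] at hij
      have := hE.bounds i j hij.1
      omega
    have hEq : insert (x, n - x) (inside 0 h E ∪ mirror n (inside 0 h E)) = E := by
      ext ⟨i, j⟩
      rw [Finset.mem_insert, Finset.mem_union, Prod.mk.injEq]
      constructor
      · rintro (⟨rfl, rfl⟩ | h1 | h1)
        · rwa [show n - i = y by omega]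
        · exact (mem_inside.1 h1).1
        · obtain ⟨k, l, h2, rfl, rfl⟩ := exists_of_mem_mirror h1
          exact hE.mem_symm hm (mem_inside.1 h2).1
      · intro hij
        have h1 := hE.bounds i j hij
        by_cases hj : j ≤ h
        · exact Or.inr (Or.inl (mem_inside.2 ⟨hij, by omega, hj⟩))
        · by_cases hi : i ≤ h
          · have := huniq i j hij hi (by omega)
            exact Or.inl (by omega)
          · refine Or.inr (Or.inr ?_)
            rw [mem_mirror hb0 (by omega) (by omega) (by omega), mem_inside]
            exact ⟨hE.mem_symm hm hij, by omega, by omega⟩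
    have hcard : E.card = 1 + ((inside 0 h E).card + (inside 0 h E).card) := by
      conv_lhs => rw [← hEq]
      rw [Finset.card_insert_of_notMem, Finset.card_union_of_disjoint, card_mirror hb0 (by omega),
        add_comm]
      · rw [Finset.disjoint_left]
        rintro ⟨i, j⟩ h1 h2
        have := hb0 i j h1
        obtain ⟨k, l, h3, rfl, rfl⟩ := exists_of_mem_mirror h2
        have := hb0 k l h3
        omega
      · intro hc
        rcases Finset.mem_union.1 hc with hc | hc
        · have := hb0 _ _ hc
          omega
        · obtain ⟨k, l, h3, h4, h5⟩ := exists_of_mem_mirror hc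
          have := hb0 k l h3
          omega
    refine ⟨⟨x, inside 0 h E⟩, ?_, hEq⟩
    simp only [Finset.mem_sigma, Finset.mem_range, Finset.mem_filter, mem_trees]
    refine ⟨by omega, ⟨hb0, fun i j k l h1 h2 => ?_, fun v _ hv => ?_, ?_⟩, ?_⟩
    · exact hE.noncrossing i j k l (mem_inside.1 h1).1 (mem_inside.1 h2).1
    -- Folding at the middle sends every arc into the left half and collapses the middle arc to `x`.
    · have h1 := (hE.joined v (by omega) (by omega)).map (F := inside 0 h E)
        (fun w => min w (n - w)) ?_
      · rwa [show min 0 (n - 0) = 0 by omega, show min v (n - v) = v by omega] at h1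
      · intro i j hij
        have h1 := hE.bounds i j hij
        by_cases hj : j ≤ h
        · rw [show min i (n - i) = i by omega, show min j (n - j) = j by omega]
          exact .of_mem (mem_inside.2 ⟨hij, by omega, hj⟩)
        · by_cases hi : i ≤ h
          · have := huniq i j hij hi (by omega)
            rw [show min i (n - i) = x by omega, show min j (n - j) = x by omega]
            exact .refl _
          · rw [show min i (n - i) = n - i by omega, show min j (n - j) = n - j by omega]
            exact (Joined.of_mem (mem_inside.2 ⟨hE.mem_symm hm hij, by omega, by omega⟩)).symm
    · have := hE.card_add
      omega
    · intro i j hij h1 h2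
      have := hb0 i j hij
      exact hE.noncrossing i j x y (mem_inside.1 hij).1 hxy h1 h2 (by omega)

theorem treeCount_zero : treeCount 0 = 1 := by
  rw [treeCount, Finset.card_eq_one]
  refine ⟨∅, ?_⟩
  ext E
  rw [mem_trees, Finset.mem_singleton]
  constructor
  · intro h
    have := h.card_add
    exact Finset.card_eq_zero.1 (by omega)
  · rintro rfl
    refine ⟨by simp, by simp, fun v h1 h2 => ?_, rfl⟩
    rw [show v = 0 by omega]
    exact .refl _

/-- The recursion of `treeCount` modulo 2 runs along the two generating maps, and indices congruent
to 3 modulo 4 give even numbers. The generator `1` is `4 * 0 + 1`, so it inherits the parity of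
`treeCount 0 = 1`. -/
theorem odd_treeCount_iff (n : ℕ) : Odd (treeCount n) ↔ IsNegligent n := by
  have hneg : ∀ n, GeneratedFromOne n → 0 < n ∧ Odd (treeCount n) := by
    have h4 : ∀ k, Odd (treeCount k) → Odd (treeCount (4 * k + 1)) := fun k hk => by
      rw [show 4 * k + 1 = 2 * (2 * k) + 1 by ring, odd_treeCount_two_mul_add_one, odd_markedCount]
      exact ⟨k, rfl, hk⟩
    intro n hn
    induction hn with
    | one => exact ⟨one_pos, h4 0 (by rw [treeCount_zero]; exact odd_one)⟩
    | double k _ ih => exact ⟨by omega, (odd_treeCount_two_mul k).2 ih.2⟩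
    | quadruple k _ ih => exact ⟨by omega, h4 k ih.2⟩
  constructor
  · induction n using Nat.strong_induction_on with
    | _ n ih =>
      intro hn
      rcases Nat.eq_zero_or_pos n with rfl | hpos
      · exact Or.inl rfl
      right
      obtain ⟨h, rfl | rfl⟩ := Nat.even_or_odd' n
      · rcases ih h (by omega) ((odd_treeCount_two_mul h).1 hn) with rfl | h1
        · omega
        · exact .double h h1
      · rw [odd_treeCount_two_mul_add_one, odd_markedCount] at hn
        obtain ⟨k, rfl, hk⟩ := hn
        rw [show 2 * (2 * k) + 1 = 4 * k + 1 by ring]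
        rcases ih k (by omega) hk with rfl | h1
        · exact .one
        · exact .quadruple k h1
  · rintro (rfl | h)
    · rw [treeCount_zero]
      exact odd_one
    · exact (hneg n h).2

/-! ### Noncrossing trees with twisted edges -/

/-- The reflection of the arcs inside `[x, y]`; the other arcs are kept. -/
def flipArc (x y : ℕ) (e : ℕ × ℕ) : ℕ × ℕ :=
  if x ≤ e.1 ∧ e.2 ≤ y then (x + y - e.2, x + y - e.1) else e

theorem flipArc_of_inside {x y i j : ℕ} (h : x ≤ i ∧ j ≤ y) :
    flipArc x y (i, j) = (x + y - j, x + y - i) := if_pos h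

theorem flipArc_of_not_inside {x y i j : ℕ} (h : ¬ (x ≤ i ∧ j ≤ y)) :
    flipArc x y (i, j) = (i, j) := if_neg h

theorem flipArc_flipArc {x y i j : ℕ} (h : i < j) : flipArc x y (flipArc x y (i, j)) = (i, j) := by
  by_cases hc : x ≤ i ∧ j ≤ y
  · rw [flipArc_of_inside hc, flipArc_of_inside (by omega), Prod.mk.injEq]
    omega
  · rw [flipArc_of_not_inside hc, flipArc_of_not_inside hc]

section Flip

variable {a b x y : ℕ} {E : Finset (ℕ × ℕ)}

theorem mem_image_flipArc (hE : ∀ i j, (i, j) ∈ E → i < j) {i j : ℕ} (hij : i < j) :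
    (i, j) ∈ E.image (flipArc x y) ↔ flipArc x y (i, j) ∈ E := by
  rw [Finset.mem_image]
  constructor
  · rintro ⟨⟨k, l⟩, h, h'⟩
    rw [← h', flipArc_flipArc (hE k l h)]
    exact h
  · intro h
    exact ⟨_, h, flipArc_flipArc hij⟩

theorem lt_of_mem_image_flipArc (hE : ∀ i j, (i, j) ∈ E → i < j) (i j : ℕ)
    (h : (i, j) ∈ E.image (flipArc x y)) : i < j := by
  rw [Finset.mem_image] at h
  obtain ⟨⟨k, l⟩, h, h'⟩ := h
  have := hE k l h
  by_cases hc : x ≤ k ∧ l ≤ y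
  · rw [flipArc_of_inside hc, Prod.mk.injEq] at h'
    omega
  · rw [flipArc_of_not_inside hc, Prod.mk.injEq] at h'
    omega

theorem image_flipArc_image_flipArc (hE : ∀ i j, (i, j) ∈ E → i < j) :
    (E.image (flipArc x y)).image (flipArc x y) = E := by
  ext ⟨i, j⟩
  by_cases hij : i < j
  · rw [mem_image_flipArc (lt_of_mem_image_flipArc hE) hij]
    by_cases hc : x ≤ i ∧ j ≤ y
    · rw [flipArc_of_inside hc, mem_image_flipArc hE (by omega), ← flipArc_of_inside hc,
        flipArc_flipArc hij]
    · rw [flipArc_of_not_inside hc, mem_image_flipArc hE hij, flipArc_of_not_inside hc]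
  · exact iff_of_false
      (fun h => hij (lt_of_mem_image_flipArc (lt_of_mem_image_flipArc hE) i j h))
      fun h => hij (hE i j h)

theorem card_image_flipArc (hE : ∀ i j, (i, j) ∈ E → i < j) :
    (E.image (flipArc x y)).card = E.card := by
  refine le_antisymm Finset.card_image_le ?_
  conv_lhs => rw [← image_flipArc_image_flipArc (x := x) (y := y) hE]
  exact Finset.card_image_le

theorem ArcTree.lt (hE : ArcTree a b E) (i j : ℕ) (h : (i, j) ∈ E) : i < j :=
  (hE.bounds i j h).2.1

/-- The place of the ends of an arc that meets the interval `[x, y]` with uncovered ends. -/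
theorem ArcTree.inside_or_outside (hE : ArcTree a b E) (hx : Uncovered E x)
    (hy : Uncovered E y) (hxy : (x, y) ∈ E) {i j : ℕ} (h : (i, j) ∈ E) :
    (x ≤ i ∧ j ≤ y) ∨ j ≤ x ∨ y ≤ i := by
  have h1 := hE.lt i j h
  have h2 := hE.lt x y hxy
  have h3 := hx i j h
  have h4 := hy i j h
  by_contra! hc
  by_cases h5 : i < x
  · exact h3 h5 (by omega)
  · exact h4 (by omega) (by omega)

theorem mem_flipArc_self (hE : ∀ i j, (i, j) ∈ E → i < j) (hxy : (x, y) ∈ E) :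
    (x, y) ∈ E.image (flipArc x y) := by
  have := hE x y hxy
  rw [mem_image_flipArc hE this, flipArc_of_inside ⟨le_rfl, le_rfl⟩]
  rwa [show x + y - y = x by omega, show x + y - x = y by omega]

/-- Since `x` and `y` are uncovered, every arc lies inside `[x, y]` or has both ends on one side of
it, so the inside can be reflected on its own. -/
theorem ArcTree.flip (hE : ArcTree a b E) (hx : Uncovered E x) (hy : Uncovered E y)
    (hxy : (x, y) ∈ E) : ArcTree a b (E.image (flipArc x y)) := by
  have hb := hE.bounds x y hxy
  have hlt := lt_of_mem_image_flipArc (x := x) (y := y) hE.lt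
  have hJ : Joined (E.image (flipArc x y)) x y := .of_mem (mem_flipArc_self hE.lt hxy)
  have hio := fun i j (h : (i, j) ∈ E) => hE.inside_or_outside hx hy hxy h
  constructor
  · intro i j h
    have h1 := hlt i j h
    rw [mem_image_flipArc hE.lt h1] at h
    by_cases hc : x ≤ i ∧ j ≤ y
    · omega
    · rw [flipArc_of_not_inside hc] at h
      exact hE.bounds i j h
  · intro i j k l h h' h1 h2 h3
    have h4 := hlt i j h
    have h5 := hlt k l h'
    rw [mem_image_flipArc hE.lt h4] at h
    rw [mem_image_flipArc hE.lt h5] at h'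
    by_cases hc : x ≤ i ∧ j ≤ y <;> by_cases hc' : x ≤ k ∧ l ≤ y
    · rw [flipArc_of_inside hc] at h
      rw [flipArc_of_inside hc'] at h'
      exact hE.noncrossing _ _ _ _ h' h (by omega) (by omega) (by omega)
    · rw [flipArc_of_not_inside hc'] at h'
      have := hio _ _ h'
      omega
    · rw [flipArc_of_not_inside hc] at h
      have := hio _ _ h
      omega
    · rw [flipArc_of_not_inside hc] at h
      rw [flipArc_of_not_inside hc'] at h'
      exact hE.noncrossing _ _ _ _ h h' h1 h2 h3
  · have key : ∀ v, a ≤ v → v ≤ b → Joined (E.image (flipArc x y)) x v := by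
      intro v hv hv'
      have hv0 := (hE.joined x (by omega) (by omega)).symm.trans (hE.joined v hv hv')
      by_cases hc : x ≤ v ∧ v ≤ y
      · have hv1 := (hE.joined x (by omega) (by omega)).symm.trans
          (hE.joined (x + y - v) (by omega) (by omega))
        have h1 := hv1.map (F := E.image (flipArc x y)) (fun w => x + y - max x (min y w)) ?_
        · rw [show x + y - max x (min y x) = y by omega,
            show x + y - max x (min y (x + y - v)) = v by omega] at h1
          exact hJ.trans h1
        · intro i j h
          have h2 := hE.lt i j h
          rcases hio i j h with h3 | h3
          · rw [show max x (min y i) = i by omega, show max x (min y j) = j by omega]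
            refine (Joined.of_mem ?_).symm
            rw [← flipArc_of_inside h3]
            exact Finset.mem_image_of_mem _ h
          · rw [show max x (min y i) = max x (min y j) by omega]
            exact .refl _
      -- For a point outside, the interior is contracted to `x`; an inner arc that ends in `y`
      -- becomes the arc `(x, y)` itself.
      · have h1 := hv0.map (F := E.image (flipArc x y)) (fun w => if x ≤ w ∧ w < y then x else w) ?_
        · rwa [if_pos ⟨le_rfl, hb.2.1⟩, if_neg (by omega)] at h1
        · intro i j h
          have h2 := hE.lt i j h
          rcases hio i j h with h3 | h3
          · rw [if_pos (by omega)]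
            by_cases hj : j < y
            · rw [if_pos (by omega)]
              exact .refl _
            · rw [if_neg (by omega), show j = y by omega]
              exact hJ
          · have h4 : (i, j) ∈ E.image (flipArc x y) := by
              rw [← flipArc_of_not_inside (x := x) (y := y) (i := i) (j := j) (by omega)]
              exact Finset.mem_image_of_mem _ h
            rw [if_neg (by omega)]
            by_cases hj : x ≤ j ∧ j < y
            · rw [if_pos hj]
              rw [show j = x by omega] at h4
              exact .of_mem h4
            · rw [if_neg hj]
              exact .of_mem h4
    intro v hv hv'
    exact (key a le_rfl (by omega)).symm.trans (key v hv hv')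
  · rw [card_image_flipArc hE.lt]
    exact hE.card_add

/-- In an arc tree that is symmetric inside `[x, y]`, only the edge `(x, y)` is symmetric. -/
theorem ArcTree.eq_of_flip_eq (hE : ArcTree a b E) (hx : Uncovered E x) (hy : Uncovered E y)
    (hxy : (x, y) ∈ E) (hf : E.image (flipArc x y) = E) {i j : ℕ} (h : (i, j) ∈ E)
    (hij : i + j = x + y) (hxi : x ≤ i) : i = x := by
  by_contra hne
  have h1 := hE.lt x y hxy
  have h2 := hE.lt i j h
  have hb := hE.bounds i j h
  -- The clamped reflection respects the tree and exchanges the ends of `(x, y)`, while `(i, j)`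
  -- would join a point to its image.
  refine hE.no_fixed_of_flip hxy (fun w => x + y - max x (min y w)) (by omega) (by omega)
    (fun k l hkl => ?_) (v := i) (by omega) (by omega) ?_
  · rw [Finset.mem_erase, ne_eq, Prod.mk.injEq] at hkl
    have h3 := hE.lt k l hkl.2
    rcases hE.inside_or_outside hx hy hxy hkl.2 with h4 | h4
    · rw [show max x (min y k) = k by omega, show max x (min y l) = l by omega]
      refine (Joined.of_mem ?_).symm
      rw [Finset.mem_erase, ne_eq, Prod.mk.injEq]
      refine ⟨by omega, ?_⟩
      rw [← flipArc_of_inside h4, ← hf]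
      exact Finset.mem_image_of_mem _ hkl.2
    · rw [show max x (min y k) = max x (min y l) by omega]
      exact .refl _
  · rw [show x + y - max x (min y i) = j by omega]
    refine .of_mem (Finset.mem_erase.2 ⟨?_, h⟩)
    rw [ne_eq, Prod.mk.injEq]
    omega

end Flip

/-- A noncrossing tree `E` on the points `0, …, q` of a line with a nonempty set `B` of twisted
edges: the twisted edges do not end in `0` and are nested, and no other edge covers one of
their ends. -/
structure TwistedTree (q : ℕ) (E B : Finset (ℕ × ℕ)) : Prop where
  tree : ArcTree 0 q E
  subset : B ⊆ E
  nonempty : B.Nonempty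
  one_le : ∀ i j, (i, j) ∈ B → 1 ≤ i
  nested : ∀ i j k l, (i, j) ∈ B → (k, l) ∈ B → (i ≤ k ∧ l ≤ j) ∨ (k ≤ i ∧ j ≤ l)
  uncovered : ∀ i j k l, (i, j) ∈ E → (i, j) ∉ B → (k, l) ∈ B →
    ¬ (i < k ∧ k < j) ∧ ¬ (i < l ∧ l < j)

open Classical in
/-- The noncrossing trees on the points `0, …, q` with a set of twisted edges. -/
noncomputable def twistedTrees (q : ℕ) : Finset (Finset (ℕ × ℕ) × Finset (ℕ × ℕ)) :=
  (trees q ×ˢ (Finset.Icc 0 q ×ˢ Finset.Icc 0 q).powerset).filter fun p => TwistedTree q p.1 p.2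

theorem mem_twistedTrees {q : ℕ} {p : Finset (ℕ × ℕ) × Finset (ℕ × ℕ)} :
    p ∈ twistedTrees q ↔ TwistedTree q p.1 p.2 := by
  classical
  rw [twistedTrees, Finset.mem_filter, and_iff_right_iff_imp, Finset.mem_product, mem_trees,
    Finset.mem_powerset]
  refine fun h => ⟨h.tree, ?_⟩
  rintro ⟨i, j⟩ he
  have := h.tree.bounds i j (h.subset he)
  simp only [Finset.mem_product, Finset.mem_Icc]
  omega

/-- `e` contains all arcs of `B`. -/
def IsOuter (B : Finset (ℕ × ℕ)) (e : ℕ × ℕ) : Prop :=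
  e ∈ B ∧ ∀ f ∈ B, e.1 ≤ f.1 ∧ f.2 ≤ e.2

theorem IsOuter.unique {B : Finset (ℕ × ℕ)} {e f : ℕ × ℕ} (h : IsOuter B e) (h' : IsOuter B f) :
    e = f := by
  have h1 := h.2 f h'.1
  have h2 := h'.2 e h.1
  exact Prod.ext (by omega) (by omega)

open Classical in
/-- The outermost arc. -/
noncomputable def outer (B : Finset (ℕ × ℕ)) : ℕ × ℕ :=
  if h : ∃ e, IsOuter B e then h.choose else 0

theorem IsOuter.outer_eq {B : Finset (ℕ × ℕ)} {e : ℕ × ℕ} (h : IsOuter B e) : outer B = e := by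
  have h' : ∃ e, IsOuter B e := ⟨e, h⟩
  rw [outer, dif_pos h']
  exact h'.choose_spec.unique h

section Twisted

variable {q : ℕ} {E B : Finset (ℕ × ℕ)}

theorem TwistedTree.exists_outer (h : TwistedTree q E B) : ∃ x y, IsOuter B (x, y) := by
  obtain ⟨⟨x, y⟩, he, hmax⟩ := B.exists_max_image (fun e => e.2 - e.1) h.nonempty
  refine ⟨x, y, he, fun ⟨i, j⟩ hf => ?_⟩
  have h1 := hmax _ hf
  have h2 := h.nested _ _ _ _ he hf
  have h3 := h.tree.lt _ _ (h.subset he)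
  have h4 := h.tree.lt _ _ (h.subset hf)
  dsimp only at h1 ⊢
  omega

theorem TwistedTree.uncovered_outer (h : TwistedTree q E B) {x y : ℕ} (hxy : IsOuter B (x, y)) :
    Uncovered E x ∧ Uncovered E y := by
  constructor
  all_goals
    intro i j hij h1 h2
    by_cases hB : (i, j) ∈ B
    · have := hxy.2 _ hB
      dsimp only at this
      omega
    · have := h.uncovered i j x y hij hB hxy.1
      omega

theorem TwistedTree.flip (h : TwistedTree q E B) {x y : ℕ} (hxy : IsOuter B (x, y)) :
    TwistedTree q (E.image (flipArc x y)) (B.image (flipArc x y)) ∧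
      IsOuter (B.image (flipArc x y)) (x, y) := by
  obtain ⟨hx, hy⟩ := h.uncovered_outer hxy
  have hBlt : ∀ i j, (i, j) ∈ B → i < j := fun i j hij => h.tree.lt i j (h.subset hij)
  have hltE := lt_of_mem_image_flipArc (x := x) (y := y) h.tree.lt
  have hltB := lt_of_mem_image_flipArc (x := x) (y := y) hBlt
  have hin : ∀ i j, (i, j) ∈ B.image (flipArc x y) →
      x ≤ i ∧ j ≤ y ∧ (x + y - j, x + y - i) ∈ B := by
    intro i j hij
    rw [mem_image_flipArc hBlt (hltB i j hij)] at hij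
    by_cases hc : x ≤ i ∧ j ≤ y
    · rw [flipArc_of_inside hc] at hij
      exact ⟨hc.1, hc.2, hij⟩
    · rw [flipArc_of_not_inside hc] at hij
      exact absurd (hxy.2 _ hij) hc
  refine ⟨⟨h.tree.flip hx hy (h.subset hxy.1), Finset.image_subset_image h.subset,
    h.nonempty.image _, fun i j hij => ?_, fun i j k l hij hkl => ?_,
    fun i j k l hij hij' hkl => ?_⟩, mem_flipArc_self hBlt hxy.1, fun ⟨i, j⟩ hij => ?_⟩
  · have := h.one_le x y hxy.1
    have := (hin i j hij).1
    omega
  · have h1 := hltB i j hij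
    have h2 := hltB k l hkl
    have h3 := hin i j hij
    have h4 := hin k l hkl
    have := h.nested _ _ _ _ h3.2.2 h4.2.2
    omega
  · have h1 := hltE i j hij
    have h2 := hltB k l hkl
    have h4 := hin k l hkl
    rw [mem_image_flipArc h.tree.lt h1] at hij
    rw [mem_image_flipArc hBlt h1] at hij'
    by_cases hc : x ≤ i ∧ j ≤ y
    · rw [flipArc_of_inside hc] at hij hij'
      have := h.uncovered _ _ _ _ hij hij' h4.2.2
      omega
    · rw [flipArc_of_not_inside hc] at hij
      have := h.tree.inside_or_outside hx hy (h.subset hxy.1) hij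
      omega
  · have := hin i j hij
    exact ⟨this.1, this.2.1⟩

end Twisted

/-- Reflecting the inside of the outermost twisted edge is an involution without fixed points on the
pairs with at least two twisted edges. A pair with a single one amounts to a tree with an uncovered
point `x`, `1 ≤ x < q`, the left end of the twisted edge. -/
theorem odd_card_twistedTrees (q : ℕ) :
    Odd (twistedTrees q).card ↔ ∃ v, 1 ≤ v ∧ q = 2 * v ∧ Odd (treeCount v) := by
  classical
  have heven : Even ((twistedTrees q).filter fun p => ¬ p.2.card = 1).card := by
    refine even_card_of_involution _ (fun p =>
      (p.1.image (flipArc (outer p.2).1 (outer p.2).2),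
        p.2.image (flipArc (outer p.2).1 (outer p.2).2))) ?_ ?_ ?_
    all_goals
      rintro ⟨E, B⟩ hp
      rw [Finset.mem_filter, mem_twistedTrees] at hp
      obtain ⟨hp, hcard⟩ := hp
      obtain ⟨x, y, hxy⟩ := hp.exists_outer
      have hf := hp.flip hxy
      have hBlt : ∀ i j, (i, j) ∈ B → i < j := fun i j hij => hp.tree.lt i j (hp.subset hij)
      dsimp only at hp hcard ⊢
      rw [hxy.outer_eq]
      dsimp only
    · rw [Finset.mem_filter, mem_twistedTrees]
      refine ⟨hf.1, ?_⟩
      rwa [card_image_flipArc hBlt]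
    · rw [hf.2.outer_eq]
      dsimp only
      rw [image_flipArc_image_flipArc hp.tree.lt, image_flipArc_image_flipArc hBlt]
    -- In a fixed pair, a twisted edge and its reflected copy are nested and of equal length, hence
    -- equal; a symmetric arc inside `[x, y]` can only be `(x, y)`.
    · intro hc
      rw [Prod.mk.injEq] at hc
      refine hcard (Finset.card_eq_one.2 ⟨(x, y), Finset.eq_singleton_iff_unique_mem.2
        ⟨hxy.1, fun ⟨i, j⟩ hij => ?_⟩⟩)
      have h1 := hxy.2 _ hij
      dsimp only at h1
      have h2 : (x + y - j, x + y - i) ∈ B := by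
        rw [← flipArc_of_inside h1]
        have h3 := Finset.mem_image_of_mem (flipArc x y) hij
        rwa [hc.2] at h3
      have h3 := hp.nested _ _ _ _ hij h2
      have h4 := hBlt i j hij
      obtain ⟨hx, hy⟩ := hp.uncovered_outer hxy
      have h5 := hp.tree.eq_of_flip_eq hx hy (hp.subset hxy.1) hc.1 (hp.subset hij) (by omega) h1.1
      rw [Prod.mk.injEq]
      omega
  have hone : ((twistedTrees q).filter fun p => p.2.card = 1).card =
      ∑ x ∈ Finset.Ico 1 q, treeCount x * treeCount (q - x) := by
    rw [← Finset.sum_congr rfl fun x hx =>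
      card_trees_uncovered (Finset.mem_Ico.1 hx).2.le, ← Finset.card_sigma]
    refine Finset.card_bij (fun p _ => ⟨(outer p.2).1, p.1⟩) ?_ ?_ ?_
    · rintro ⟨E, B⟩ hp
      rw [Finset.mem_filter, mem_twistedTrees] at hp
      obtain ⟨hp, -⟩ := hp
      dsimp only at hp
      obtain ⟨x, y, hxy⟩ := hp.exists_outer
      simp only [Finset.mem_sigma, Finset.mem_Ico, Finset.mem_filter, mem_trees, hxy.outer_eq]
      have h1 := hp.tree.bounds x y (hp.subset hxy.1)
      have h2 := hp.one_le x y hxy.1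
      exact ⟨by omega, hp.tree, (hp.uncovered_outer hxy).1⟩
    · rintro ⟨E, B⟩ hp ⟨E', B'⟩ hp' he
      rw [Finset.mem_filter, mem_twistedTrees] at hp hp'
      obtain ⟨hp, hB⟩ := hp
      obtain ⟨hp', hB'⟩ := hp'
      dsimp only at hp hp' hB hB'
      obtain ⟨x, y, hxy⟩ := hp.exists_outer
      obtain ⟨x', y', hxy'⟩ := hp'.exists_outer
      simp only [hxy.outer_eq, hxy'.outer_eq, Sigma.mk.injEq, heq_eq_eq] at he
      obtain ⟨rfl, rfl⟩ := he
      have h1 := (hp.uncovered_outer hxy).2 _ _ (hp'.subset hxy'.1) (hp.tree.lt _ _ (hp.subset hxy.1))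
      have h2 := (hp'.uncovered_outer hxy').2 _ _ (hp.subset hxy.1)
        (hp.tree.lt _ _ (hp'.subset hxy'.1))
      have h3 : y = y' := by
        rcases lt_trichotomy y y' with h | h | h
        · exact (h1 h).elim
        · exact h
        · exact (h2 h).elim
      subst h3
      have hs : ∀ B : Finset (ℕ × ℕ), B.card = 1 → IsOuter B (x, y) → B = {(x, y)} := by
        intro B h h'
        obtain ⟨e, rfl⟩ := Finset.card_eq_one.1 h
        rw [Finset.mem_singleton.1 h'.1]
      rw [hs B hB hxy, hs B' hB' hxy']
    · rintro ⟨x, E⟩ hE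
      simp only [Finset.mem_sigma, Finset.mem_Ico, Finset.mem_filter, mem_trees] at hE
      obtain ⟨hx, hE, hu⟩ := hE
      have hne : (E.filter fun e => e.1 = x).Nonempty := by
        have h1 := (hE.joined x (by omega) (by omega)).symm.trans (hE.joined q (by omega) le_rfl)
        obtain ⟨i, j, hij, h2⟩ := h1.exists_boundary (fun w => w ≤ x) le_rfl (by omega)
        have h3 := hE.lt i j hij
        refine ⟨(i, j), Finset.mem_filter.2 ⟨hij, ?_⟩⟩
        dsimp only
        by_contra hc
        exact hu i j hij (by omega) (by omega)
      -- The twisted edge must be the longest arc that starts in the marked point, since it covers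
      -- the right ends of all others.
      obtain ⟨⟨x', y⟩, hxy, hmax⟩ := Finset.exists_max_image _ (fun e : ℕ × ℕ => e.2) hne
      rw [Finset.mem_filter] at hxy
      obtain ⟨hxy, rfl⟩ := hxy
      dsimp only at hx hu hmax
      have hlt := hE.lt _ _ hxy
      have hy : Uncovered E y := fun i j hij h1 h2 => by
        rcases lt_trichotomy i x' with h3 | rfl | h3
        · exact hu i j hij h3 (by omega)
        · have := hmax (i, j) (Finset.mem_filter.2 ⟨hij, rfl⟩)
          dsimp only at this
          omega
        · exact hE.noncrossing _ _ _ _ hxy hij h3 h1 h2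
      have ho : IsOuter {(x', y)} (x', y) :=
        ⟨Finset.mem_singleton_self _, fun f hf => by rw [Finset.mem_singleton.1 hf]; exact ⟨le_rfl, le_rfl⟩⟩
      refine ⟨(E, {(x', y)}), ?_, ?_⟩
      · rw [Finset.mem_filter, mem_twistedTrees]
        refine ⟨⟨hE, Finset.singleton_subset_iff.2 hxy, Finset.singleton_nonempty _, ?_, ?_, ?_⟩,
          Finset.card_singleton _⟩
        · intro i j h
          rw [Finset.mem_singleton, Prod.mk.injEq] at h
          omega
        · intro i j k l h h'
          rw [Finset.mem_singleton, Prod.mk.injEq] at h h'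
          omega
        · intro i j k l hij _ h'
          rw [Finset.mem_singleton, Prod.mk.injEq] at h'
          obtain ⟨rfl, rfl⟩ := h'
          exact ⟨fun h => hu i j hij h.1 h.2, fun h => hy i j hij h.1 h.2⟩
      · simp only [ho.outer_eq]
  rw [← Finset.card_filter_add_card_filter_not (s := twistedTrees q) (fun p => p.2.card = 1),
    Nat.odd_add, iff_true_right heven, hone]
  rcases Nat.eq_zero_or_pos q with rfl | hq
  · refine iff_of_false (by decide) ?_
    rintro ⟨v, h1, h2, -⟩
    omega
  -- The marked points `0` and `q`, which are not allowed here, contribute `treeCount q` each and do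
  -- not change the parity.
  · have h1 : markedCount q =
        (∑ x ∈ Finset.Ico 1 q, treeCount x * treeCount (q - x)) + 2 * treeCount q := by
      rw [markedCount, Finset.sum_range_succ, ← Nat.Ico_zero_eq_range,
        Finset.sum_eq_sum_Ico_succ_bot hq, treeCount_zero, Nat.sub_self, Nat.sub_zero,
        treeCount_zero]
      ring
    have h2 := odd_markedCount q
    rw [h1, Nat.odd_add, iff_true_right (even_two_mul _)] at h2
    rw [h2]
    exact ⟨fun ⟨v, h3, h4⟩ => ⟨v, by omega, h3, h4⟩, fun ⟨v, _, h3, h4⟩ => ⟨v, h3, h4⟩⟩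

/-! ### Alternating matrices of rank two and the faces of a chord diagram -/

section Alternating

variable {A : Type*} [Fintype A] [DecidableEq A]

/-- An alternating matrix over the field with two elements has rank two if and only if it has
the form `u vᵀ + v uᵀ` with the columns `u ≠ v` at any nonzero entry. -/
theorem finrank_ker_add_two_eq_card_iff (X : Matrix A A (ZMod 2)) (hs : ∀ i j, X i j = X j i)
    (h0 : ∀ i, X i i = 0) :
    Module.finrank (ZMod 2) (LinearMap.ker X.mulVecLin) + 2 = Fintype.card A ↔
      (∃ p q, X p q = 1) ∧
        ∀ p q r s, X p q = 1 → X r s = X r p * X s q + X r q * X s p := by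
  have h2 : ∀ x : ZMod 2, x + x = 0 := by decide
  have key : ∀ p q, X p q = 1 →
      (Module.finrank (ZMod 2) (LinearMap.ker X.mulVecLin) + 2 = Fintype.card A ↔
        ∀ r s, X r s = X r p * X s q + X r q * X s p) := by
    intro p q hpq
    have hqp : X q p = 1 := by rw [hs, hpq]
    -- The rows `p` and `q` are independent because their minor at the columns `p`, `q` is the
    -- exchange matrix. So the rank is at least two, with equality exactly if these two rows already
    -- cut out the kernel.
    let φ : (A → ZMod 2) →ₗ[ZMod 2] ZMod 2 × ZMod 2 :=
      ((LinearMap.proj p).comp X.mulVecLin).prod ((LinearMap.proj q).comp X.mulVecLin)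
    have hφ : ∀ v, φ v = ((X.mulVec v) p, (X.mulVec v) q) := fun v => rfl
    have hsurj : Function.Surjective φ := by
      rintro ⟨x, y⟩
      refine ⟨x • Pi.single q 1 + y • Pi.single p 1, ?_⟩
      rw [map_add, map_smul, map_smul, hφ, hφ]
      simp [h0, hpq, hqp]
    have hfin : Module.finrank (ZMod 2) (LinearMap.ker φ) + 2 = Fintype.card A := by
      have h := LinearMap.finrank_range_add_finrank_ker φ
      rw [LinearMap.range_eq_top.2 hsurj, finrank_top, Module.finrank_prod, Module.finrank_self,
        Module.finrank_fintype_fun_eq_card] at h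
      omega
    have hle : LinearMap.ker X.mulVecLin ≤ LinearMap.ker φ := by
      intro v hv
      rw [LinearMap.mem_ker, Matrix.mulVecLin_apply] at hv
      rw [LinearMap.mem_ker, hφ, hv]
      rfl
    constructor
    · intro h r s
      have heq := Submodule.eq_of_le_of_finrank_eq hle (by omega)
      -- The basis vector at `s` is corrected at `p` and `q` so that the rows `p` and `q` vanish on
      -- it; row `r` then yields the identity.
      have hv : Pi.single s 1 + X s q • Pi.single p 1 + X s p • Pi.single q 1 ∈
          LinearMap.ker φ := by
        rw [LinearMap.mem_ker, map_add, map_add, map_smul, map_smul, hφ, hφ, hφ]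
        simp [h0, hpq, hqp, hs p s, hs q s, h2]
      rw [← heq, LinearMap.mem_ker] at hv
      have hr := congrFun hv r
      rw [map_add, map_add, map_smul, map_smul] at hr
      simp only [Matrix.mulVecLin_apply, Matrix.mulVec_single_one, Pi.add_apply, Pi.smul_apply,
        Matrix.col_apply, smul_eq_mul, Pi.zero_apply] at hr
      have h3 : ∀ a b c : ZMod 2, a + b + c = 0 → a = b + c := by decide
      rw [h3 _ _ _ hr]
      ring
    · intro h
      rw [← hfin]
      suffices LinearMap.ker X.mulVecLin = LinearMap.ker φ by rw [this]
      refine le_antisymm hle fun v hv => ?_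
      rw [LinearMap.mem_ker, hφ, Prod.mk_eq_zero] at hv
      rw [LinearMap.mem_ker, Matrix.mulVecLin_apply]
      funext r
      have h3 : X.mulVec v r = X r p * X.mulVec v q + X r q * X.mulVec v p := by
        simp only [Matrix.mulVec, dotProduct, Finset.mul_sum]
        rw [← Finset.sum_add_distrib]
        refine Finset.sum_congr rfl fun s _ => ?_
        rw [h r s, hs q s, hs p s]
        ring
      rw [h3, hv.1, hv.2, mul_zero, mul_zero, add_zero]
      rfl
  by_cases hex : ∃ p q, X p q = 1
  · obtain ⟨p, q, hpq⟩ := hex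
    constructor
    · intro h
      exact ⟨⟨p, q, hpq⟩, fun p' q' r s h' => (key p' q' h').1 h r s⟩
    · intro h
      exact (key p q hpq).2 fun r s => h.2 p q r s hpq
  · refine iff_of_false (fun h => ?_) fun h => hex h.1
    have hX : X = 0 := by
      ext p q
      have h1 : ∀ x : ZMod 2, x ≠ 1 → x = 0 := by decide
      exact h1 _ fun h => hex ⟨p, q, h⟩
    rw [hX, Matrix.mulVecLin_zero, LinearMap.ker_zero, finrank_top,
      Module.finrank_fintype_fun_eq_card] at h
    omega

end Alternating

/-- This makes the number of cycles accessible to linear algebra: invariant functions are the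
functions on the set of cycles. -/
theorem card_invariant_functions {D : Type*} [Finite D] (π : Equiv.Perm D) :
    Nat.card {g : D → ZMod 2 // ∀ d, g (π d) = g d} = 2 ^ cycleCount π := by
  have hinv : ∀ g : D → ZMod 2, (∀ d, g (π d) = g d) → ∀ d e, π.SameCycle d e → g d = g e := by
    rintro g hg d e ⟨i, rfl⟩
    induction i with
    | zero => rfl
    | succ i ih => rw [add_comm, zpow_add, Equiv.Perm.mul_apply, zpow_one, hg, ih]
    | pred i ih =>
      rw [ih, ← hg ((π ^ (-(i : ℤ) - 1)) d), ← Equiv.Perm.mul_apply, ← zpow_one_add]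
      congr 3
      ring
  let e : {g : D → ZMod 2 // ∀ d, g (π d) = g d} ≃
      (Quotient (Equiv.Perm.SameCycle.setoid π) → ZMod 2) :=
    { toFun := fun g => Quotient.lift g.1 (hinv g.1 g.2)
      invFun := fun f => ⟨fun d => f (Quotient.mk _ d), fun d => congrArg f
        (Quotient.sound (s := Equiv.Perm.SameCycle.setoid π) ⟨-1, by simp⟩)⟩
      left_inv := fun g => rfl
      right_inv := fun f => by
        funext x
        induction x using Quotient.inductionOn
        rfl }
  rw [Nat.card_congr e, Nat.card_fun, Nat.card_zmod, cycleCount]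

section Chord

variable {A : Type*} [Fintype A] {N : ℕ}

/-- The chord diagram on `N + 1` points with chords `β (a, false) — β (a, true)`:
functions that are constant on the faces correspond to elements of the kernel of the crossing
matrix, up to a constant. -/
theorem card_face_functions (β : A × Bool ≃ Fin (N + 1))
    (hlt : ∀ a, β (a, false) < β (a, true)) (X : Matrix A A (ZMod 2))
    (hX : ∀ a b, X a b = ∑ t : Bool,
      if β (a, false) < β (b, t) ∧ β (b, t) < β (a, true) then 1 else 0) :
    Nat.card {g : Fin (N + 1) → ZMod 2 //
      ∀ a t, g (β (a, !t)) = g (β (a, t) - 1)} =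
      2 * Nat.card (LinearMap.ker X.mulVecLin) := by
  have h2 : ∀ x : ZMod 2, x + x = 0 := by decide
  have htel : ∀ (g t : Fin (N + 1) → ZMod 2), (∀ i, g i = g (i - 1) + t i) →
      ∀ i j : Fin (N + 1), i ≤ j →
        ∑ k ∈ Finset.univ.filter (fun k => i < k ∧ k ≤ j), t k = g j + g i := by
    intro g t hg i j
    induction j using Fin.induction with
    | zero =>
      intro h
      have hi : i = 0 := le_antisymm h (Fin.zero_le _)
      subst hi
      rw [h2, Finset.filter_eq_empty_iff.2, Finset.sum_empty]
      rintro k -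
      exact fun h => absurd h.1 (not_lt.2 h.2)
    | succ j ih =>
      intro h
      rcases h.eq_or_lt with rfl | h
      · rw [h2, Finset.filter_eq_empty_iff.2, Finset.sum_empty]
        rintro k -
        exact fun h => absurd h.1 (not_lt.2 h.2)
      · have hij : i ≤ j.castSucc := by
          rw [Fin.le_def, Fin.val_castSucc]
          rw [Fin.lt_def, Fin.val_succ] at h
          omega
        have hs : Finset.univ.filter (fun k => i < k ∧ k ≤ j.succ) =
            insert j.succ (Finset.univ.filter (fun k => i < k ∧ k ≤ j.castSucc)) := by
          ext k
          simp only [Finset.mem_filter, Finset.mem_univ, true_and, Finset.mem_insert, Fin.lt_def,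
            Fin.le_def, Fin.ext_iff, Fin.val_succ, Fin.val_castSucc] at h ⊢
          omega
        rw [hs, Finset.sum_insert, ih hij, hg j.succ]
        · have : j.succ - 1 = j.castSucc := by
            rw [sub_eq_iff_eq_add, Fin.coeSucc_eq_succ]
          rw [this]
          ring
        · simp [Fin.le_def]
  have htot : ∀ S : A → ZMod 2, ∑ k, S (β.symm k).1 = 0 := by
    intro S
    rw [← β.sum_comp, Fintype.sum_prod_type]
    refine Finset.sum_eq_zero fun a _ => ?_
    rw [Fintype.sum_bool, Equiv.symm_apply_apply, Equiv.symm_apply_apply]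
    exact h2 _
  -- Here `S` gives the jump of `g` at both ends of a chord. The jumps strictly inside the chord `a`
  -- add up to the entry `a` of `X S`, since `X a b` counts the ends of `b` inside `a`.
  have hmul : ∀ (S : A → ZMod 2) (g : Fin (N + 1) → ZMod 2),
      (∀ i, g i = g (i - 1) + S (β.symm i).1) → ∀ a,
        X.mulVec S a = g (β (a, true) - 1) + g (β (a, false)) := by
    intro S g hg a
    have hpos : 0 < β (a, true) := lt_of_le_of_lt (Fin.zero_le _) (hlt a)
    have hval : (β (a, true) - 1 : Fin (N + 1)).val = (β (a, true)).val - 1 := by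
      rw [Fin.val_sub_one_of_ne_zero hpos.ne']
    have hl := hlt a
    rw [Fin.lt_def] at hl
    rw [← htel g _ hg _ _ (by rw [Fin.le_def, hval]; omega), Finset.sum_filter, ← β.sum_comp,
      Fintype.sum_prod_type]
    simp only [Matrix.mulVec, dotProduct]
    refine Finset.sum_congr rfl fun b _ => ?_
    rw [hX, Finset.sum_mul]
    refine Finset.sum_congr rfl fun t _ => ?_
    rw [Equiv.symm_apply_apply, ite_mul, one_mul, zero_mul]
    congr 1
    rw [Fin.le_def, hval, Fin.lt_def, Fin.lt_def]
    exact propext ⟨fun h => ⟨h.1, by omega⟩, fun h => ⟨h.1, by omega⟩⟩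
  -- With equal jumps at both ends of a chord, the face conditions at its two ends are equivalent,
  -- and either says that the jumps inside the chord cancel.
  have hinv : ∀ (S : A → ZMod 2) (g : Fin (N + 1) → ZMod 2),
      (∀ i, g i = g (i - 1) + S (β.symm i).1) →
        ((∀ a t, g (β (a, !t)) = g (β (a, t) - 1)) ↔ S ∈ LinearMap.ker X.mulVecLin) := by
    intro S g hg
    have h3 : ∀ x y : ZMod 2, x + y = 0 ↔ y = x := by decide
    have h4 : ∀ x y z u v : ZMod 2, u = y + v → z = x + v → (z = y ↔ u = x) := by decide
    rw [LinearMap.mem_ker, Matrix.mulVecLin_apply, funext_iff]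
    refine forall_congr' fun a => ?_
    rw [Bool.forall_bool, hmul S g hg a, Pi.zero_apply, h3]
    have e1 := hg (β (a, true))
    have e2 := hg (β (a, false))
    rw [Equiv.symm_apply_apply] at e1 e2
    exact and_iff_right_of_imp fun h => (h4 _ _ _ _ _ e2 e1).2 h
  -- The constant `c` is the value at the last point `0 - 1`. The recursion closes up around the
  -- circle because every chord contributes its jump twice.
  let G : (A → ZMod 2) → ZMod 2 → Fin (N + 1) → ZMod 2 := fun S c i =>
    c + ∑ k ∈ Finset.univ.filter (fun k => k ≤ i), S (β.symm k).1
  have hlast : ∀ S c, G S c (0 - 1) = c := by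
    intro S c
    have h5 : Finset.univ.filter (fun k : Fin (N + 1) => k ≤ 0 - 1) = Finset.univ := by
      rw [Finset.filter_eq_self]
      rintro k -
      rw [show (0 - 1 : Fin (N + 1)) = Fin.last N by rw [sub_eq_iff_eq_add, Fin.last_add_one]]
      exact Fin.le_last k
    simp only [G]
    rw [h5, htot, add_zero]
  have hsucc : ∀ j : Fin N, j.succ - 1 = j.castSucc := fun j => by
    rw [sub_eq_iff_eq_add, Fin.coeSucc_eq_succ]
  have hG : ∀ S c i, G S c i = G S c (i - 1) + S (β.symm i).1 := by
    intro S c i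
    induction i using Fin.cases with
    | zero =>
      have h6 : Finset.univ.filter (fun k : Fin (N + 1) => k ≤ 0) = {0} := by
        ext k
        simp
      rw [hlast]
      simp only [G]
      rw [h6, Finset.sum_singleton]
    | succ j =>
      have hs : Finset.univ.filter (fun k => k ≤ j.succ) =
          insert j.succ (Finset.univ.filter (fun k => k ≤ j.castSucc)) := by
        ext k
        simp only [Finset.mem_filter, Finset.mem_univ, true_and, Finset.mem_insert,
          Fin.le_def, Fin.ext_iff, Fin.val_succ, Fin.val_castSucc]
        omega
      rw [hsucc]
      simp only [G]
      rw [hs, Finset.sum_insert (by simp [Fin.le_def]), add_comm (S _), add_assoc]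
  let e : LinearMap.ker X.mulVecLin × ZMod 2 → {g : Fin (N + 1) → ZMod 2 //
      ∀ a t, g (β (a, !t)) = g (β (a, t) - 1)} := fun p =>
    ⟨G p.1.1 p.2, (hinv p.1.1 _ (hG _ _)).2 p.1.2⟩
  have he : Function.Bijective e := by
    constructor
    · rintro ⟨⟨S, hS⟩, c⟩ ⟨⟨S', hS'⟩, c'⟩ h
      have h : G S c = G S' c' := congrArg Subtype.val h
      have h1 : c = c' := by rw [← hlast S c, h, hlast]
      have h3 : S = S' := by
        funext a
        have h4 := hG S c (β (a, true))
        rw [h, hG S' c', Equiv.symm_apply_apply] at h4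
        exact (add_left_cancel h4).symm
      subst h1 h3
      rfl
    · rintro ⟨g, hg⟩
      -- The jump is read off at one end; the face conditions give the same jump at the other.
      set S : A → ZMod 2 := fun a => g (β (a, true)) + g (β (a, true) - 1) with hS
      have hgS : ∀ i, g i = g (i - 1) + S (β.symm i).1 := by
        intro i
        obtain ⟨⟨a, t⟩, rfl⟩ := β.surjective i
        rw [Equiv.symm_apply_apply, hS]
        have h3 : ∀ x y : ZMod 2, x = y + (x + y) := by decide
        have h4 : ∀ x y : ZMod 2, x = y + (y + x) := by decide
        cases t
        · have h5 := hg a true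
          have h6 := hg a false
          simp only [Bool.not_true, Bool.not_false] at h5 h6
          dsimp only
          rw [← h5, h6]
          exact h4 _ _
        · exact h3 _ _
      refine ⟨⟨⟨S, (hinv S g hgS).1 hg⟩, g (0 - 1)⟩, Subtype.ext (funext fun i => ?_)⟩
      change G S (g (0 - 1)) i = g i
      induction i using Fin.induction with
      | zero => rw [hG, hlast, hgS 0]
      | succ j ih => rw [hG, hgS j.succ, hsucc, ih]
  rw [← Nat.card_congr (Equiv.ofBijective e he), Nat.card_prod, Nat.card_zmod, mul_comm]

end Chord

/-! ### Crossings of edges and genus one -/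

variable {n : ℕ}

/-- `c` lies strictly between `a` and `b`. -/
def StrictlyBetween (a b c : ℕ) : Prop := (a < c ∧ c < b) ∨ (b < c ∧ c < a)

/-- The chords `a b` and `c d` cross. -/
def Crossing (a b c d : Fin n) : Prop :=
  (c.val ≠ a ∧ c.val ≠ b ∧ d.val ≠ a ∧ d.val ≠ b) ∧
    (StrictlyBetween a b c ↔ ¬ StrictlyBetween a b d)

/-- The crossing edges of `G` form a complete multipartite graph with two or three parts. -/
def HasOneHandle (G : SimpleGraph (Fin n)) : Prop :=
  (∃ a b c d, G.Adj a b ∧ G.Adj c d ∧ Crossing a b c d) ∧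
    ∀ a b c d u v w x, G.Adj a b → G.Adj c d → G.Adj u v → G.Adj w x → Crossing a b c d →
      (Crossing u v w x ↔
        ¬ (Crossing u v a b ∧ Crossing w x c d ↔ Crossing u v c d ∧ Crossing w x a b))

theorem Crossing.comm {a b c d : Fin n} (hab : a ≠ b) (hcd : c ≠ d) :
    Crossing a b c d ↔ Crossing c d a b := by
  have h1 : a.val ≠ b := fun h => hab (Fin.ext h)
  have h2 : c.val ≠ d := fun h => hcd (Fin.ext h)
  unfold Crossing StrictlyBetween
  omega

theorem Crossing.swap_left (a b c d : Fin n) : Crossing b a c d ↔ Crossing a b c d := by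
  unfold Crossing StrictlyBetween
  omega

theorem Crossing.swap_right (a b c d : Fin n) : Crossing a b d c ↔ Crossing a b c d := by
  unfold Crossing StrictlyBetween
  omega

/-- The edges of `G`, as pairs `(a, b)` with `a < b`. -/
abbrev Chord (G : SimpleGraph (Fin n)) := {p : Fin n × Fin n // p.1 < p.2 ∧ G.Adj p.1 p.2}

noncomputable instance (G : SimpleGraph (Fin n)) : Fintype (Chord G) := Fintype.ofFinite _

/-- Every edge has two half-edges. -/
def dartEquiv (G : SimpleGraph (Fin n)) : Chord G × Bool ≃ G.Dart where
  toFun p := bif p.2 then ⟨(p.1.1.2, p.1.1.1), p.1.2.2.symm⟩ else ⟨(p.1.1.1, p.1.1.2), p.1.2.2⟩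
  invFun d := if h : d.fst < d.snd then (⟨(d.fst, d.snd), h, d.adj⟩, false)
    else (⟨(d.snd, d.fst), lt_of_le_of_ne (not_lt.1 h) d.adj.ne.symm, d.adj.symm⟩, true)
  left_inv := by
    rintro ⟨⟨⟨a, b⟩, h, h'⟩, t⟩
    cases t
    · exact dif_pos h
    · exact dif_neg (not_lt.2 h.le)
  right_inv := by
    rintro ⟨⟨a, b⟩, h⟩
    by_cases hc : a < b
    · dsimp only
      rw [dif_pos hc]
      rfl
    · dsimp only
      rw [dif_neg hc]
      rfl

theorem matching_dartEquiv (G : SimpleGraph (Fin n)) (a : Chord G) (t : Bool) :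
    matching G (dartEquiv G (a, t)) = dartEquiv G (a, !t) := by
  cases t <;> rfl

theorem matching_inv (G : SimpleGraph (Fin n)) : (matching G)⁻¹ = matching G := by
  ext1 d
  rw [Equiv.Perm.inv_eq_iff_eq]
  exact (SimpleGraph.Dart.symm_involutive d).symm

theorem card_dart_eq (G : SimpleGraph (Fin n)) :
    Fintype.card G.Dart = 2 * Fintype.card (Chord G) := by
  rw [← Fintype.card_congr (dartEquiv G), Fintype.card_prod, Fintype.card_bool, mul_comm]

theorem cycleCount_matching (G : SimpleGraph (Fin n)) :
    cycleCount (matching G) = Fintype.card (Chord G) := by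
  refine Nat.pow_right_injective (le_refl 2) ?_
  dsimp only
  rw [← card_invariant_functions]
  let e : {g : G.Dart → ZMod 2 // ∀ d, g (matching G d) = g d} ≃ (Chord G → ZMod 2) :=
    { toFun := fun g a => g.1 (dartEquiv G (a, false))
      invFun := fun f => ⟨fun d => f ((dartEquiv G).symm d).1, fun d => by
        obtain ⟨⟨a, t⟩, rfl⟩ := (dartEquiv G).surjective d
        dsimp only
        rw [matching_dartEquiv, Equiv.symm_apply_apply, Equiv.symm_apply_apply]⟩
      left_inv := fun g => by
        refine Subtype.ext (funext fun d => ?_)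
        obtain ⟨⟨a, t⟩, rfl⟩ := (dartEquiv G).surjective d
        dsimp only
        rw [Equiv.symm_apply_apply]
        cases t
        · rfl
        · rw [← g.2, matching_dartEquiv]
          rfl
      right_inv := fun f => by
        funext a
        dsimp only
        rw [Equiv.symm_apply_apply] }
  rw [Nat.card_congr e, Nat.card_fun, Nat.card_zmod, Nat.card_eq_fintype_card]

theorem Fin.val_sub_eq_ite (a b : Fin n) :
    (a - b).val = if b.val ≤ a.val then a.val - b.val else n + a.val - b.val := by
  have ha := a.isLt
  have hb := b.isLt
  rw [Fin.sub_def]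
  dsimp only
  split_ifs with h
  · rw [show n - b.val + a.val = (a.val - b.val) + n by omega, Nat.add_mod_right,
      Nat.mod_eq_of_lt (by omega)]
  · rw [Nat.mod_eq_of_lt (by omega)]
    omega

theorem numbering_symm_lt_iff (G : SimpleGraph (Fin n)) (d e : G.Dart) :
    (numbering G).symm d < (numbering G).symm e ↔
      d.fst.val < e.fst.val ∨
        (d.fst.val = e.fst.val ∧ (d.fst - d.snd).val < (e.fst - e.snd).val) := by
  let _ := circularOrder G
  have h : (numbering G).symm d < (numbering G).symm e ↔ position G d < position G e :=
    (monoEquivOfFin G.Dart rfl).symm.lt_iff_lt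
  rw [h, position, position, Prod.Lex.toLex_lt_toLex, Fin.lt_def, Fin.lt_def, Fin.ext_iff]

open Classical in
/-- The matrix of the crossings of the edges, over the field with two elements. -/
noncomputable def crossingMatrix (G : SimpleGraph (Fin n)) :
    Matrix (Chord G) (Chord G) (ZMod 2) :=
  fun p q => if Crossing p.1.1 p.1.2 q.1.1 q.1.2 then 1 else 0

theorem crossingMatrix_eq_one_iff (G : SimpleGraph (Fin n)) (p q : Chord G) :
    crossingMatrix G p q = 1 ↔ Crossing p.1.1 p.1.2 q.1.1 q.1.2 := by
  classical
  unfold crossingMatrix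
  split_ifs with h
  · exact iff_of_true rfl h
  · exact iff_of_false (by decide) h

/-- The order of the half-edges at a vertex matters here: an edge that meets `p` in a vertex has
both or none of its half-edges between those of `p`, so it contributes zero modulo 2, as it must. -/
theorem crossingMatrix_eq_sum (G : SimpleGraph (Fin n)) (p q : Chord G) :
    crossingMatrix G p q = ∑ t : Bool,
      if (numbering G).symm (dartEquiv G (p, false)) < (numbering G).symm (dartEquiv G (q, t)) ∧
        (numbering G).symm (dartEquiv G (q, t)) < (numbering G).symm (dartEquiv G (p, true))
      then 1 else 0 := by
  classical
  have hite : ∀ (P Q R : Prop) [Decidable P] [Decidable Q] [Decidable R], (P ↔ ¬ (Q ↔ R)) →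
      (if P then (1 : ZMod 2) else 0) = (if Q then 1 else 0) + (if R then 1 else 0) := by
    intro P Q R _ _ _ h
    have h2 : (1 : ZMod 2) + 1 = 0 := by decide
    by_cases hQ : Q <;> by_cases hR : R <;> simp [h, hQ, hR, h2]
  obtain ⟨⟨a, b⟩, hab, h⟩ := p
  obtain ⟨⟨c, d⟩, hcd, h'⟩ := q
  have key : ∀ e : G.Dart,
      ((numbering G).symm (dartEquiv G (⟨(a, b), hab, h⟩, false)) < (numbering G).symm e ∧
        (numbering G).symm e < (numbering G).symm (dartEquiv G (⟨(a, b), hab, h⟩, true))) ↔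
      ((a.val < e.fst.val ∧ e.fst.val < b.val) ∨
        ((e.fst.val = a.val ∨ e.fst.val = b.val) ∧ a.val < e.snd.val ∧ e.snd.val < b.val)) := by
    intro e
    have h1 : e.fst.val ≠ e.snd.val := fun h => e.adj.ne (Fin.ext h)
    rw [numbering_symm_lt_iff, numbering_symm_lt_iff]
    simp only [dartEquiv, Equiv.coe_fn_mk, cond_true, cond_false, Fin.val_sub_eq_ite]
    have ha := a.isLt
    have hb := b.isLt
    have hc := e.fst.isLt
    have hd := e.snd.isLt
    rw [Fin.lt_def] at hab
    dsimp only at hab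
    split_ifs <;> omega
  rw [Fintype.sum_bool]
  simp only [key]
  unfold crossingMatrix
  refine hite _ _ _ ?_
  simp only [dartEquiv, Equiv.coe_fn_mk, cond_true, cond_false, Crossing, StrictlyBetween]
  rw [Fin.lt_def] at hab hcd
  dsimp only at hab hcd
  omega

theorem card_face_functions_dart (G : SimpleGraph (Fin n)) (hG : 0 < Fintype.card G.Dart) :
    Nat.card {g : G.Dart → ZMod 2 // ∀ d, g (((matching G)⁻¹ * rotation G) d) = g d} =
      2 * Nat.card (LinearMap.ker (crossingMatrix G).mulVecLin) := by
  classical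
  have hlt : ∀ p : Chord G, (numbering G).symm (dartEquiv G (p, false)) <
      (numbering G).symm (dartEquiv G (p, true)) := fun p => by
    rw [numbering_symm_lt_iff]
    exact Or.inl p.2.1
  have hX := crossingMatrix_eq_sum G
  rw [matching_inv]
  unfold rotation
  generalize numbering G = num at hlt hX ⊢
  obtain ⟨N, hN⟩ : ∃ N, Fintype.card G.Dart = N + 1 := ⟨_, (Nat.succ_pred_eq_of_pos hG).symm⟩
  generalize Fintype.card G.Dart = M at num hlt hX hG hN ⊢
  subst hN
  rw [← card_face_functions ((dartEquiv G).trans num.symm) hlt (crossingMatrix G) hX]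
  refine Nat.card_congr ((num.symm.arrowCongr (Equiv.refl _)).subtypeEquiv fun g => ?_)
  simp only [Equiv.arrowCongr_apply, Equiv.coe_refl, Function.comp, id, Equiv.symm_symm,
    Equiv.trans_apply, Equiv.apply_symm_apply, Equiv.Perm.mul_apply, Equiv.permCongr_apply,
    finRotate_apply]
  constructor
  · intro h a t
    have h1 := h (num (num.symm (dartEquiv G (a, t)) - 1))
    rwa [Equiv.symm_apply_apply, sub_add_cancel, Equiv.apply_symm_apply, matching_dartEquiv] at h1
  · intro h d
    obtain ⟨⟨a, t⟩, hat⟩ := (dartEquiv G).surjective (num (num.symm d + 1))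
    rw [← hat, matching_dartEquiv, h, hat, Equiv.symm_apply_apply, add_sub_cancel_right,
      Equiv.apply_symm_apply]

theorem Chord.nonempty_of_adj {G : SimpleGraph (Fin n)} {a b : Fin n} (h : G.Adj a b) :
    Nonempty (Chord G) := by
  rcases lt_or_gt_of_ne h.ne with h1 | h1
  · exact ⟨⟨(a, b), h1, h⟩⟩
  · exact ⟨⟨(b, a), h1, h.symm⟩⟩

/-- A graph with at least one edge has genus one if and only if its crossing edges form a complete
multipartite graph with two or three parts. -/
theorem genus_eq_one_iff {G : SimpleGraph (Fin n)} {a b : Fin n} (hab : G.Adj a b) :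
    genus G = 1 ↔ HasOneHandle G := by
  classical
  have hne := Chord.nonempty_of_adj hab
  have hpos : 0 < Fintype.card (Chord G) := Fintype.card_pos
  -- Both sides are exponents of two in the count of the functions that are constant on the faces.
  have hz : cycleCount ((matching G)⁻¹ * rotation G) =
      Module.finrank (ZMod 2) (LinearMap.ker (crossingMatrix G).mulVecLin) + 1 := by
    refine Nat.pow_right_injective (le_refl 2) ?_
    dsimp only
    rw [← card_invariant_functions, card_face_functions_dart G (by rw [card_dart_eq]; omega),
      Module.natCard_eq_pow_finrank (K := ZMod 2), Nat.card_zmod, pow_succ, mul_comm]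
  have h1 : genus G = 1 ↔
      Module.finrank (ZMod 2) (LinearMap.ker (crossingMatrix G).mulVecLin) + 2 =
        Fintype.card (Chord G) := by
    rw [genus, hz, cycleCount_matching, card_dart_eq, ← @Nat.cast_inj ℚ]
    push_cast
    constructor <;> intro h <;> linarith
  have h0 : ∀ x : ZMod 2, x = 0 ∨ x = 1 := by decide
  rw [h1, finrank_ker_add_two_eq_card_iff]
  -- Over the field with two elements, the rank-two identity is the logical condition of
  -- `HasOneHandle`.
  · have hz2 : ∀ x y z u v : ZMod 2, x = y * z + u * v ↔
        (x = 1 ↔ ¬ (y = 1 ∧ z = 1 ↔ u = 1 ∧ v = 1)) := by decide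
    simp only [hz2, crossingMatrix_eq_one_iff]
    constructor
    · rintro ⟨⟨p, q, hpq⟩, h⟩
      refine ⟨⟨_, _, _, _, p.2.2, q.2.2, hpq⟩, fun a b c d u v w x hab hcd huv hwx hc => ?_⟩
      have hcomm := fun c d (h : G.Adj c d) u v (h' : G.Adj u v) => Crossing.comm h.ne h'.ne
      have lift : ∀ a b, G.Adj a b → ∃ p : Chord G,
          (∀ c d, Crossing a b c d ↔ Crossing p.1.1 p.1.2 c d) ∧
          (∀ c d, Crossing c d a b ↔ Crossing c d p.1.1 p.1.2) := by
        intro a b hab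
        rcases lt_or_gt_of_ne hab.ne with h1 | h1
        · exact ⟨⟨(a, b), h1, hab⟩, fun c d => Iff.rfl, fun c d => Iff.rfl⟩
        · exact ⟨⟨(b, a), h1, hab.symm⟩, fun c d => (Crossing.swap_left _ _ _ _).symm,
            fun c d => (Crossing.swap_right _ _ _ _).symm⟩
      obtain ⟨p, hp, hp'⟩ := lift a b hab
      obtain ⟨q, hq, hq'⟩ := lift c d hcd
      obtain ⟨r, hr, hr'⟩ := lift u v huv
      obtain ⟨s, hs, hs'⟩ := lift w x hwx
      rw [hp, hq'] at hc
      rw [hr, hs', hr, hp', hs, hq', hr, hq', hs, hp']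
      exact h p q r s hc
    · rintro ⟨⟨a, b, c, d, hab, hcd, hc⟩, h⟩
      refine ⟨?_, fun p q r s hpq => h _ _ _ _ _ _ _ _ p.2.2 q.2.2 r.2.2 s.2.2 hpq⟩
      rcases lt_or_gt_of_ne hab.ne with h1 | h1 <;> rcases lt_or_gt_of_ne hcd.ne with h2 | h2
      · exact ⟨⟨(a, b), h1, hab⟩, ⟨(c, d), h2, hcd⟩, hc⟩
      · exact ⟨⟨(a, b), h1, hab⟩, ⟨(d, c), h2, hcd.symm⟩, (Crossing.swap_right _ _ _ _).2 hc⟩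
      · exact ⟨⟨(b, a), h1, hab.symm⟩, ⟨(c, d), h2, hcd⟩, (Crossing.swap_left _ _ _ _).2 hc⟩
      · exact ⟨⟨(b, a), h1, hab.symm⟩, ⟨(d, c), h2, hcd.symm⟩,
          (Crossing.swap_left _ _ _ _).2 ((Crossing.swap_right _ _ _ _).2 hc)⟩
  · intro p q
    have h2 : crossingMatrix G p q = 1 ↔ crossingMatrix G q p = 1 := by
      rw [crossingMatrix_eq_one_iff, crossingMatrix_eq_one_iff]
      exact Crossing.comm p.2.2.ne q.2.2.ne
    rcases h0 (crossingMatrix G p q) with h3 | h3 <;> rcases h0 (crossingMatrix G q p) with h4 | h4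
    · rw [h3, h4]
    · exact absurd (h2.2 h4) (by rw [h3]; decide)
    · exact absurd (h2.1 h3) (by rw [h4]; decide)
    · rw [h3, h4]
  · intro p
    refine (h0 _).resolve_right fun h => ?_
    exact ((crossingMatrix_eq_one_iff G p p).1 h).1.1 rfl

/-! ### Free actions and automorphisms of trees that flip an edge -/

theorem card_dvd_card_of_free {Γ Y : Type*} [AddGroup Γ] [AddAction Γ Y] (S : Set Y)
    (hS : ∀ (g : Γ), ∀ y ∈ S, g +ᵥ y ∈ S) (hfree : ∀ (g : Γ), ∀ y ∈ S, g +ᵥ y = y → g = 0) :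
    Nat.card Γ ∣ Nat.card S := by
  let _ : AddAction Γ S :=
    { vadd := fun g y => ⟨g +ᵥ y.1, hS g y.1 y.2⟩
      zero_vadd := fun y => Subtype.ext (zero_vadd Γ y.1)
      add_vadd := fun g h y => Subtype.ext (add_vadd g h y.1) }
  have h : ∀ y : S, AddAction.stabilizer Γ y = ⊥ := by
    intro y
    rw [eq_bot_iff]
    intro g hg
    exact hfree g y.1 y.2 (congrArg Subtype.val hg)
  rw [Nat.card_congr (AddAction.selfEquivOrbitsQuotientProd h), Nat.card_prod]
  exact dvd_mul_left _ _

section Flip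

variable {V : Type*} {G : SimpleGraph V}

theorem _root_.SimpleGraph.Connected.reachable_deleteEdges_or (hG : G.Connected) (i j v : V) :
    (G.deleteEdges {s(i, j)}).Reachable i v ∨ (G.deleteEdges {s(i, j)}).Reachable j v := by
  suffices h : ∀ u w, G.Walk u w → w = i →
      (G.deleteEdges {s(i, j)}).Reachable i u ∨ (G.deleteEdges {s(i, j)}).Reachable j u by
    obtain ⟨p⟩ := hG.preconnected v i
    exact h v i p rfl
  intro u w p hw
  induction p with
  | nil =>
    rw [hw]
    exact Or.inl (.refl _)
  | @cons u x w h _ ih =>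
    by_cases hc : s(u, x) = s(i, j)
    · rcases Sym2.eq_iff.1 hc with ⟨h1, -⟩ | ⟨h1, -⟩
      · rw [h1]
        exact Or.inl (.refl _)
      · rw [h1]
        exact Or.inr (.refl _)
    · have h1 : (G.deleteEdges {s(i, j)}).Adj x u := by
        rw [SimpleGraph.deleteEdges_adj, Set.mem_singleton_iff, Sym2.eq_swap]
        exact ⟨h.symm, hc⟩
      exact (ih hw).imp (fun h' => h'.trans h1.reachable) fun h' => h'.trans h1.reachable

/-- An automorphism of a tree that exchanges the ends of an edge exchanges the two
components that remain if the edge is deleted. -/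
theorem _root_.SimpleGraph.IsTree.not_reachable_of_flip (hG : G.IsTree) {τ : V → V}
    (hinj : Function.Injective τ) (hτ : ∀ u v, G.Adj u v → G.Adj (τ u) (τ v)) {i j : V}
    (hij : G.Adj i j) (hi : τ i = j) (hj : τ j = i) (v : V) :
    ¬ (G.deleteEdges {s(i, j)}).Reachable v (τ v) := by
  have hb : ¬ (G.deleteEdges {s(i, j)}).Reachable i j :=
    SimpleGraph.isAcyclic_iff_forall_adj_isBridge.1 hG.isAcyclic hij
  let φ : G.deleteEdges {s(i, j)} →g G.deleteEdges {s(i, j)} :=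
    { toFun := τ
      map_rel' := by
        intro u w h
        rw [SimpleGraph.deleteEdges_adj, Set.mem_singleton_iff] at h ⊢
        refine ⟨hτ u w h.1, fun hc => h.2 ?_⟩
        rw [Sym2.eq_iff] at hc ⊢
        rcases hc with ⟨h1, h2⟩ | ⟨h1, h2⟩
        · exact Or.inr ⟨hinj (h1.trans hj.symm), hinj (h2.trans hi.symm)⟩
        · exact Or.inl ⟨hinj (h1.trans hi.symm), hinj (h2.trans hj.symm)⟩ }
  intro h
  rcases hG.connected.reachable_deleteEdges_or i j v with h1 | h1
  · have h2 := h1.map φ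
    rw [show φ i = j from hi] at h2
    exact hb (h1.trans (h.trans h2.symm))
  · have h2 := h1.map φ
    rw [show φ j = i from hj] at h2
    exact hb (h2.trans (h.symm.trans h1.symm))

theorem _root_.SimpleGraph.IsTree.ne_of_flip (hG : G.IsTree) {τ : V → V}
    (hinj : Function.Injective τ) (hτ : ∀ u v, G.Adj u v → G.Adj (τ u) (τ v)) {i j : V}
    (hij : G.Adj i j) (hi : τ i = j) (hj : τ j = i) (v : V) : τ v ≠ v := fun h => by
  refine hG.not_reachable_of_flip hinj hτ hij hi hj v ?_
  rw [h]

/-- Any other flipped edge would survive the deletion and join a vertex to its image, which lies in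
the other component. -/
theorem _root_.SimpleGraph.IsTree.eq_of_flip (hG : G.IsTree) {τ : V → V}
    (hinj : Function.Injective τ) (hτ : ∀ u v, G.Adj u v → G.Adj (τ u) (τ v)) {i j : V}
    (hij : G.Adj i j) (hi : τ i = j) (hj : τ j = i) {v : V} (hv : G.Adj v (τ v)) :
    v = i ∨ v = j := by
  by_contra! hc
  refine hG.not_reachable_of_flip hinj hτ hij hi hj v (SimpleGraph.Adj.reachable ?_)
  rw [SimpleGraph.deleteEdges_adj, Set.mem_singleton_iff]
  refine ⟨hv, fun h => ?_⟩
  rcases Sym2.eq_iff.1 h with h | h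
  · exact hc.1 h.1
  · exact hc.2 h.1

end Flip

/-! ### Rotations and reflections of trees of genus one -/

/-- A tree of genus one, with the genus expressed by the crossings of the edges. -/
def IsGenusOneTree (G : SimpleGraph (Fin n)) : Prop := G.IsTree ∧ HasOneHandle G

theorem f_eq_card (hn : 2 ≤ n) : f n = Nat.card {G : SimpleGraph (Fin n) | IsGenusOneTree G} := by
  refine Nat.card_congr (Equiv.subtypeEquivRight fun G => and_congr_right fun hG => ?_)
  have : Nontrivial (Fin n) := Fin.nontrivial_iff_two_le.2 hn
  obtain ⟨v, hv⟩ := hG.connected.preconnected.exists_adj_of_nontrivial (⟨0, by omega⟩ : Fin n)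
  exact genus_eq_one_iff hv

theorem HasOneHandle.comap {G : SimpleGraph (Fin n)} (hG : HasOneHandle G) (e : Fin n ≃ Fin n)
    (he : ∀ a b c d, Crossing (e a) (e b) (e c) (e d) ↔ Crossing a b c d) :
    HasOneHandle (G.comap e) := by
  refine ⟨?_, fun a b c d u v w x hab hcd huv hwx hc => ?_⟩
  · obtain ⟨a, b, c, d, hab, hcd, hc⟩ := hG.1
    refine ⟨e.symm a, e.symm b, e.symm c, e.symm d, ?_, ?_, ?_⟩
    · rwa [SimpleGraph.comap_adj, Equiv.apply_symm_apply, Equiv.apply_symm_apply]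
    · rwa [SimpleGraph.comap_adj, Equiv.apply_symm_apply, Equiv.apply_symm_apply]
    · rwa [← he, Equiv.apply_symm_apply, Equiv.apply_symm_apply, Equiv.apply_symm_apply,
        Equiv.apply_symm_apply]
  · rw [← he a] at hc
    rw [← he u, ← he u, ← he w, ← he u, ← he w]
    exact hG.2 _ _ _ _ _ _ _ _ hab hcd huv hwx hc

theorem IsGenusOneTree.comap {G : SimpleGraph (Fin n)} (hG : IsGenusOneTree G) (e : Fin n ≃ Fin n)
    (he : ∀ a b c d, Crossing (e a) (e b) (e c) (e d) ↔ Crossing a b c d) :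
    IsGenusOneTree (G.comap e) :=
  ⟨(SimpleGraph.Iso.comap e G).isTree_iff.2 hG.1, hG.2.comap e he⟩

theorem Crossing.add_right [NeZero n] (a b c d r : Fin n) :
    Crossing (a + r) (b + r) (c + r) (d + r) ↔ Crossing a b c d := by
  have h1 := a.isLt
  have h2 := b.isLt
  have h3 := c.isLt
  have h4 := d.isLt
  have h5 := r.isLt
  simp only [Crossing, StrictlyBetween, Fin.val_add_eq_ite]
  split_ifs <;> omega

theorem Crossing.neg [NeZero n] (a b c d : Fin n) :
    Crossing (-a) (-b) (-c) (-d) ↔ Crossing a b c d := by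
  have h1 := a.isLt
  have h2 := b.isLt
  have h3 := c.isLt
  have h4 := d.isLt
  simp only [Crossing, StrictlyBetween, Fin.val_neg, Fin.ext_iff, Fin.val_zero]
  split_ifs <;> omega

/-- The rotation of a graph on the circle. -/
def rotate [NeZero n] (r : Fin n) (G : SimpleGraph (Fin n)) : SimpleGraph (Fin n) :=
  G.comap (Equiv.addRight r)

theorem rotate_adj [NeZero n] {r : Fin n} {G : SimpleGraph (Fin n)} {a b : Fin n} :
    (rotate r G).Adj a b ↔ G.Adj (a + r) (b + r) := Iff.rfl

/-- The reflection of a graph on the circle. -/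
def reflect [NeZero n] (G : SimpleGraph (Fin n)) : SimpleGraph (Fin n) :=
  G.comap (Equiv.neg (Fin n))

theorem reflect_adj [NeZero n] {G : SimpleGraph (Fin n)} {a b : Fin n} :
    (reflect G).Adj a b ↔ G.Adj (-a) (-b) := Iff.rfl

protected theorem IsGenusOneTree.rotate [NeZero n] {G : SimpleGraph (Fin n)} (hG : IsGenusOneTree G)
    (r : Fin n) : IsGenusOneTree (rotate r G) :=
  hG.comap _ fun a b c d => Crossing.add_right a b c d r

protected theorem IsGenusOneTree.reflect [NeZero n] {G : SimpleGraph (Fin n)} (hG : IsGenusOneTree G) :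
    IsGenusOneTree (reflect G) :=
  hG.comap _ Crossing.neg

/-- The group of the rotations of the circle acts on the graphs. -/
instance rotationAction [NeZero n] : AddAction (Fin n) (SimpleGraph (Fin n)) where
  vadd := rotate
  zero_vadd G := by
    ext a b
    change G.Adj (a + 0) (b + 0) ↔ _
    rw [add_zero, add_zero]
  add_vadd r s G := by
    ext a b
    change G.Adj (a + (r + s)) (b + (r + s)) ↔ G.Adj (a + r + s) (b + r + s)
    rw [add_assoc, add_assoc]

theorem vadd_eq_rotate [NeZero n] (r : Fin n) (G : SimpleGraph (Fin n)) :
    r +ᵥ G = rotate r G := rfl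

/-- If a nontrivial rotation preserves a tree, then the tree contains a diameter and is preserved by
the half-turn. -/
theorem exists_halfTurn [NeZero n] {G : SimpleGraph (Fin n)} (hG : G.IsTree) {r : Fin n}
    (hr : r ≠ 0) (h : rotate r G = G) :
    ∃ s : Fin n, s ≠ 0 ∧ s + s = 0 ∧ rotate s G = G ∧ ∃ i, G.Adj i (i + s) := by
  set H := AddAction.stabilizer (Fin n) G with hH
  have hHmem : ∀ s, s ∈ H ↔ rotate s G = G := fun s => Iff.rfl
  let _ : AddAction H (Sym2 (Fin n)) :=
    { vadd := fun s e => e.map (· + s.1)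
      zero_vadd := fun e => by
        induction e using Sym2.ind with
        | _ i j =>
          change s(i + 0, j + 0) = _
          rw [add_zero, add_zero]
      add_vadd := fun s t e => by
        induction e using Sym2.ind with
        | _ i j =>
          change s(i + (s.1 + t.1), j + (s.1 + t.1)) = s(i + t.1 + s.1, j + t.1 + s.1)
          rw [add_comm s.1, add_assoc, add_assoc] }
  -- A free action on the edges makes the order of `H` a divisor of both `n - 1` and `n`.
  by_cases hfree : ∀ s : H, ∀ e ∈ G.edgeSet, s +ᵥ e = e → s = 0
  · exfalso
    have h1 : Nat.card H ∣ Nat.card G.edgeSet := by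
      refine card_dvd_card_of_free G.edgeSet (fun s e he => ?_) hfree
      induction e using Sym2.ind with
      | _ i j =>
        change G.Adj (i + s.1) (j + s.1)
        have h2 := (hHmem s.1).1 s.2
        rw [← rotate_adj, h2]
        exact he
    have h2 : Nat.card H ∣ Nat.card (Fin n) := AddSubgroup.card_addSubgroup_dvd_card H
    rw [← (SimpleGraph.isTree_iff_connected_and_card.1 hG).2] at h2
    have h3 : Nat.card H = 1 := Nat.dvd_one.1 ((Nat.dvd_add_right h1).1 h2)
    rw [AddSubgroup.card_eq_one] at h3
    have h4 : r ∈ H := (hHmem r).2 h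
    rw [h3, AddSubgroup.mem_bot] at h4
    exact hr h4
  · push Not at hfree
    obtain ⟨s, e, he, hse, hs⟩ := hfree
    have hs' : s.1 ≠ 0 := fun h => hs (Subtype.ext h)
    induction e using Sym2.ind with
    | _ i j =>
      replace hse : s(i + s.1, j + s.1) = s(i, j) := hse
      -- A nonzero rotation fixes no point, so it exchanges the two ends, and its square fixes them.
      rcases Sym2.eq_iff.1 hse with ⟨h1, -⟩ | ⟨h1, h2⟩
      · exact absurd (add_eq_left.1 h1) hs'
      · refine ⟨s.1, hs', ?_, (hHmem s.1).1 s.2, i, ?_⟩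
        · rw [← h1, add_assoc] at h2
          exact add_eq_left.1 h2
        · rw [h1]
          exact he

/-- The trees of genus one that are preserved by the rotation `h` and contain the edge from
`0` to `h`. -/
def SymmetricTrees [NeZero n] (h : Fin n) : Set (SimpleGraph (Fin n)) :=
  {G | IsGenusOneTree G ∧ rotate h G = G ∧ G.Adj 0 h}

theorem dvd_f_of_no_halfTurn [NeZero n] (hn : 2 ≤ n) (h : ∀ s : Fin n, s + s = 0 → s = 0) :
    n ∣ f n := by
  rw [f_eq_card hn]
  have h1 := card_dvd_card_of_free (Γ := Fin n) {G : SimpleGraph (Fin n) | IsGenusOneTree G}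
    (fun r G hG => IsGenusOneTree.rotate hG r) fun r G hG hr => by
      by_contra hne
      obtain ⟨s, h1, h2, -⟩ := exists_halfTurn hG.1 hne hr
      exact h1 (h s h2)
  rwa [Nat.card_fin] at h1

section HalfTurn

variable {m : ℕ} [NeZero n] {h : Fin n}

theorem eq_half (hnm : n = 2 * m) (hh : h.val = m) {s : Fin n} (hs : s ≠ 0) (hs2 : s + s = 0) :
    s = h := by
  have h1 : (s + s).val = 0 := by rw [hs2]; rfl
  have h2 : s.val ≠ 0 := fun h => hs (Fin.ext h)
  have := s.isLt
  rw [Fin.val_add_eq_ite] at h1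
  refine Fin.ext ?_
  split_ifs at h1 <;> omega

theorem half_add_half (hnm : n = 2 * m) (hh : h.val = m) : h + h = 0 := by
  refine Fin.ext ?_
  rw [Fin.val_add_eq_ite, hh, if_pos (by omega), Fin.val_zero]
  omega

theorem IsGenusOneTree.eq_of_diameters {G : SimpleGraph (Fin n)} (hG : IsGenusOneTree G)
    (hnm : n = 2 * m) (hh : h.val = m) (hr : rotate h G = G) {i j : Fin n}
    (hi : G.Adj i (i + h)) (hj : G.Adj j (j + h)) : j = i ∨ j = i + h :=
  hG.1.eq_of_flip (τ := fun x => x + h) (add_left_injective h)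
    (fun u v huv => by rwa [← rotate_adj, hr]) hi rfl
    (by rw [add_assoc, half_add_half hnm hh, add_zero]) hj

theorem rotate_rotate (r s : Fin n) (G : SimpleGraph (Fin n)) :
    rotate r (rotate s G) = rotate (r + s) G := (add_vadd r s G).symm

theorem rotate_zero (G : SimpleGraph (Fin n)) : rotate 0 G = G := zero_vadd (Fin n) G

/-- The unique diameter has exactly one end among `0, …, m - 1`; rotating this end to `0` gives the
bijection. -/
theorem card_halfTurn_trees (hnm : n = 2 * m) (hh : h.val = m) :
    Nat.card {G : SimpleGraph (Fin n) | IsGenusOneTree G ∧ rotate h G = G} =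
      m * Nat.card (SymmetricTrees h) := by
  have hrot : ∀ (r : Fin n) (G : SimpleGraph (Fin n)), rotate h G = G →
      rotate h (rotate r G) = rotate r G := fun r G hG => by
    rw [rotate_rotate, add_comm, ← rotate_rotate, hG]
  have hm : 0 < m := by
    have := h.isLt
    omega
  let ι : Fin m → Fin n := fun i => ⟨i.val, by omega⟩
  let e : Fin m × SymmetricTrees h → {G : SimpleGraph (Fin n) | IsGenusOneTree G ∧ rotate h G = G} :=
    fun p => ⟨rotate (-ι p.1) p.2.1, p.2.2.1.rotate _, hrot _ _ p.2.2.2.1⟩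
  have hadj : ∀ p, (e p).1.Adj (ι p.1) (ι p.1 + h) := by
    intro p
    change p.2.1.Adj (ι p.1 + -ι p.1) (ι p.1 + h + -ι p.1)
    rw [add_neg_cancel, add_neg_cancel_comm]
    exact p.2.2.2.2
  have he : Function.Bijective e := by
    constructor
    · rintro p q hpq
      have h1 := hadj p
      have h2 := hadj q
      rw [hpq] at h1
      have h3 : p.1 = q.1 := by
        rcases (e q).2.1.eq_of_diameters hnm hh (e q).2.2 h1 h2 with h3 | h3
        · exact Fin.ext (congrArg Fin.val h3).symm
        · have h4 := congrArg Fin.val h3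
          rw [Fin.val_add_eq_ite, hh] at h4
          have h5 : (ι p.1).val = p.1.val := rfl
          have h6 : (ι q.1).val = q.1.val := rfl
          have h7 := p.1.isLt
          have h8 := q.1.isLt
          split_ifs at h4 <;> omega
      refine Prod.ext h3 (Subtype.ext ?_)
      have h4 := congrArg (rotate (ι p.1)) (congrArg Subtype.val hpq)
      change rotate (ι p.1) (rotate (-ι p.1) p.2.1) = rotate (ι p.1) (rotate (-ι q.1) q.2.1) at h4
      rwa [h3, rotate_rotate, rotate_rotate, add_neg_cancel, rotate_zero, rotate_zero] at h4
    · rintro ⟨G, hG, hr⟩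
      have hne : h ≠ 0 := fun hc => by
        rw [hc, Fin.val_zero] at hh
        omega
      obtain ⟨s, hs, hs2, -, i, hi⟩ := exists_halfTurn hG.1 hne hr
      rw [eq_half hnm hh hs hs2] at hi
      have hi' : ∃ j : Fin m, G.Adj (ι j) (ι j + h) := by
        by_cases hc : i.val < m
        · exact ⟨⟨i.val, hc⟩, hi⟩
        · have h1 := i.isLt
          refine ⟨⟨i.val - m, by omega⟩, ?_⟩
          have h2 : i + h = ι ⟨i.val - m, by omega⟩ := by
            refine Fin.ext ?_
            have h3 : (ι ⟨i.val - m, by omega⟩).val = i.val - m := rfl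
            rw [Fin.val_add_eq_ite, h3, hh, if_pos (by omega)]
            omega
          rw [← h2, add_assoc, half_add_half hnm hh, add_zero]
          exact hi.symm
      obtain ⟨j, hj⟩ := hi'
      refine ⟨(j, ⟨rotate (ι j) G, hG.rotate _, hrot _ _ hr, ?_⟩), Subtype.ext ?_⟩
      · rw [rotate_adj, zero_add, add_comm h]
        exact hj
      · change rotate (-ι j) (rotate (ι j) G) = G
        rw [rotate_rotate, neg_add_cancel, rotate_zero]
  rw [← Nat.card_congr (Equiv.ofBijective e he), Nat.card_prod, Nat.card_fin]

/-- Trees without half-turn symmetry have trivial stabilizer, so their number is a multiple of `n`.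
-/
theorem exists_f_eq (hnm : n = 2 * m) (hh : h.val = m) :
    ∃ a, f n = n * a + m * Nat.card (SymmetricTrees h) := by
  have hm := h.isLt
  have h1 := card_dvd_card_of_free (Γ := Fin n)
    {G : SimpleGraph (Fin n) | IsGenusOneTree G ∧ rotate h G ≠ G}
    (fun r G hG => ⟨IsGenusOneTree.rotate hG.1 r, fun hc => hG.2 ?_⟩) fun r G hG hr => by
      by_contra hne
      obtain ⟨s, h1, h2, h3, -⟩ := exists_halfTurn hG.1.1 hne hr
      rw [eq_half hnm hh h1 h2] at h3
      exact hG.2 h3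
  · obtain ⟨a, ha⟩ := h1
    rw [Nat.card_fin] at ha
    refine ⟨a, ?_⟩
    rw [f_eq_card (by omega), ← card_halfTurn_trees hnm hh, ← ha, Nat.card_coe_set_eq,
      Nat.card_coe_set_eq, Nat.card_coe_set_eq, ← Set.ncard_union_eq]
    · congr 1
      ext G
      simp only [Set.mem_ofPred_eq, Set.mem_union, ← and_or_left]
      exact (and_iff_left (ne_or_eq _ _)).symm
    · rw [Set.disjoint_left]
      exact fun G h2 h3 => h2.2 h3.2
  · rw [vadd_eq_rotate] at hc
    have h2 := congrArg (rotate (-r)) hc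
    rwa [rotate_rotate, rotate_rotate, rotate_rotate, add_right_comm, neg_add_cancel, zero_add,
      rotate_zero] at h2

theorem reflect_reflect (G : SimpleGraph (Fin n)) : reflect (reflect G) = G := by
  ext a b
  rw [reflect_adj, reflect_adj, neg_neg, neg_neg]

theorem neg_half (hnm : n = 2 * m) (hh : h.val = m) : -h = h :=
  neg_eq_of_add_eq_zero_left (half_add_half hnm hh)

theorem odd_card_symmetricTrees (hnm : n = 2 * m) (hh : h.val = m) :
    Odd (Nat.card (SymmetricTrees h)) ↔
      Odd (Nat.card {G : SimpleGraph (Fin n) | G ∈ SymmetricTrees h ∧ reflect G = G}) := by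
  classical
  have h1 := odd_card_iff_of_involution (SymmetricTrees h).toFinset reflect (fun G hG => by
    rw [Set.mem_toFinset] at hG ⊢
    refine ⟨hG.1.reflect, ?_, ?_⟩
    · ext a b
      rw [rotate_adj, reflect_adj, reflect_adj, neg_add, neg_add, neg_half hnm hh, ← rotate_adj,
        hG.2.1]
    · rw [reflect_adj, neg_zero, neg_half hnm hh]
      exact hG.2.2) fun G _ => reflect_reflect G
  rw [Nat.card_coe_set_eq, Nat.card_coe_set_eq, Set.ncard_eq_toFinset_card', h1,
    Set.ncard_eq_toFinset_card']
  congr! 2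
  ext G
  simp

/-- The reflection `x ↦ m - x` would be an automorphism that flips the diameter from `0` to `m`, but
for even `m` it fixes the vertex `m / 2`. -/
theorem IsGenusOneTree.not_reflect_of_even (hnm : n = 2 * m) (hh : h.val = m) (hm : Even m)
    {G : SimpleGraph (Fin n)} (hG : G ∈ SymmetricTrees h) : reflect G ≠ G := by
  intro hr
  obtain ⟨k, hk⟩ := hm
  have hlt := h.isLt
  refine hG.1.1.ne_of_flip (τ := fun x => -x + h) (fun x y hxy => ?_) (fun u v huv => ?_) hG.2.2
    (by rw [neg_zero, zero_add]) (neg_add_cancel h) ⟨k, by omega⟩ (Fin.ext ?_)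
  · exact neg_injective (add_right_cancel hxy)
  · rw [← rotate_adj, hG.2.1, ← reflect_adj, hr]
    exact huv
  · simp only [Fin.val_add_eq_ite, Fin.val_neg, hh, Fin.ext_iff, Fin.val_zero]
    split_ifs <;> omega

end HalfTurn

/-! ### Folding the circle by the Klein four-group -/

/-- The four copies of the point `i` of the line `0, …, q` among the points `0, …, 4 q + 1` of the
circle. -/
def corner (q : ℕ) : Fin 4 → ℕ → ℕ
  | 0, i => i
  | 1, i => 2 * q + 1 - i
  | 2, i => 2 * q + 1 + i
  | 3, i => if i = 0 then 0 else 4 * q + 2 - i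

/-- The point of the line `0, …, q` that has a given point of the circle as a copy. -/
def fold (q w : ℕ) : ℕ :=
  if w ≤ q then w else if w ≤ 2 * q + 1 then 2 * q + 1 - w
    else if w ≤ 3 * q + 1 then w - (2 * q + 1) else 4 * q + 2 - w

/-- The half-turn of the circle. -/
def halfTurn (q w : ℕ) : ℕ := if w < 2 * q + 1 then w + (2 * q + 1) else w - (2 * q + 1)

/-- The reflection of the circle. -/
def flipOver (q w : ℕ) : ℕ := if w = 0 then 0 else 4 * q + 2 - w

section Geometry

variable {q : ℕ}

theorem fold_corner {i : ℕ} (hi : i ≤ q) (s : Fin 4) : fold q (corner q s i) = i := by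
  fin_cases s <;> simp only [corner] <;> simp only [fold] <;> (repeat' split) <;> omega

theorem corner_lt {i : ℕ} (hi : i ≤ q) (s : Fin 4) : corner q s i < 4 * q + 2 := by
  fin_cases s <;> simp only [corner] <;> (repeat' split) <;> omega

theorem exists_corner_eq {w : ℕ} (hw : w < 4 * q + 2) : ∃ s, corner q s (fold q w) = w := by
  by_cases h1 : w ≤ q
  · exact ⟨0, by simp only [corner, fold]; split_ifs; rfl⟩
  by_cases h2 : w ≤ 2 * q + 1
  · exact ⟨1, by simp only [corner, fold]; split_ifs; omega⟩
  by_cases h3 : w ≤ 3 * q + 1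
  · exact ⟨2, by simp only [corner, fold]; split_ifs; omega⟩
  · exact ⟨3, by simp only [corner, fold]; (repeat' split) <;> omega⟩

theorem fold_le {w : ℕ} (hw : w < 4 * q + 2) : fold q w ≤ q := by
  simp only [fold]
  (repeat' split) <;> omega

theorem corner_injective {i : ℕ} (h1 : 1 ≤ i) (hi : i ≤ q) {s t : Fin 4}
    (h : corner q s i = corner q t i) : s = t := by
  fin_cases s <;> fin_cases t <;> simp only [corner] at h <;>
    first | rfl | (exfalso; split_ifs at h <;> omega) | (exfalso; omega)

theorem corner_opposite_ne {i : ℕ} (hi : i ≤ q) (s : Fin 4) :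
    corner q s i ≠ corner q (s + 2) i := by
  intro h
  fin_cases s <;> simp only [corner, Fin.reduceFinMk, Fin.reduceAdd, Fin.zero_eta, Fin.mk_one] at h <;>
    first | omega | (split_ifs at h <;> omega)

theorem halfTurn_corner {i : ℕ} (hi : i ≤ q) (s : Fin 4) :
    halfTurn q (corner q s i) = corner q (s + 2) i := by
  fin_cases s <;>
    simp only [corner, Fin.reduceFinMk, Fin.reduceAdd, Fin.zero_eta, Fin.mk_one] <;>
    simp only [halfTurn] <;>
    (repeat' split) <;> omega

theorem flipOver_corner {i : ℕ} (hi : i ≤ q) (s : Fin 4) :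
    flipOver q (corner q s i) = corner q (3 - s) i := by
  fin_cases s <;>
    simp only [corner, Fin.reduceFinMk, Fin.reduceSub, Fin.zero_eta, Fin.mk_one] <;>
    simp only [flipOver] <;>
    (repeat' split) <;> omega

theorem halfTurn_halfTurn {w : ℕ} (hw : w < 4 * q + 2) : halfTurn q (halfTurn q w) = w := by
  simp only [halfTurn]
  (repeat' split) <;> omega

theorem flipOver_flipOver {w : ℕ} (hw : w < 4 * q + 2) : flipOver q (flipOver q w) = w := by
  simp only [flipOver]
  (repeat' split) <;> omega

/-- The crossing of chords in terms of the numbers of their ends. -/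
def ChordsCross (a b c d : ℕ) : Prop :=
  (c ≠ a ∧ c ≠ b ∧ d ≠ a ∧ d ≠ b) ∧ (StrictlyBetween a b c ↔ ¬ StrictlyBetween a b d)

theorem ChordsCross.swap_left (a b c d : ℕ) : ChordsCross b a c d ↔ ChordsCross a b c d := by
  unfold ChordsCross StrictlyBetween
  omega

theorem ChordsCross.swap_right (a b c d : ℕ) : ChordsCross a b d c ↔ ChordsCross a b c d := by
  unfold ChordsCross StrictlyBetween
  omega

theorem ChordsCross.comm {a b c d : ℕ} (_hab : a ≠ b) (_hcd : c ≠ d) :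
    ChordsCross a b c d ↔ ChordsCross c d a b := by
  unfold ChordsCross StrictlyBetween
  omega

theorem not_chordsCross_straight_straight {i j k l : ℕ} (hij : i < j) (hj : j ≤ q) (hkl : k < l)
    (hl : l ≤ q) (h1 : ¬ (i < k ∧ k < j ∧ j < l)) (h2 : ¬ (k < i ∧ i < l ∧ l < j)) (s t : Fin 4) :
    ¬ ChordsCross (corner q s i) (corner q s j) (corner q t k) (corner q t l) := by
  unfold ChordsCross StrictlyBetween
  fin_cases s <;> fin_cases t <;> simp only [corner] <;> (repeat' split) <;> omega

theorem not_chordsCross_straight_diameter {i j : ℕ} (hij : i < j) (hj : j ≤ q) (s : Fin 4) :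
    ¬ ChordsCross (corner q s i) (corner q s j) 0 (2 * q + 1) := by
  unfold ChordsCross StrictlyBetween
  fin_cases s <;> simp only [corner] <;> (repeat' split) <;> omega

theorem not_chordsCross_straight_twisted {i j k l : ℕ} (hij : i < j) (hj : j ≤ q) (hk : 1 ≤ k)
    (hkl : k < l) (hl : l ≤ q) (h1 : ¬ (i < k ∧ k < j)) (h2 : ¬ (i < l ∧ l < j)) (s t : Fin 4) :
    ¬ ChordsCross (corner q s i) (corner q s j) (corner q t k) (corner q (t + 2) l) := by
  unfold ChordsCross StrictlyBetween
  fin_cases s <;> fin_cases t <;>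
    simp only [corner, Fin.reduceFinMk, Fin.reduceAdd, Fin.zero_eta, Fin.mk_one] <;>
    (repeat' split) <;> omega

theorem chordsCross_diameter_twisted {k l : ℕ} (hk : 1 ≤ k) (hkl : k < l) (hl : l ≤ q)
    (t : Fin 4) : ChordsCross 0 (2 * q + 1) (corner q t k) (corner q (t + 2) l) := by
  unfold ChordsCross StrictlyBetween
  fin_cases t <;>
    simp only [corner, Fin.reduceFinMk, Fin.reduceAdd, Fin.zero_eta, Fin.mk_one] <;>
    (repeat' split) <;> omega

/-- The two families of twisted edges. -/
def side (s : Fin 4) : Bool := s = 1 ∨ s = 3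

/-- Nestedness keeps the twisted arcs of one side from crossing each other; the reflection exchanges
the two sides, whose arcs always cross. -/
theorem chordsCross_twisted_twisted {i j k l : ℕ} (hi : 1 ≤ i) (hij : i < j) (hj : j ≤ q)
    (hk : 1 ≤ k) (hkl : k < l) (hl : l ≤ q) (h : (i ≤ k ∧ l ≤ j) ∨ (k ≤ i ∧ j ≤ l)) (s t : Fin 4) :
    ChordsCross (corner q s i) (corner q (s + 2) j) (corner q t k) (corner q (t + 2) l) ↔
      side s ≠ side t := by
  unfold ChordsCross StrictlyBetween
  fin_cases s <;> fin_cases t <;>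
    simp only [corner, Fin.reduceFinMk, Fin.reduceAdd, Fin.zero_eta, Fin.mk_one] <;>
    first
      | (refine iff_of_true ?_ (by decide); (repeat' split) <;> omega)
      | (refine iff_of_false ?_ (by decide); (repeat' split) <;> omega)

end Geometry

/-! ### Lifting arcs from the line to the circle -/

/-- The arcs of the lift to the circle of a family `S` of straight and a family `B` of twisted arcs
on the line `0, …, q`. Arcs of the same class do not cross. -/
inductive LiftArc (q : ℕ) (S B : Finset (ℕ × ℕ)) : Fin 4 → ℕ → ℕ → Prop
  | straight (s : Fin 4) (i j : ℕ) (h : (i, j) ∈ S) :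
      LiftArc q S B 0 (corner q s i) (corner q s j)
  | diameter : LiftArc q S B 1 0 (2 * q + 1)
  | twisted (s : Fin 4) (i j : ℕ) (h : (i, j) ∈ B) :
      LiftArc q S B (if side s then 3 else 2) (corner q s i) (corner q (s + 2) j)

/-- The families of straight and twisted arcs that have a lift of genus at most one. -/
structure Liftable (q : ℕ) (S B : Finset (ℕ × ℕ)) : Prop where
  straight_bounds : ∀ i j, (i, j) ∈ S → i < j ∧ j ≤ q
  noncrossing : ∀ i j k l, (i, j) ∈ S → (k, l) ∈ S → i < k → k < j → j < l → False
  twisted_bounds : ∀ i j, (i, j) ∈ B → 1 ≤ i ∧ i < j ∧ j ≤ q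
  nested : ∀ i j k l, (i, j) ∈ B → (k, l) ∈ B → (i ≤ k ∧ l ≤ j) ∨ (k ≤ i ∧ j ≤ l)
  uncovered : ∀ i j k l, (i, j) ∈ S → (k, l) ∈ B → ¬ (i < k ∧ k < j) ∧ ¬ (i < l ∧ l < j)

/-- The lift to the circle of a family `S` of straight and a family `B` of twisted arcs. -/
def lift (q : ℕ) (S B : Finset (ℕ × ℕ)) : SimpleGraph (Fin (4 * q + 2)) :=
  SimpleGraph.fromRel fun u v => ∃ c, LiftArc q S B c u v

/-- The lifted arcs as pairs of points. -/
def liftArcs (q : ℕ) (S B : Finset (ℕ × ℕ)) : Finset (ℕ × ℕ) :=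
  insert (0, 2 * q + 1)
    ((S ×ˢ Finset.univ).image (fun p : (ℕ × ℕ) × Fin 4 => (corner q p.2 p.1.1, corner q p.2 p.1.2)) ∪
      (B ×ˢ Finset.univ).image
        (fun p : (ℕ × ℕ) × Fin 4 => (corner q p.2 p.1.1, corner q (p.2 + 2) p.1.2)))

section Lift

variable {q : ℕ} {S B : Finset (ℕ × ℕ)}

theorem mem_liftArcs {u v : ℕ} : (u, v) ∈ liftArcs q S B ↔ ∃ c, LiftArc q S B c u v := by
  simp only [liftArcs, Finset.mem_insert, Finset.mem_union, Finset.mem_image, Finset.mem_product,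
    Finset.mem_univ, and_true, Prod.exists, Prod.mk.injEq]
  constructor
  · rintro (⟨rfl, rfl⟩ | ⟨i, j, s, h, rfl, rfl⟩ | ⟨i, j, s, h, rfl, rfl⟩)
    · exact ⟨1, .diameter⟩
    · exact ⟨0, .straight s i j h⟩
    · exact ⟨_, .twisted s i j h⟩
  · rintro ⟨c, h⟩
    cases h with
    | straight s i j h => exact .inr (.inl ⟨i, j, s, h, rfl, rfl⟩)
    | diameter => exact .inl ⟨rfl, rfl⟩
    | twisted s i j h => exact .inr (.inr ⟨i, j, s, h, rfl, rfl⟩)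

theorem side_add_two (s : Fin 4) : side (s + 2) = side s := by
  revert s; decide

theorem add_two_add_two (s : Fin 4) : s + 2 + 2 = s := by
  revert s; decide

theorem three_sub_add_two (s : Fin 4) : 3 - (s + 2) = 3 - s + 2 := by
  revert s; decide

namespace Liftable

theorem lt {c : Fin 4} {u v : ℕ} (hL : Liftable q S B) (h : LiftArc q S B c u v) :
    u < 4 * q + 2 ∧ v < 4 * q + 2 := by
  cases h with
  | straight s i j h =>
    have := hL.straight_bounds i j h
    exact ⟨corner_lt (by omega) s, corner_lt (by omega) s⟩
  | diameter => omega
  | twisted s i j h =>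
    have := hL.twisted_bounds i j h
    exact ⟨corner_lt (by omega) _, corner_lt (by omega) _⟩

theorem fold_lt (hL : Liftable q S B) {c : Fin 4} {u v : ℕ} (h : LiftArc q S B c u v) :
    fold q u < fold q v ∨ (u = 0 ∧ v = 2 * q + 1) := by
  cases h with
  | straight s i j h =>
    have := hL.straight_bounds i j h
    rw [fold_corner (by omega), fold_corner (by omega)]
    omega
  | diameter => omega
  | twisted s i j h =>
    have := hL.twisted_bounds i j h
    rw [fold_corner (by omega), fold_corner (by omega)]
    omega

theorem fold_zero_diameter : fold q 0 = 0 ∧ fold q (2 * q + 1) = 0 := by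
  simp only [fold]
  constructor <;> (repeat' split) <;> omega

theorem ne (hL : Liftable q S B) {c : Fin 4} {u v : ℕ} (h : LiftArc q S B c u v) : u ≠ v := by
  rintro rfl
  have := hL.fold_lt h
  omega

theorem asymm (hL : Liftable q S B) {c d : Fin 4} {u v : ℕ} (h : LiftArc q S B c u v)
    (h' : LiftArc q S B d v u) : False := by
  have h1 := hL.fold_lt h
  have h2 := hL.fold_lt h'
  have h3 := fold_zero_diameter (q := q)
  rcases h1 with h1 | ⟨rfl, rfl⟩
  · rcases h2 with h2 | ⟨rfl, rfl⟩ <;> omega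
  · omega

theorem adj_iff (hL : Liftable q S B) (u v : Fin (4 * q + 2)) :
    (lift q S B).Adj u v ↔ ∃ c, LiftArc q S B c u v ∨ LiftArc q S B c v u := by
  rw [lift, SimpleGraph.fromRel_adj]
  constructor
  · rintro ⟨-, ⟨c, h⟩ | ⟨c, h⟩⟩
    exacts [⟨c, .inl h⟩, ⟨c, .inr h⟩]
  · rintro ⟨c, h | h⟩
    · exact ⟨fun e => hL.ne h (congrArg Fin.val e), .inl ⟨c, h⟩⟩
    · exact ⟨fun e => hL.ne h (congrArg Fin.val e).symm, .inr ⟨c, h⟩⟩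

/-- Four copies of each arc and the diameter. The copies are told apart by the right end of a
straight arc, as its left end may be `0`, which has only two copies, and by the left end of a
twisted arc, which is at least `1`. -/
theorem card_liftArcs (hL : Liftable q S B) :
    (liftArcs q S B).card = 4 * (S.card + B.card) + 1 := by
  rw [liftArcs, Finset.card_insert_of_notMem, Finset.card_union_of_disjoint,
    Finset.card_image_of_injOn, Finset.card_image_of_injOn, Finset.card_product,
    Finset.card_product]
  · simp only [Finset.card_univ, Fintype.card_fin]
    ring
  · rintro ⟨⟨i, j⟩, s⟩ h ⟨⟨k, l⟩, t⟩ h' e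
    simp only [Finset.coe_product, Finset.coe_univ, Set.mem_prod, Finset.mem_coe, Set.mem_univ,
      and_true, Prod.mk.injEq] at h h' e ⊢
    have h1 := hL.twisted_bounds _ _ h
    have h2 := hL.twisted_bounds _ _ h'
    have e1 := congrArg (fold q) e.1
    have e2 := congrArg (fold q) e.2
    rw [fold_corner (by omega), fold_corner (by omega)] at e1 e2
    subst e1 e2
    exact ⟨⟨rfl, rfl⟩, corner_injective h1.1 (by omega) e.1⟩
  · rintro ⟨⟨i, j⟩, s⟩ h ⟨⟨k, l⟩, t⟩ h' e
    simp only [Finset.coe_product, Finset.coe_univ, Set.mem_prod, Finset.mem_coe, Set.mem_univ,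
      and_true, Prod.mk.injEq] at h h' e ⊢
    have h1 := hL.straight_bounds _ _ h
    have h2 := hL.straight_bounds _ _ h'
    have e1 := congrArg (fold q) e.1
    have e2 := congrArg (fold q) e.2
    rw [fold_corner (by omega), fold_corner (by omega)] at e1 e2
    subst e1 e2
    exact ⟨⟨rfl, rfl⟩, corner_injective (by omega) h1.2 e.2⟩
  · rw [Finset.disjoint_left]
    rintro ⟨u, v⟩ h h'
    simp only [Finset.mem_image, Finset.mem_product, Finset.mem_univ, and_true, Prod.exists,
      Prod.mk.injEq] at h h'
    obtain ⟨i, j, s, h, rfl, rfl⟩ := h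
    obtain ⟨k, l, t, h', e⟩ := h'
    have h1 := hL.straight_bounds _ _ h
    have h2 := hL.twisted_bounds _ _ h'
    have e1 := congrArg (fold q) e.1
    have e2 := congrArg (fold q) e.2
    rw [fold_corner (by omega), fold_corner (by omega)] at e1 e2
    subst e1 e2
    have := corner_injective h2.1 (by omega) e.1
    subst this
    exact corner_opposite_ne h1.2 t e.2.symm
  · intro h
    simp only [Finset.mem_union, Finset.mem_image, Finset.mem_product, Finset.mem_univ, and_true,
      Prod.exists, Prod.mk.injEq] at h
    have h3 := fold_zero_diameter (q := q)
    rcases h with ⟨i, j, s, h, e⟩ | ⟨i, j, s, h, e⟩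
    · have h1 := hL.straight_bounds _ _ h
      have e2 := congrArg (fold q) e.2
      rw [fold_corner (by omega)] at e2
      omega
    · have h1 := hL.twisted_bounds _ _ h
      have e2 := congrArg (fold q) e.2
      rw [fold_corner (by omega)] at e2
      omega

theorem card_edgeSet (hL : Liftable q S B) :
    Nat.card (lift q S B).edgeSet = 4 * (S.card + B.card) + 1 := by
  rw [← hL.card_liftArcs, Nat.card_coe_set_eq,
    ← Set.ncard_image_of_injective _ (Sym2.map.injective Fin.val_injective)]
  have : Sym2.map Fin.val '' (lift q S B).edgeSet =
      ((liftArcs q S B).image (fun p => s(p.1, p.2)) : Finset (Sym2 ℕ)) := by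
    ext e
    simp only [Set.mem_image, Finset.coe_image, Finset.mem_coe, Prod.exists, mem_liftArcs]
    constructor
    · rintro ⟨e, he, rfl⟩
      induction e with
      | _ u v =>
        rw [SimpleGraph.mem_edgeSet, hL.adj_iff] at he
        obtain ⟨c, h | h⟩ := he
        · exact ⟨u, v, ⟨c, h⟩, rfl⟩
        · exact ⟨v, u, ⟨c, h⟩, Sym2.eq_swap⟩
    · rintro ⟨u, v, ⟨c, h⟩, rfl⟩
      have := hL.lt h
      exact ⟨s(⟨u, this.1⟩, ⟨v, this.2⟩), (hL.adj_iff _ _).2 ⟨c, .inl h⟩, rfl⟩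
  rw [this, Set.ncard_coe_finset, Finset.card_image_of_injOn]
  rintro ⟨u, v⟩ h ⟨u', v'⟩ h' e
  rw [Finset.mem_coe, mem_liftArcs] at h h'
  obtain ⟨c, h⟩ := h
  obtain ⟨d, h'⟩ := h'
  rcases Sym2.eq_iff.1 e with ⟨rfl, rfl⟩ | ⟨rfl, rfl⟩
  · rfl
  · exact (hL.asymm h h').elim

/-- Folding projects paths to the line. Conversely, an arc lifts from each copy of its ends, and the
diameter links the two copies of `0`, so reachability of all copies propagates along the line. -/
theorem connected_iff (hL : Liftable q S B) :
    (lift q S B).Connected ↔ ∀ v ≤ q, Joined (S ∪ B) 0 v := by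
  constructor
  · intro h v hv
    have key : ∀ u w : Fin (4 * q + 2), (lift q S B).Reachable u w →
        Joined (S ∪ B) (fold q u) (fold q w) := by
      rintro u w ⟨p⟩
      induction p with
      | nil => exact .refl _
      | cons hadj _ ih =>
        refine .trans ?_ ih
        have key : ∀ (c : Fin 4) (a b : ℕ), LiftArc q S B c a b →
            Joined (S ∪ B) (fold q a) (fold q b) := by
          rintro c a b (⟨s, i, j, h⟩ | _ | ⟨s, i, j, h⟩)
          · have := hL.straight_bounds _ _ h
            rw [fold_corner (by omega), fold_corner (by omega)]
            exact .of_mem (Finset.mem_union_left _ h)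
          · rw [fold_zero_diameter.1, fold_zero_diameter.2]
            exact .refl _
          · have := hL.twisted_bounds _ _ h
            rw [fold_corner (by omega), fold_corner (by omega)]
            exact .of_mem (Finset.mem_union_right _ h)
        obtain ⟨c, h | h⟩ := (hL.adj_iff _ _).1 hadj
        · exact key _ _ _ h
        · exact (key _ _ _ h).symm
    have := key 0 ⟨v, by omega⟩ (h.preconnected _ _)
    rwa [Fin.val_zero, fold_zero_diameter.1, show fold q v = v from if_pos hv] at this
  · intro h
    let P : ℕ → Prop := fun i => ∀ s : Fin 4, ∀ w : Fin (4 * q + 2), w.val = corner q s i →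
      (lift q S B).Reachable 0 w
    have adj : ∀ {c : Fin 4} {a b : ℕ} (hc : LiftArc q S B c a b),
        (lift q S B).Adj ⟨a, (hL.lt hc).1⟩ ⟨b, (hL.lt hc).2⟩ := fun hc =>
      (hL.adj_iff _ _).2 ⟨_, .inl hc⟩
    have step : ∀ i j, (i, j) ∈ S ∪ B → (P i ↔ P j) := by
      intro i j hij
      rcases Finset.mem_union.1 hij with hij | hij
      · constructor
        · rintro hP s ⟨w, hw⟩ rfl
          exact (hP s _ rfl).trans (adj (.straight s i j hij)).reachable
        · rintro hP s ⟨w, hw⟩ rfl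
          exact (hP s _ rfl).trans (adj (.straight s i j hij)).symm.reachable
      · constructor
        · rintro hP s ⟨w, hw⟩ e
          have hs := adj (.twisted (s + 2) i j hij)
          obtain rfl : w = corner q (s + 2 + 2) j := by rw [add_two_add_two]; exact e
          exact (hP (s + 2) _ rfl).trans hs.reachable
        · rintro hP s ⟨w, hw⟩ rfl
          exact (hP (s + 2) _ rfl).trans (adj (.twisted s i j hij)).symm.reachable
    have joined : ∀ i j, Joined (S ∪ B) i j → (P i ↔ P j) := by
      intro i j hij
      induction hij with
      | rel _ _ h => exact step _ _ h
      | refl _ => exact Iff.rfl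
      | symm _ _ _ ih => exact ih.symm
      | trans _ _ _ _ _ ih1 ih2 => exact ih1.trans ih2
    have zero : P 0 := by
      have hd : (lift q S B).Reachable 0 ⟨2 * q + 1, by omega⟩ :=
        (adj (.diameter : LiftArc q S B 1 0 (2 * q + 1))).reachable
      rintro s ⟨w, hw⟩ e
      have : w = 0 ∨ w = 2 * q + 1 := by
        revert e
        fin_cases s <;> simp [corner] <;> omega
      rcases this with rfl | rfl
      · exact .refl _
      · exact hd
    have reach : ∀ w : Fin (4 * q + 2), (lift q S B).Reachable 0 w := by
      intro w
      obtain ⟨s, hs⟩ := exists_corner_eq w.isLt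
      exact (joined _ _ (h _ (fold_le w.isLt))).1 zero s w hs.symm
    exact (SimpleGraph.connected_iff_exists_forall_reachable _).2 ⟨0, reach⟩

theorem isTree_iff (hL : Liftable q S B) :
    (lift q S B).IsTree ↔ (∀ v ≤ q, Joined (S ∪ B) 0 v) ∧ S.card + B.card = q := by
  rw [SimpleGraph.isTree_iff_connected_and_card, hL.connected_iff, hL.card_edgeSet,
    Nat.card_eq_fintype_card, Fintype.card_fin]
  refine and_congr_right fun _ => ?_
  omega

/-- The crossing graph of a lift is complete multipartite: its parts are the diameter and the two
sides of twisted arcs (classes 1, 2, 3), and straight arcs (class 0) are isolated. -/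
theorem chordsCross_iff (hL : Liftable q S B) {c d : Fin 4} {a b u v : ℕ}
    (h : LiftArc q S B c a b) (h' : LiftArc q S B d u v) :
    ChordsCross a b u v ↔ c ≠ 0 ∧ d ≠ 0 ∧ c ≠ d := by
  cases h with
  | straight s i j h =>
    have hij := hL.straight_bounds _ _ h
    refine iff_of_false ?_ (by simp)
    cases h' with
    | straight t k l h' =>
      have hkl := hL.straight_bounds _ _ h'
      exact not_chordsCross_straight_straight hij.1 hij.2 hkl.1 hkl.2
        (fun e => hL.noncrossing _ _ _ _ h h' e.1 e.2.1 e.2.2)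
        (fun e => hL.noncrossing _ _ _ _ h' h e.1 e.2.1 e.2.2) s t
    | diameter => exact not_chordsCross_straight_diameter hij.1 hij.2 s
    | twisted t k l h' =>
      have hkl := hL.twisted_bounds _ _ h'
      have hu := hL.uncovered _ _ _ _ h h'
      exact not_chordsCross_straight_twisted hij.1 hij.2 hkl.1 hkl.2.1 hkl.2.2 hu.1 hu.2 s t
  | diameter =>
    cases h' with
    | straight t k l h' =>
      have hkl := hL.straight_bounds _ _ h'
      refine iff_of_false (fun e => ?_) (by simp)
      exact not_chordsCross_straight_diameter hkl.1 hkl.2 t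
        ((ChordsCross.comm (hL.ne (.straight t k l h' : LiftArc q S B 0 _ _)) (by omega)).2 e)
    | diameter => exact iff_of_false (fun e => e.1.1 rfl) (by simp)
    | twisted t k l h' =>
      have hkl := hL.twisted_bounds _ _ h'
      refine iff_of_true (chordsCross_diameter_twisted hkl.1 hkl.2.1 hkl.2.2 t) ?_
      revert t; decide
  | twisted s i j h =>
    have hij := hL.twisted_bounds _ _ h
    cases h' with
    | straight t k l h' =>
      have hkl := hL.straight_bounds _ _ h'
      have hu := hL.uncovered _ _ _ _ h' h
      refine iff_of_false (fun e => ?_) (by simp)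
      exact not_chordsCross_straight_twisted hkl.1 hkl.2 hij.1 hij.2.1 hij.2.2 hu.1 hu.2 t s
        ((ChordsCross.comm (hL.ne (.straight t k l h' : LiftArc q S B 0 _ _))
          (hL.ne (.twisted s i j h))).2 e)
    | diameter =>
      refine iff_of_true ((ChordsCross.comm (by omega) (hL.ne (.twisted s i j h))).1
        (chordsCross_diameter_twisted hij.1 hij.2.1 hij.2.2 s)) ?_
      revert s; decide
    | twisted t k l h' =>
      have hkl := hL.twisted_bounds _ _ h'
      rw [chordsCross_twisted_twisted hij.1 hij.2.1 hij.2.2 hkl.1 hkl.2.1 hkl.2.2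
        (hL.nested _ _ _ _ h h') s t]
      revert s t; decide

end Liftable

theorem LiftArc.exists_halfTurn {c : Fin 4} {u v : ℕ} (hL : Liftable q S B)
    (h : LiftArc q S B c u v) :
    LiftArc q S B c (halfTurn q u) (halfTurn q v) ∨ LiftArc q S B c (halfTurn q v) (halfTurn q u) := by
  cases h with
  | straight s i j h =>
    have := hL.straight_bounds _ _ h
    rw [halfTurn_corner (by omega), halfTurn_corner (by omega)]
    exact .inl (.straight _ _ _ h)
  | diameter =>
    have h1 : halfTurn q 0 = 2 * q + 1 := by simp [halfTurn]
    have h2 : halfTurn q (2 * q + 1) = 0 := by simp [halfTurn]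
    rw [h1, h2]
    exact .inr .diameter
  | twisted s i j h =>
    have := hL.twisted_bounds _ _ h
    rw [halfTurn_corner (by omega), halfTurn_corner (by omega), ← side_add_two s]
    exact .inl (.twisted _ _ _ h)

theorem LiftArc.exists_flipOver {c : Fin 4} {u v : ℕ} (hL : Liftable q S B)
    (h : LiftArc q S B c u v) : ∃ d, LiftArc q S B d (flipOver q u) (flipOver q v) := by
  cases h with
  | straight s i j h =>
    have := hL.straight_bounds _ _ h
    rw [flipOver_corner (by omega), flipOver_corner (by omega)]
    exact ⟨_, .straight _ _ _ h⟩
  | diameter =>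
    have h1 : flipOver q 0 = 0 := by simp [flipOver]
    have h2 : flipOver q (2 * q + 1) = 2 * q + 1 := by simp [flipOver]; omega
    rw [h1, h2]
    exact ⟨_, .diameter⟩
  | twisted s i j h =>
    have := hL.twisted_bounds _ _ h
    rw [flipOver_corner (by omega), flipOver_corner (by omega), three_sub_add_two]
    exact ⟨_, .twisted _ _ _ h⟩

theorem val_add_half {h : Fin (4 * q + 2)} (hh : h.val = 2 * q + 1) (u : Fin (4 * q + 2)) :
    (u + h).val = halfTurn q u := by
  rw [Fin.val_add_eq_ite, hh, halfTurn]
  have := u.isLt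
  (repeat' split) <;> omega

theorem val_neg_eq_flipOver (u : Fin (4 * q + 2)) : (-u).val = flipOver q u := by
  rw [← zero_sub, Fin.val_sub_eq_ite, flipOver, Fin.val_zero]
  have := u.isLt
  (repeat' split) <;> omega

namespace Liftable

theorem crossing_iff (hL : Liftable q S B) {a b : Fin (4 * q + 2)} (h : (lift q S B).Adj a b) :
    ∃ c : Fin 4, (LiftArc q S B c a b ∨ LiftArc q S B c b a) ∧
      ∀ (d : Fin 4) (u v : Fin (4 * q + 2)), (LiftArc q S B d u v ∨ LiftArc q S B d v u) →
        (Crossing a b u v ↔ c ≠ 0 ∧ d ≠ 0 ∧ c ≠ d) := by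
  obtain ⟨c, h⟩ := (hL.adj_iff a b).1 h
  refine ⟨c, h, fun d u v h' => ?_⟩
  change ChordsCross a b u v ↔ _
  rcases h with h | h <;> rcases h' with h' | h'
  · exact hL.chordsCross_iff h h'
  · rw [← ChordsCross.swap_right]
    exact hL.chordsCross_iff h h'
  · rw [← ChordsCross.swap_left]
    exact hL.chordsCross_iff h h'
  · rw [← ChordsCross.swap_left, ← ChordsCross.swap_right]
    exact hL.chordsCross_iff h h'

/-- Without twisted arcs only the classes 0 and 1 occur and nothing crosses. Otherwise the condition
depends on the four classes alone and is checked on all of them. -/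
theorem hasOneHandle_iff (hL : Liftable q S B) : HasOneHandle (lift q S B) ↔ B.Nonempty := by
  constructor
  · rintro ⟨⟨a, b, c, d, hab, hcd, hX⟩, -⟩
    obtain ⟨x, hx', hx⟩ := hL.crossing_iff hab
    obtain ⟨y, hy⟩ := (hL.adj_iff c d).1 hcd
    have hxy := (hx y c d hy).1 hX
    rw [Finset.nonempty_iff_ne_empty]
    rintro rfl
    have key : ∀ (z : Fin 4) (u v : ℕ), LiftArc q S ∅ z u v → z = 0 ∨ z = 1 := by
      rintro z u v (⟨s, i, j, h⟩ | _ | ⟨s, i, j, h⟩)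
      · exact .inl rfl
      · exact .inr rfl
      · simp at h
    have h1 : x = 0 ∨ x = 1 := by
      rcases hx' with hx' | hx' <;> exact key _ _ _ hx'
    have h2 : y = 0 ∨ y = 1 := by
      rcases hy with hy | hy <;> exact key _ _ _ hy
    omega
  · rintro ⟨⟨k, l⟩, hkl⟩
    have hb := hL.twisted_bounds _ _ hkl
    refine ⟨⟨⟨0, by omega⟩, ⟨2 * q + 1, by omega⟩, ⟨corner q 0 k, corner_lt (by omega) _⟩,
      ⟨corner q (0 + 2) l, corner_lt (by omega) _⟩, (hL.adj_iff _ _).2 ⟨_, .inl .diameter⟩,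
      (hL.adj_iff _ _).2 ⟨_, .inl (.twisted 0 k l hkl)⟩,
      chordsCross_diameter_twisted hb.1 hb.2.1 hb.2.2 0⟩, ?_⟩
    intro a b c d u v w x hab hcd huv hwx
    obtain ⟨α, hα', hα⟩ := hL.crossing_iff hab
    obtain ⟨β, hβ', hβ⟩ := hL.crossing_iff hcd
    obtain ⟨γ, hγ', hγ⟩ := hL.crossing_iff huv
    obtain ⟨δ, hδ', hδ⟩ := hL.crossing_iff hwx
    rw [hα _ _ _ hβ', hγ _ _ _ hδ', hγ _ _ _ hα', hδ _ _ _ hβ', hγ _ _ _ hβ', hδ _ _ _ hα']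
    clear hα hβ hγ hδ hα' hβ' hγ' hδ'
    revert α β γ δ
    decide

theorem rotate_lift (hL : Liftable q S B) {h : Fin (4 * q + 2)} (hh : h.val = 2 * q + 1) :
    rotate h (lift q S B) = lift q S B := by
  have key : ∀ u v, (lift q S B).Adj u v → (lift q S B).Adj (u + h) (v + h) := by
    intro u v huv
    rw [hL.adj_iff, val_add_half hh, val_add_half hh]
    obtain ⟨c, hc | hc⟩ := (hL.adj_iff u v).1 huv
    · exact ⟨c, hc.exists_halfTurn hL⟩
    · exact ⟨c, (hc.exists_halfTurn hL).symm⟩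
  ext u v
  rw [rotate_adj]
  refine ⟨fun huv => ?_, key u v⟩
  have h0 : h + h = 0 := half_add_half (by ring : 4 * q + 2 = 2 * (2 * q + 1)) hh
  have := key _ _ huv
  rwa [add_assoc, add_assoc, h0, add_zero, add_zero] at this

theorem reflect_lift (hL : Liftable q S B) : reflect (lift q S B) = lift q S B := by
  have key : ∀ u v, (lift q S B).Adj u v → (lift q S B).Adj (-u) (-v) := by
    intro u v huv
    rw [hL.adj_iff, val_neg_eq_flipOver, val_neg_eq_flipOver]
    obtain ⟨c, hc | hc⟩ := (hL.adj_iff u v).1 huv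
    · obtain ⟨d, hd⟩ := hc.exists_flipOver hL
      exact ⟨d, .inl hd⟩
    · obtain ⟨d, hd⟩ := hc.exists_flipOver hL
      exact ⟨d, .inr hd⟩
  ext u v
  rw [reflect_adj]
  refine ⟨fun huv => ?_, key u v⟩
  have := key _ _ huv
  rwa [neg_neg, neg_neg] at this

/-- This and `lift_adj_twisted` recover `S` and `B` from the lift, which makes lifting injective. -/
theorem lift_adj_straight (hL : Liftable q S B) {i j : ℕ} (hij : i < j) (hj : j ≤ q) :
    (lift q S B).Adj ⟨i, by omega⟩ ⟨j, by omega⟩ ↔ (i, j) ∈ S := by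
  rw [hL.adj_iff]
  refine ⟨?_, fun h => ⟨0, .inl (.straight 0 i j h)⟩⟩
  have key : ∀ (c : Fin 4) (u v : ℕ), u ≤ q → v ≤ q → LiftArc q S B c u v → (u, v) ∈ S := by
    intro c u v hu hv h
    cases h with
    | straight s k l h =>
      have hb := hL.straight_bounds _ _ h
      have e1 := fold_corner (q := q) (i := k) (by omega) s
      have e2 := fold_corner (q := q) (i := l) (by omega) s
      rw [fold, if_pos hu] at e1
      rw [fold, if_pos hv] at e2
      rwa [e1, e2]
    | diameter => omega
    | twisted s k l h =>
      exfalso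
      have hb := hL.twisted_bounds _ _ h
      have e1 := fold_corner (q := q) (i := k) (by omega) s
      have e2 := fold_corner (q := q) (i := l) (by omega) (s + 2)
      rw [fold, if_pos hu] at e1
      rw [fold, if_pos hv] at e2
      have f1 := corner_injective (q := q) (t := 0) hb.1 (by omega) e1
      have f2 := corner_injective (q := q) (t := 0) (by omega) hb.2.2 e2
      rw [f1] at f2
      exact absurd f2 (by decide)
  rintro ⟨c, h | h⟩
  · exact key c i j (by omega) hj h
  · have := hL.straight_bounds _ _ (key c j i hj (by omega) h)
    omega

theorem lift_adj_twisted (hL : Liftable q S B) {i j : ℕ} (hij : i < j) (hj : j ≤ q) :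
    (lift q S B).Adj ⟨i, by omega⟩ ⟨2 * q + 1 + j, by omega⟩ ↔ (i, j) ∈ B := by
  rw [hL.adj_iff]
  refine ⟨?_, fun h => ⟨_, .inl (.twisted 0 i j h)⟩⟩
  rintro ⟨c, h⟩
  obtain ⟨u, hu⟩ : ∃ u, u = corner q 0 i := ⟨_, rfl⟩
  obtain ⟨v, hv⟩ : ∃ v, v = corner q 2 j := ⟨_, rfl⟩
  have hfu : fold q u = i := by rw [hu, fold_corner (by omega)]
  have hfv : fold q v = j := by rw [hv, fold_corner (by omega)]
  change LiftArc q S B c (corner q 0 i) (corner q 2 j) ∨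
    LiftArc q S B c (corner q 2 j) (corner q 0 i) at h
  rw [← hu, ← hv] at h
  have h3 := fold_zero_diameter (q := q)
  rcases h with h | h
  · cases h with
    | straight s k l h =>
      exfalso
      have hb := hL.straight_bounds _ _ h
      rw [fold_corner (by omega)] at hfu hfv
      subst hfu hfv
      have := corner_injective (by omega) hb.2 hv
      subst this
      exact corner_opposite_ne (by omega) 0 hu.symm
    | diameter => omega
    | twisted s k l h =>
      have hb := hL.twisted_bounds _ _ h
      rw [fold_corner (by omega)] at hfu hfv
      subst hfu hfv
      exact h
  · exfalso
    have hlt := hL.fold_lt h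
    rw [hfu, hfv] at hlt
    rcases hlt with hlt | hlt
    · omega
    · rw [hlt.1] at hfv
      omega

end Liftable

end Lift

/-! ### Trees with Klein symmetry are lifts -/

/-- The adjacency relation of a tree of genus one on the points `0, …, 4 q + 1` of the circle that
contains the edge from `0` to `2 q + 1` and is preserved by the half-turn and by the reflection. -/
structure KleinSymmetric (q : ℕ) (A : ℕ → ℕ → Prop) : Prop where
  lt : ∀ u v, A u v → u < 4 * q + 2
  symm : ∀ u v, A u v → A v u
  halfTurn : ∀ u v, A u v → A (halfTurn q u) (halfTurn q v)
  flipOver : ∀ u v, A u v → A (flipOver q u) (flipOver q v)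
  diameter : A 0 (2 * q + 1)
  handle : ∀ a b c d u v w x, A a b → A c d → A u v → A w x → ChordsCross a b c d →
    (ChordsCross u v w x ↔ ¬ (ChordsCross u v a b ∧ ChordsCross w x c d ↔
      ChordsCross u v c d ∧ ChordsCross w x a b))
  eq_diameter : ∀ u v, A u v → fold q u = fold q v →
    (u = 0 ∧ v = 2 * q + 1) ∨ (u = 2 * q + 1 ∧ v = 0)

open Classical in
/-- The straight arcs on the line `0, …, q` in the relation `A`. -/
noncomputable def straightPart (q : ℕ) (A : ℕ → ℕ → Prop) : Finset (ℕ × ℕ) :=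
  (Finset.range (q + 1) ×ˢ Finset.range (q + 1)).filter fun p => p.1 < p.2 ∧ A p.1 p.2

open Classical in
/-- The arcs on the line `0, …, q` with a twisted copy in the relation `A`. -/
noncomputable def twistedPart (q : ℕ) (A : ℕ → ℕ → Prop) : Finset (ℕ × ℕ) :=
  (Finset.range (q + 1) ×ˢ Finset.range (q + 1)).filter fun p =>
    1 ≤ p.1 ∧ p.1 < p.2 ∧ A p.1 (2 * q + 1 + p.2)

theorem mem_straightPart {q : ℕ} {A : ℕ → ℕ → Prop} {i j : ℕ} :
    (i, j) ∈ straightPart q A ↔ i < j ∧ j ≤ q ∧ A i j := by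
  simp only [straightPart, Finset.mem_filter, Finset.mem_product, Finset.mem_range]
  constructor
  · rintro ⟨h1, h2, h3⟩
    exact ⟨h2, by omega, h3⟩
  · rintro ⟨h1, h2, h3⟩
    exact ⟨by omega, h1, h3⟩

theorem mem_twistedPart {q : ℕ} {A : ℕ → ℕ → Prop} {i j : ℕ} :
    (i, j) ∈ twistedPart q A ↔ 1 ≤ i ∧ i < j ∧ j ≤ q ∧ A i (2 * q + 1 + j) := by
  simp only [twistedPart, Finset.mem_filter, Finset.mem_product, Finset.mem_range]
  constructor
  · rintro ⟨h1, h2, h3, h4⟩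
    exact ⟨h2, h3, by omega, h4⟩
  · rintro ⟨h1, h2, h3, h4⟩
    exact ⟨by omega, h1, h2, h4⟩

theorem fold_halfTurn {q w : ℕ} (hw : w < 4 * q + 2) : fold q (halfTurn q w) = fold q w := by
  obtain ⟨s, hs⟩ := exists_corner_eq hw
  rw [← hs, halfTurn_corner (fold_le hw), fold_corner (fold_le hw), fold_corner (fold_le hw)]

theorem fold_flipOver {q w : ℕ} (hw : w < 4 * q + 2) : fold q (flipOver q w) = fold q w := by
  obtain ⟨s, hs⟩ := exists_corner_eq hw
  rw [← hs, flipOver_corner (fold_le hw), fold_corner (fold_le hw), fold_corner (fold_le hw)]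

namespace KleinSymmetric

variable {q : ℕ} {A : ℕ → ℕ → Prop}

theorem lt_right (hA : KleinSymmetric q A) {u v : ℕ} (h : A u v) : v < 4 * q + 2 :=
  hA.lt _ _ (hA.symm _ _ h)

theorem corner_add_two (hA : KleinSymmetric q A) {i j : ℕ} (hi : i ≤ q) (hj : j ≤ q) {s t : Fin 4}
    (h : A (corner q s i) (corner q t j)) : A (corner q (s + 2) i) (corner q (t + 2) j) := by
  have := hA.halfTurn _ _ h
  rwa [halfTurn_corner hi, halfTurn_corner hj] at this

theorem corner_three_sub (hA : KleinSymmetric q A) {i j : ℕ} (hi : i ≤ q) (hj : j ≤ q)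
    {s t : Fin 4} (h : A (corner q s i) (corner q t j)) :
    A (corner q (3 - s) i) (corner q (3 - t) j) := by
  have := hA.flipOver _ _ h
  rwa [flipOver_corner hi, flipOver_corner hj] at this

/-- In a complete multipartite graph, a vertex that is not isolated is adjacent to at least one end
of every edge. -/
theorem crosses (hA : KleinSymmetric q A) {a b c d u v w x : ℕ} (hab : A a b) (hcd : A c d)
    (huv : A u v) (hwx : A w x) (h : ChordsCross a b c d) (h' : ChordsCross u v w x) :
    ChordsCross u v a b ∨ ChordsCross u v c d := by
  have := hA.handle _ _ _ _ _ _ _ _ hab hcd huv hwx h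
  tauto

/-- The four images of such an edge form two crossing pairs, one in each half of the circle, that do
not cross each other; this contradicts `crosses`. -/
theorem not_mirror (hA : KleinSymmetric q A) {i j : ℕ} (hij : i < j) (hj : j ≤ q) :
    ¬ A (corner q 0 i) (corner q 1 j) := by
  intro h
  have h2 := hA.corner_add_two (by omega) hj h
  have h3 := hA.corner_three_sub (by omega) hj h
  have h4 := hA.corner_add_two (by omega) hj h3
  change A (corner q 2 i) (corner q 3 j) at h2
  change A (corner q 3 i) (corner q 2 j) at h3
  change A (corner q 1 i) (corner q 0 j) at h4
  simp only [corner] at h h2 h3 h4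
  rw [if_neg (by omega)] at h2
  rcases hA.crosses h h4 h2 h3 (by unfold ChordsCross StrictlyBetween; omega)
    (by unfold ChordsCross StrictlyBetween; split <;> omega) with h | h <;>
    unfold ChordsCross StrictlyBetween at h <;> omega

/-- As in `not_mirror`, with one crossing pair around the point `0` and the other around `2 q + 1`.
-/
theorem not_reflected (hA : KleinSymmetric q A) {i j : ℕ} (hi : 1 ≤ i) (hij : i < j) (hj : j ≤ q) :
    ¬ A (corner q 0 i) (corner q 3 j) := by
  intro h
  have h2 := hA.corner_add_two (by omega) hj h
  have h3 := hA.corner_three_sub (by omega) hj h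
  have h4 := hA.corner_add_two (by omega) hj h3
  change A (corner q 2 i) (corner q 1 j) at h2
  change A (corner q 3 i) (corner q 0 j) at h3
  change A (corner q 1 i) (corner q 2 j) at h4
  simp only [corner] at h h2 h3 h4
  rw [if_neg (by omega)] at h h3
  rcases hA.crosses h h3 h2 h4 (by unfold ChordsCross StrictlyBetween; omega)
    (by unfold ChordsCross StrictlyBetween; omega) with h | h <;>
    unfold ChordsCross StrictlyBetween at h <;> omega

theorem liftable (hA : KleinSymmetric q A) : Liftable q (straightPart q A) (twistedPart q A) where
  straight_bounds i j h := by
    rw [mem_straightPart] at h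
    omega
  twisted_bounds i j h := by
    rw [mem_twistedPart] at h
    omega
  -- A crossing and its image under the half-turn would be two crossing pairs far apart.
  noncrossing i j k l h h' hik hkj hjl := by
    rw [mem_straightPart] at h h'
    have h2 := hA.corner_add_two (s := 0) (t := 0) (by omega) (by omega) h.2.2
    have h3 := hA.corner_add_two (s := 0) (t := 0) (by omega) (by omega) h'.2.2
    change A (2 * q + 1 + i) (2 * q + 1 + j) at h2
    change A (2 * q + 1 + k) (2 * q + 1 + l) at h3
    rcases hA.crosses h.2.2 h'.2.2 h2 h3 (by unfold ChordsCross StrictlyBetween; omega)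
      (by unfold ChordsCross StrictlyBetween; omega) with h | h <;>
      unfold ChordsCross StrictlyBetween at h <;> omega
  nested := by
    have key : ∀ i j k l, (i, j) ∈ twistedPart q A → (k, l) ∈ twistedPart q A → i < k →
        j < l → False := by
      intro i j k l h h' hik hjl
      rw [mem_twistedPart] at h h'
      obtain ⟨hi, hij, hjq, h⟩ := h
      obtain ⟨hk, hkl, hlq, h'⟩ := h'
      have h2 := hA.corner_three_sub (s := 0) (t := 2) (by omega) (by omega) h
      change A (corner q 3 i) (corner q 1 j) at h2
      simp only [corner] at h2
      rw [if_neg (by omega)] at h2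
      -- If the arcs were not nested, the two twisted edges, the diameter and a reflected copy of
      -- the first would cross pairwise, and three parts do not allow this.
      have h3 := hA.handle _ _ _ _ _ _ _ _ h h' hA.diameter h2
        (by unfold ChordsCross StrictlyBetween; omega)
      have x1 : ChordsCross 0 (2 * q + 1) (4 * q + 2 - i) (2 * q + 1 - j) := by
        unfold ChordsCross StrictlyBetween; omega
      have x2 : ChordsCross 0 (2 * q + 1) i (2 * q + 1 + j) := by
        unfold ChordsCross StrictlyBetween; omega
      have x3 : ChordsCross 0 (2 * q + 1) k (2 * q + 1 + l) := by
        unfold ChordsCross StrictlyBetween; omega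
      have x4 : ChordsCross (4 * q + 2 - i) (2 * q + 1 - j) i (2 * q + 1 + j) := by
        unfold ChordsCross StrictlyBetween; omega
      have x5 : ChordsCross (4 * q + 2 - i) (2 * q + 1 - j) k (2 * q + 1 + l) := by
        unfold ChordsCross StrictlyBetween; omega
      tauto
    intro i j k l h h'
    have h1 := key i j k l h h'
    have h2 := key k l i j h' h
    by_contra
    rcases lt_trichotomy i k with h3 | h3 | h3 <;> rcases lt_trichotomy j l with h4 | h4 | h4 <;>
      first | exact h1 h3 h4 | exact h2 h3 h4 | omega
  uncovered i j k l h h' := by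
    rw [mem_straightPart] at h
    rw [mem_twistedPart] at h'
    obtain ⟨hij, hjq, h⟩ := h
    obtain ⟨hk, hkl, hlq, h'⟩ := h'
    have h2 := hA.corner_three_sub (s := 0) (t := 2) (by omega) (by omega) h'
    have h3 := hA.corner_add_two (s := 0) (t := 2) (by omega) (by omega) h'
    change A (corner q 3 k) (corner q 1 l) at h2
    change A (2 * q + 1 + k) l at h3
    simp only [corner] at h2
    rw [if_neg (by omega)] at h2
    have x1 : ChordsCross 0 (2 * q + 1) (4 * q + 2 - k) (2 * q + 1 - l) := by
      unfold ChordsCross StrictlyBetween; omega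
    -- The straight edge would cross a copy of the twisted edge, but it crosses neither the diameter
    -- nor the reflected copy, which cross each other.
    constructor <;> intro hc
    · rcases hA.crosses hA.diameter h2 h h' x1 (by unfold ChordsCross StrictlyBetween; omega)
        with h | h <;> unfold ChordsCross StrictlyBetween at h <;> omega
    · rcases hA.crosses hA.diameter h2 h h3 x1 (by unfold ChordsCross StrictlyBetween; omega)
        with h | h <;> unfold ChordsCross StrictlyBetween at h <;> omega

theorem of_liftArc (hA : KleinSymmetric q A) {c : Fin 4} {u v : ℕ}
    (h : LiftArc q (straightPart q A) (twistedPart q A) c u v) : A u v := by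
  have key : ∀ i j, i ≤ q → j ≤ q → ∀ δ : Fin 4, δ = 0 ∨ δ = 2 →
      A (corner q 0 i) (corner q δ j) → ∀ s, A (corner q s i) (corner q (s + δ) j) := by
    intro i j hi hj δ hδ h s
    have h2 := hA.corner_add_two hi hj h
    have h3 := hA.corner_three_sub hi hj h
    have h4 := hA.corner_add_two hi hj h3
    rcases hδ with rfl | rfl <;> fin_cases s
    exacts [h, h4, h2, h3, h, h4, h2, h3]
  cases h with
  | straight s i j h =>
    rw [mem_straightPart] at h
    have := key i j (by omega) (by omega) 0 (.inl rfl) h.2.2 s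
    rwa [add_zero] at this
  | diameter => exact hA.diameter
  | twisted s i j h =>
    rw [mem_twistedPart] at h
    exact key i j (by omega) (by omega) 2 (.inr rfl) h.2.2.2 s

/-- The symmetries bring the end with the smaller fold to the first quarter of the circle; the copy
in which the other end lies then decides the type of the arc. -/
theorem exists_liftArc (hA : KleinSymmetric q A) {u v : ℕ} (h : A u v) :
    ∃ c, LiftArc q (straightPart q A) (twistedPart q A) c u v ∨
      LiftArc q (straightPart q A) (twistedPart q A) c v u := by
  have hL := hA.liftable
  set S := straightPart q A with hS
  set B := twistedPart q A with hB
  have base : ∀ i j t, i < j → j ≤ q → A (corner q 0 i) (corner q t j) →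
      ∃ c, LiftArc q S B c (corner q 0 i) (corner q t j) := by
    intro i j t hij hj h
    have ht : ∀ t : Fin 4, t = 0 ∨ t = 1 ∨ t = 2 ∨ t = 3 := by decide
    rcases ht t with rfl | rfl | rfl | rfl
    · exact ⟨_, .straight 0 i j (mem_straightPart.2 ⟨hij, hj, h⟩)⟩
    · exact (hA.not_mirror hij hj h).elim
    -- The point `0` is its own reflection, so an edge from it to the copies 2 or 3 reflects to the
    -- copies 1 or 0.
    · rcases Nat.eq_zero_or_pos i with rfl | hi
      · exact (hA.not_mirror hij hj (hA.corner_three_sub (by omega) hj h)).elim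
      · exact ⟨_, .twisted 0 i j (mem_twistedPart.2 ⟨hi, hij, hj, h⟩)⟩
    · rcases Nat.eq_zero_or_pos i with rfl | hi
      · exact ⟨_, .straight 3 0 j (mem_straightPart.2
          ⟨hij, hj, hA.corner_three_sub (s := 3) (t := 3) (by omega) hj h⟩)⟩
      · exact (hA.not_reflected hi hij hj h).elim
  have left : ∀ u v, A u v → u ≤ q → fold q u < fold q v → ∃ c, LiftArc q S B c u v := by
    intro u v h hu huv
    have hv := hA.lt_right h
    obtain ⟨t, ht⟩ := exists_corner_eq hv
    rw [fold, if_pos hu] at huv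
    have := base u (fold q v) t huv (fold_le hv)
    rw [ht] at this
    exact this h
  have unturn : ∀ u v, u < 4 * q + 2 → v < 4 * q + 2 →
      (∃ c, LiftArc q S B c (CircleTree.halfTurn q u) (CircleTree.halfTurn q v) ∨
        LiftArc q S B c (CircleTree.halfTurn q v) (CircleTree.halfTurn q u)) →
      ∃ c, LiftArc q S B c u v ∨ LiftArc q S B c v u := by
    rintro u v hu hv ⟨c, h | h⟩
    · have := h.exists_halfTurn hL
      rw [halfTurn_halfTurn hu, halfTurn_halfTurn hv] at this
      exact ⟨c, this⟩
    · have := h.exists_halfTurn hL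
      rw [halfTurn_halfTurn hu, halfTurn_halfTurn hv] at this
      exact ⟨c, this.symm⟩
  have unflip : ∀ u v, u < 4 * q + 2 → v < 4 * q + 2 →
      (∃ c, LiftArc q S B c (CircleTree.flipOver q u) (CircleTree.flipOver q v) ∨
        LiftArc q S B c (CircleTree.flipOver q v) (CircleTree.flipOver q u)) →
      ∃ c, LiftArc q S B c u v ∨ LiftArc q S B c v u := by
    rintro u v hu hv ⟨c, h | h⟩
    · obtain ⟨d, this⟩ := h.exists_flipOver hL
      rw [flipOver_flipOver hu, flipOver_flipOver hv] at this
      exact ⟨d, .inl this⟩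
    · obtain ⟨d, this⟩ := h.exists_flipOver hL
      rw [flipOver_flipOver hu, flipOver_flipOver hv] at this
      exact ⟨d, .inr this⟩
  have ordered : ∀ u v, A u v → fold q u < fold q v →
      ∃ c, LiftArc q S B c u v ∨ LiftArc q S B c v u := by
    intro u v h huv
    have hu := hA.lt _ _ h
    have hv := hA.lt_right h
    by_cases h1 : u ≤ q
    · obtain ⟨c, hc⟩ := left u v h h1 huv
      exact ⟨c, .inl hc⟩
    have hf := hA.flipOver _ _ h
    have hfu := hA.lt _ _ hf
    have hfv := hA.lt_right hf
    by_cases h2 : 3 * q + 2 ≤ u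
    · refine unflip u v hu hv ?_
      obtain ⟨c, hc⟩ := left _ _ hf
        (by rw [CircleTree.flipOver, if_neg (by omega)]; omega)
        (by rwa [fold_flipOver hu, fold_flipOver hv])
      exact ⟨c, .inl hc⟩
    by_cases h3 : 2 * q + 1 < u
    · refine unturn u v hu hv ?_
      obtain ⟨c, hc⟩ := left _ _ (hA.halfTurn _ _ h)
        (by rw [CircleTree.halfTurn, if_neg (by omega)]; omega)
        (by rwa [fold_halfTurn hu, fold_halfTurn hv])
      exact ⟨c, .inl hc⟩
    · refine unflip u v hu hv (unturn _ _ hfu hfv ?_)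
      obtain ⟨c, hc⟩ := left _ _ (hA.halfTurn _ _ hf)
        (by
          have e : CircleTree.flipOver q u = 4 * q + 2 - u := if_neg (by omega)
          rw [e, CircleTree.halfTurn, if_neg (by omega)]
          omega)
        (by rwa [fold_halfTurn hfu, fold_halfTurn hfv, fold_flipOver hu, fold_flipOver hv])
      exact ⟨c, .inl hc⟩
  rcases lt_trichotomy (fold q u) (fold q v) with h1 | h1 | h1
  · exact ordered u v h h1
  · rcases hA.eq_diameter u v h h1 with ⟨rfl, rfl⟩ | ⟨rfl, rfl⟩
    · exact ⟨1, .inl .diameter⟩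
    · exact ⟨1, .inr .diameter⟩
  · obtain ⟨c, hc⟩ := ordered v u (hA.symm _ _ h) h1
    exact ⟨c, hc.symm⟩

end KleinSymmetric

/-! ### The bijection between twisted trees and Klein symmetric trees -/

variable {q : ℕ}

theorem TwistedTree.liftable {E B : Finset (ℕ × ℕ)} (hT : TwistedTree q E B) :
    Liftable q (E \ B) B where
  straight_bounds i j h := (hT.tree.bounds i j (Finset.mem_sdiff.1 h).1).2
  noncrossing i j k l h h' :=
    hT.tree.noncrossing i j k l (Finset.mem_sdiff.1 h).1 (Finset.mem_sdiff.1 h').1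
  twisted_bounds i j h := ⟨hT.one_le i j h, (hT.tree.bounds i j (hT.subset h)).2⟩
  nested := hT.nested
  uncovered i j k l h := hT.uncovered i j k l (Finset.mem_sdiff.1 h).1 (Finset.mem_sdiff.1 h).2

/-- Connectedness needs at least `q` arcs in the union, so the number of arcs forces the two
families to be disjoint. -/
theorem Liftable.twistedTree {S B : Finset (ℕ × ℕ)} (hL : Liftable q S B)
    (hB : B.Nonempty) (hJ : ∀ v ≤ q, Joined (S ∪ B) 0 v) (hc : S.card + B.card = q) :
    TwistedTree q (S ∪ B) B ∧ (S ∪ B) \ B = S := by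
  have hle : q ≤ (S ∪ B).card + 0 := le_card_of_joined fun v _ hv => hJ v hv
  have hun := Finset.card_union_add_card_inter S B
  have hdisj : Disjoint S B := by
    rw [Finset.disjoint_iff_inter_eq_empty, ← Finset.card_eq_zero]
    omega
  refine ⟨⟨⟨?_, ?_, fun v _ => hJ v, by omega⟩, Finset.subset_union_right, hB,
    fun i j h => (hL.twisted_bounds i j h).1, hL.nested, fun i j k l h hn => ?_⟩,
    Finset.union_sdiff_cancel_right hdisj⟩
  · intro i j h
    rcases Finset.mem_union.1 h with h | h
    · exact ⟨Nat.zero_le _, hL.straight_bounds i j h⟩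
    · exact ⟨Nat.zero_le _, (hL.twisted_bounds i j h).2⟩
  · intro i j k l h h' hik hkj hjl
    rcases Finset.mem_union.1 h with h | h <;> rcases Finset.mem_union.1 h' with h' | h'
    · exact hL.noncrossing _ _ _ _ h h' hik hkj hjl
    · exact (hL.uncovered _ _ _ _ h h').1 ⟨hik, hkj⟩
    · exact (hL.uncovered _ _ _ _ h' h).2 ⟨hkj, hjl⟩
    · have := hL.nested _ _ _ _ h h'
      omega
  · exact hL.uncovered i j k l ((Finset.mem_union.1 h).resolve_right hn)

theorem TwistedTree.lift_mem {E B : Finset (ℕ × ℕ)} (hT : TwistedTree q E B)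
    {h : Fin (4 * q + 2)} (hh : h.val = 2 * q + 1) :
    lift q (E \ B) B ∈ SymmetricTrees h ∧ reflect (lift q (E \ B) B) = lift q (E \ B) B := by
  have hL := hT.liftable
  refine ⟨⟨⟨hL.isTree_iff.2 ⟨?_, ?_⟩, hL.hasOneHandle_iff.2 hT.nonempty⟩, hL.rotate_lift hh,
    (hL.adj_iff _ _).2 ⟨1, .inl ?_⟩⟩, hL.reflect_lift⟩
  · rw [Finset.sdiff_union_of_subset hT.subset]
    exact fun v hv => hT.tree.joined v (Nat.zero_le v) hv
  · rw [Finset.card_sdiff_add_card_eq_card hT.subset]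
    exact hT.tree.card_add
  · rw [hh]
    exact .diameter

theorem kleinSymmetric {h : Fin (4 * q + 2)} (hh : h.val = 2 * q + 1)
    {G : SimpleGraph (Fin (4 * q + 2))} (hG : G ∈ SymmetricTrees h) (hr : reflect G = G) :
    KleinSymmetric q fun u v => ∃ x y, G.Adj x y ∧ x.val = u ∧ y.val = v := by
  obtain ⟨⟨htree, -, hcross⟩, hrot, hadj⟩ := hG
  have h0 : h + h = 0 := half_add_half (by ring : 4 * q + 2 = 2 * (2 * q + 1)) hh
  have hturn : ∀ u v, G.Adj u v → G.Adj (u + h) (v + h) := fun u v huv => by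
    rwa [← rotate_adj, hrot]
  have hflip : ∀ u v, G.Adj u v → G.Adj (-u) (-v) := fun u v huv => by
    rwa [← reflect_adj, hr]
  refine ⟨?_, ?_, ?_, ?_, ⟨0, h, hadj, rfl, hh⟩, ?_, ?_⟩
  · rintro _ _ ⟨x, y, -, rfl, rfl⟩
    exact x.isLt
  · rintro _ _ ⟨x, y, hxy, rfl, rfl⟩
    exact ⟨y, x, hxy.symm, rfl, rfl⟩
  · rintro _ _ ⟨x, y, hxy, rfl, rfl⟩
    exact ⟨_, _, hturn _ _ hxy, val_add_half hh _, val_add_half hh _⟩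
  · rintro _ _ ⟨x, y, hxy, rfl, rfl⟩
    exact ⟨_, _, hflip _ _ hxy, val_neg_eq_flipOver _, val_neg_eq_flipOver _⟩
  · rintro _ _ _ _ _ _ _ _ ⟨a, b, hab, rfl, rfl⟩ ⟨c, d, hcd, rfl, rfl⟩ ⟨u, v, huv, rfl, rfl⟩
      ⟨w, x, hwx, rfl, rfl⟩ hX
    exact hcross a b c d u v w x hab hcd huv hwx hX
  · rintro _ _ ⟨x, y, hxy, rfl, rfl⟩ hf
    -- Points with the same fold form an orbit of the four symmetries. The reflection flips no edge
    -- as it fixes `0`; the other two nontrivial symmetries flip the diameter and hence no other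
    -- edge.
    have hcases : y = x ∨ y = -x ∨ y = x + h ∨ y = -x + h := by
      simp only [Fin.ext_iff, val_add_half hh, val_neg_eq_flipOver]
      have hx := x.isLt
      have hy := y.isLt
      simp only [fold, halfTurn, flipOver] at hf ⊢
      split_ifs at hf <;> split_ifs <;> omega
    have main : ∀ τ : Fin (4 * q + 2) → Fin (4 * q + 2), Function.Injective τ →
        (∀ u v, G.Adj u v → G.Adj (τ u) (τ v)) → τ 0 = h → τ h = 0 → y = τ x →
        (x.val = 0 ∧ y.val = 2 * q + 1) ∨ (x.val = 2 * q + 1 ∧ y.val = 0) := by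
      intro τ hinj hτ h1 h2 hy
      subst hy
      rcases htree.eq_of_flip hinj hτ hadj h1 h2 hxy with rfl | rfl
      · exact .inl ⟨rfl, by rw [h1, hh]⟩
      · exact .inr ⟨hh, by rw [h2]; rfl⟩
    rcases hcases with e | e | e | e
    · exact (hxy.ne e.symm).elim
    · exfalso
      refine htree.ne_of_flip neg_injective hflip hxy e.symm ?_ 0 neg_zero
      rw [e, neg_neg]
    · exact main (fun x => x + h) (add_left_injective h) hturn (zero_add h) h0 e
    · exact main (fun x => -x + h) ((add_left_injective h).comp neg_injective)
        (fun u v huv => hturn _ _ (hflip _ _ huv)) (by simp) (by simp) e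

theorem exists_twistedTree {h : Fin (4 * q + 2)} (hh : h.val = 2 * q + 1)
    {G : SimpleGraph (Fin (4 * q + 2))} (hG : G ∈ SymmetricTrees h) (hr : reflect G = G) :
    ∃ E B, TwistedTree q E B ∧ lift q (E \ B) B = G := by
  have hA := kleinSymmetric hh hG hr
  have hL := hA.liftable
  have hlift : lift q (straightPart q fun u v => ∃ x y, G.Adj x y ∧ x.val = u ∧ y.val = v)
      (twistedPart q fun u v => ∃ x y, G.Adj x y ∧ x.val = u ∧ y.val = v) = G := by
    ext u v
    rw [hL.adj_iff]
    constructor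
    · rintro ⟨c, hc | hc⟩
      · obtain ⟨x, y, hxy, hx, hy⟩ := hA.of_liftArc hc
        rwa [← Fin.ext hx, ← Fin.ext hy]
      · obtain ⟨x, y, hxy, hx, hy⟩ := hA.of_liftArc hc
        rw [← Fin.ext hx, ← Fin.ext hy]
        exact hxy.symm
    · exact fun huv => hA.exists_liftArc ⟨u, v, huv, rfl, rfl⟩
  have htree := hG.1.1
  have hhandle := hG.1.2
  rw [← hlift] at htree hhandle
  have hJ := hL.isTree_iff.1 htree
  obtain ⟨h1, h2⟩ := hL.twistedTree (hL.hasOneHandle_iff.1 hhandle) hJ.1 hJ.2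
  exact ⟨_, _, h1, by rw [h2, hlift]⟩

theorem TwistedTree.eq_of_lift_eq {E B E' B' : Finset (ℕ × ℕ)} (hT : TwistedTree q E B)
    (hT' : TwistedTree q E' B') (h : lift q (E \ B) B = lift q (E' \ B') B') :
    E = E' ∧ B = B' := by
  have hL := hT.liftable
  have hL' := hT'.liftable
  have hS : E \ B = E' \ B' := by
    ext ⟨i, j⟩
    by_cases hij : i < j ∧ j ≤ q
    · rw [← hL.lift_adj_straight hij.1 hij.2, ← hL'.lift_adj_straight hij.1 hij.2, h]
    · exact iff_of_false (fun e => hij (hL.straight_bounds i j e))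
        (fun e => hij (hL'.straight_bounds i j e))
  have hB : B = B' := by
    ext ⟨i, j⟩
    by_cases hij : i < j ∧ j ≤ q
    · rw [← hL.lift_adj_twisted hij.1 hij.2, ← hL'.lift_adj_twisted hij.1 hij.2, h]
    · exact iff_of_false (fun e => hij (hL.twisted_bounds i j e).2)
        (fun e => hij (hL'.twisted_bounds i j e).2)
  exact ⟨by rw [← Finset.sdiff_union_of_subset hT.subset, hS, hB,
    Finset.sdiff_union_of_subset hT'.subset], hB⟩

theorem card_reflect_symmetricTrees {h : Fin (4 * q + 2)} (hh : h.val = 2 * q + 1) :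
    Nat.card {G : SimpleGraph (Fin (4 * q + 2)) | G ∈ SymmetricTrees h ∧ reflect G = G} =
      (twistedTrees q).card := by
  have himage : {G : SimpleGraph (Fin (4 * q + 2)) | G ∈ SymmetricTrees h ∧ reflect G = G} =
      (fun p : Finset (ℕ × ℕ) × Finset (ℕ × ℕ) => lift q (p.1 \ p.2) p.2) '' twistedTrees q := by
    ext G
    constructor
    · rintro ⟨hG, hr⟩
      obtain ⟨E, B, hT, rfl⟩ := exists_twistedTree hh hG hr
      exact ⟨(E, B), mem_twistedTrees.2 hT, rfl⟩
    · rintro ⟨p, hp, rfl⟩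
      exact (mem_twistedTrees.1 hp).lift_mem hh
  rw [Nat.card_coe_set_eq, himage, Set.InjOn.ncard_image, Set.ncard_coe_finset]
  rintro ⟨E, B⟩ hp ⟨E', B'⟩ hp' e
  obtain ⟨rfl, rfl⟩ := (mem_twistedTrees.1 hp).eq_of_lift_eq (mem_twistedTrees.1 hp') e
  rfl

/-! ### Negligent numbers and divisibility -/

/-- Final doublings give the power of two; before them stands an application of `k ↦ 4 k + 1` or the
start `1`, which is the case `w = 0`. -/
theorem generatedFromOne_iff {v : ℕ} :
    GeneratedFromOne v ↔ ∃ j w, IsNegligent w ∧ v = 2 ^ j * (4 * w + 1) := by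
  constructor
  · intro h
    induction h with
    | one => exact ⟨0, 0, .inl rfl, rfl⟩
    | double k _ ih =>
      obtain ⟨j, w, hw, rfl⟩ := ih
      exact ⟨j + 1, w, hw, by ring⟩
    | quadruple k hk => exact ⟨0, k, .inr hk, by ring⟩
  · rintro ⟨j, w, hw, rfl⟩
    induction j with
    | zero =>
      rw [pow_zero, one_mul]
      rcases hw with rfl | hw
      · exact .one
      · exact .quadruple w hw
    | succ j ih =>
      rw [pow_succ', mul_assoc]
      exact .double _ ih

theorem GeneratedFromOne.pos {v : ℕ} (h : GeneratedFromOne v) : 1 ≤ v := by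
  induction h <;> omega

theorem odd_card_symmetricTrees_iff {n m : ℕ} [NeZero n] {h : Fin n} (hnm : n = 2 * m)
    (hh : h.val = m) :
    Odd (Nat.card (SymmetricTrees h)) ↔ ∃ v, GeneratedFromOne v ∧ n = 8 * v + 2 := by
  rw [odd_card_symmetricTrees hnm hh]
  rcases Nat.even_or_odd m with hm | ⟨q, hq⟩
  · have hempty : {G : SimpleGraph (Fin n) | G ∈ SymmetricTrees h ∧ reflect G = G} = ∅ :=
      Set.eq_empty_of_forall_notMem fun G hG =>
        IsGenusOneTree.not_reflect_of_even hnm hh hm hG.1 hG.2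
    rw [hempty, Nat.card_coe_set_eq, Set.ncard_empty]
    obtain ⟨k, hk⟩ := hm
    refine iff_of_false (by decide) ?_
    rintro ⟨v, -, hv⟩
    omega
  · obtain rfl : n = 4 * q + 2 := by omega
    rw [card_reflect_symmetricTrees (hh.trans hq), odd_card_twistedTrees]
    refine exists_congr fun v => ?_
    rw [odd_treeCount_iff, IsNegligent]
    constructor
    · rintro ⟨h1, h2, h3 | h3⟩
      · omega
      · exact ⟨h3, by omega⟩
    · rintro ⟨h1, h2⟩
      exact ⟨h1.pos, by omega, .inr h1⟩

theorem half_dvd_f {m : ℕ} (hm : 1 ≤ m) : m ∣ f (2 * m) := by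
  have : NeZero (2 * m) := ⟨by omega⟩
  obtain ⟨a, ha⟩ := exists_f_eq (n := 2 * m) (h := ⟨m, by omega⟩) rfl rfl
  rw [ha]
  exact dvd_add ⟨2 * a, by ring⟩ (dvd_mul_right _ _)

theorem dvd_f_of_odd {n : ℕ} (hn : 2 ≤ n) (hodd : Odd n) : n ∣ f n := by
  have : NeZero n := ⟨by omega⟩
  refine dvd_f_of_no_halfTurn hn fun s hs => ?_
  obtain ⟨k, hk⟩ := hodd
  have h1 : (s + s).val = 0 := by rw [hs]; rfl
  have := s.isLt
  rw [Fin.val_add_eq_ite] at h1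
  refine Fin.ext ?_
  rw [Fin.val_zero]
  split_ifs at h1 <;> omega

/-- In `f n = n a + m b` with `n = 2 m`, divisibility by `n` says that `b` is even. -/
theorem not_dvd_f_iff {n : ℕ} (hn : 2 ≤ n) :
    ¬ n ∣ f n ↔ ∃ v, GeneratedFromOne v ∧ n = 8 * v + 2 := by
  rcases Nat.even_or_odd' n with ⟨m, rfl | rfl⟩
  · have : NeZero (2 * m) := ⟨by omega⟩
    obtain ⟨a, ha⟩ := exists_f_eq (n := 2 * m) (h := ⟨m, by omega⟩) rfl rfl
    rw [← odd_card_symmetricTrees_iff (n := 2 * m) (h := ⟨m, by omega⟩) rfl rfl, ha,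
      Nat.dvd_add_right (dvd_mul_right _ _)]
    generalize Nat.card _ = b
    rw [mul_comm 2 m, Nat.mul_dvd_mul_iff_left (by omega), ← even_iff_two_dvd, Nat.not_even_iff_odd]
  · refine iff_of_false (not_not.2 (dvd_f_of_odd hn ⟨m, rfl⟩)) ?_
    rintro ⟨v, -, hv⟩
    omega

/-- Insert `v = 2^j (4 w + 1)`: the three forms are `j = 0`, `j = 1` and `j = k + 1` with `k ≥ 1`.
-/
theorem exists_generatedFromOne_iff (n : ℕ) :
    (∃ v, GeneratedFromOne v ∧ n = 8 * v + 2) ↔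
      (∃ v : ℕ, IsNegligent v ∧ n = 32 * v + 10) ∨
      (∃ v : ℕ, IsNegligent v ∧ n = 64 * v + 18) ∨
      (∃ k v : ℕ, 1 ≤ k ∧ IsNegligent v ∧ n = 64 * 2 ^ k * v + 16 * 2 ^ k + 2) := by
  constructor
  · rintro ⟨v, hv, rfl⟩
    obtain ⟨j, w, hw, rfl⟩ := generatedFromOne_iff.1 hv
    match j with
    | 0 => exact .inl ⟨w, hw, by ring⟩
    | 1 => exact .inr (.inl ⟨w, hw, by ring⟩)
    | k + 2 => exact .inr (.inr ⟨k + 1, w, by omega, hw, by ring⟩)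
  · rintro (⟨w, hw, rfl⟩ | ⟨w, hw, rfl⟩ | ⟨k, w, -, hw, rfl⟩)
    · exact ⟨_, generatedFromOne_iff.2 ⟨0, w, hw, rfl⟩, by ring⟩
    · exact ⟨_, generatedFromOne_iff.2 ⟨1, w, hw, rfl⟩, by ring⟩
    · exact ⟨_, generatedFromOne_iff.2 ⟨k + 1, w, hw, rfl⟩, by ring⟩

end CircleTree

theorem mainTheorem1 (n : ℕ) (hn : 3 < n) :
    (n ∣ CircleTree.f n ∨ (Even n ∧ n / 2 ∣ CircleTree.f n)) ∧
    (¬ n ∣ CircleTree.f n ↔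
      (∃ v : ℕ, CircleTree.IsNegligent v ∧ n = 32 * v + 10) ∨
      (∃ v : ℕ, CircleTree.IsNegligent v ∧ n = 64 * v + 18) ∨
      (∃ k v : ℕ, 1 ≤ k ∧ CircleTree.IsNegligent v ∧
        n = 64 * 2 ^ k * v + 16 * 2 ^ k + 2)) := by
  refine ⟨?_, (CircleTree.not_dvd_f_iff (by omega)).trans (CircleTree.exists_generatedFromOne_iff n)⟩
  rcases Nat.even_or_odd' n with ⟨m, rfl | rfl⟩
  · refine .inr ⟨even_two_mul m, ?_⟩
    rw [Nat.mul_div_cancel_left m (by omega)]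
    exact CircleTree.half_dvd_f (by omega)
  · exact .inl (CircleTree.dvd_f_of_odd (by omega) ⟨m, rfl⟩)
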